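/- **Channel.** Fix $k\ge 1$, centres $c=(c_0,\dots,c_k)\in\mathbb R^{k+1}$, radii $r=(r_0,\dots,r_k)$ with $r_i\ge 0$, and a power $P$. The time-varying Gaussian ISI channel is $$y_t=\sum_{i=0}^k h_{t,i}\,x_{t-i}+z_t,\qquad t=1,2,\dots,$$ where $z_1,z_2,\dots$ are i.i.d. $N(0,1)$ and the random taps satisfy $h_{t,i}\in[c_i-r_i,c_i+r_i]$ almost surely; their joint law is otherwise arbitrary and unknown to transmitter and receiver, and message, taps and noise are independent. For block length $n$ put $m=n+k$; then $y=Hx+z$, where $x\in\mathbb R^n$ is the input (with $x_t=0$ for $t\notin\{1,\dots,n\}$), $y,z\in\mathbb R^m$, and $H$ is the $m\times n$ matrix with $H_{i,j}=h_{i,i-j}$ if $0\le i-j\le k$ and $0$ otherwise. Let $H_c$ be the $m\times n$ matrix with entries $c_{i-j}$ if $0\le i-j\le k$ and $0$ otherwise. **Capacity.** A rate $R\ge 0$ is achievable if there are encoder-decoder pairs, one for each block length $n$ and not depending on the law of the taps, for $\lceil 2^{nR}\rceil$ equiprobable messages, whose codewords satisfy $\mathbb E\|x\|_2^2\le nP$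 (average over the messages) and whose decoding error probability $p_{e,n}$ tends to $0$ as $n\to\infty$ for every admissible joint law of the taps. $C^*$ is the supremum of all achievable rates. **Notation.** $\log$ is to base $2$; $x^+=\max\{0,x\}$; $\|r\|_2^2=\sum_i r_i^2$; $r_s=\sum_i r_i$; $f(\omega)=\sum_{l=0}^k c_l e^{\sqrt{-1}\,l\omega}$; $\alpha=\min_{\omega\in[0,2\pi]}|f(\omega)|$; $\beta=\max_{\omega\in[0,2\pi]}|f(\omega)|$. For positive-definite matrices $\Sigma_n\in\mathbb R^{n\times n}$ put $$\phi_{1,n}=\frac{r_s(r_s+2\beta)\lambda_{\max}(\Sigma_n)}{1+\alpha^2\lambda_{\min}(\Sigma_n)},\quad \phi_{2,n}=r_s(r_s+2\beta)\frac{\mathrm{tr}(\Sigma_n)}{m},\quad \phi_{3,n}=\frac{1}{1+r_s(r_s+2\beta)\lambda_{\max}(\Sigma_n)},$$ $$\delta_n=-\tfrac12\log(1-\phi_{1,n})+\frac{1}{2\ln 2}\bigl(1-(1-\phi_{2,n})^+\phi_{3,n}\bigr).$$ **Theorem.** Let $\Sigma_n$ be positive-definite $n\times n$ matrices with $\mathrm{tr}(\Sigma_n)\le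 nP$ for all $n$ and $\lambda_{\max}(\Sigma_n)/n\to 0$, and assume $\phi_{1,n}<1$ for all $n$. Then $$C^*\ \ge\ C^*_{LB}:=\liminf_{n\to\infty}\Bigl(\frac1{2n}\log\det(I_n+H_c^TH_c\Sigma_n)-\log\Bigl(1+(k+1)\|r\|_2^2\,\frac{\mathrm{tr}(\Sigma_n)}{m+n}\Bigr)-\delta_n\Bigr)$$ (as an inequality between extended real numbers). Moreover, $C^*_{LB}$ is achieved by Gaussian random codes with a joint-typicality decoder tuned to $H_c$: for every $0\le R<C^*_{LB}$ there are thresholds $\varepsilon>0$ and $\eta_n>0$, not depending on the law of the taps, such that, for every admissible joint law of the taps, the following error probability tends to $0$ as $n\to\infty$. The $\lceil 2^{nR}\rceil$ codewords $x_i$ are drawn independently from $N(0,\Sigma_n)$ (independently of message, taps and noise), and the decoder outputs the unique index $i$ with $$x_i\in\mathcal T^{(n)}_{\varepsilon}(\Sigma_n),\qquad \begin{bmatrix}x_i\\ y\end{bmatrix}\in\mathcal T^{(m+n)}_{\eta_n}(\Xi_n),\qquad \Xi_n=\begin{bmatrix}\Sigma_n&\Sigma_nH_c^T\\ H_c\Sigma_n&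 I_m+H_c\Sigma_nH_c^T\end{bmatrix},$$ an error being declared if there is no such index or more than one. Here $\mathcal T^{(d)}_\eta(\Sigma)=\{a\in\mathbb R^d: |\tfrac1d a^T\Sigma^{-1}a-1|<\eta\}$, and the error probability is averaged over the random code, the uniform message, the taps and the noise. -/

import Mathlib

open MeasureTheory ProbabilityTheory Filter Topology

noncomputable section

namespace ISI

/-! ### Channel

Time slots are numbered from `0`; a block of `n` inputs produces `m = n + k` outputs. -/

/-- An array of channel taps: `h t i` is the `i`-th tap during time slot `t`. -/
abbrev Taps (k : ℕ) : Type := ℕ → Fin (k + 1) → ℝ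

/-- The `(n + k) × n` channel matrix, with entry `h t (t - j)` at `(t, j)` when `0 ≤ t - j ≤ k`
and `0` elsewhere. -/
def channelMatrix {k : ℕ} (n : ℕ) (h : Taps k) : Matrix (Fin (n + k)) (Fin n) ℝ :=
  Matrix.of fun t j =>
    if hj : (j : ℕ) ≤ t ∧ (t : ℕ) - j ≤ k then h t ⟨(t : ℕ) - j, Nat.lt_succ_of_le hj.2⟩ else 0

/-- The matrix `H_c` of the time-invariant channel with taps `c`. -/
def centreMatrix {k : ℕ} (n : ℕ) (c : Fin (k + 1) → ℝ) : Matrix (Fin (n + k)) (Fin n) ℝ :=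
  channelMatrix n fun _ => c

/-- `ν` is a possible joint law of the tap array: a probability measure under which each tap
`h t i` lies in `[c i - r i, c i + r i]` almost surely.  Nothing else is assumed of it. -/
structure IsTapLaw {k : ℕ} (c r : Fin (k + 1) → ℝ) (ν : Measure (Taps k)) : Prop where
  prob : IsProbabilityMeasure ν
  supp : ∀ t i, ∀ᵐ h ∂ν, h t i ∈ Set.Icc (c i - r i) (c i + r i)

/-- White Gaussian noise of unit variance. -/
def noise (m : ℕ) : Measure (Fin m → ℝ) := Measure.pi fun _ => gaussianReal 0 1

/-- The channel output `H x + z`. -/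
def output {k n : ℕ} (h : Taps k) (x : Fin n → ℝ) (z : Fin (n + k) → ℝ) : Fin (n + k) → ℝ :=
  (channelMatrix n h).mulVec x + z

/-! ### Codes and capacity -/

/-- The number of messages `2 ^ (n R)`, rounded up. -/
def numMessages (n : ℕ) (R : ℝ) : ℕ := ⌈(2 : ℝ) ^ ((n : ℝ) * R)⌉₊

/-- An encoder-decoder pair with `M` messages and codewords of length `n`. -/
structure BlockCode (k n M : ℕ) where
  enc : Fin M → Fin n → ℝ
  dec : (Fin (n + k) → ℝ) → Fin M
  measurable_dec : Measurable dec

/-- Average power constraint, the message being uniformly distributed. -/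
def BlockCode.PowerConstraint {k n M : ℕ} (C : BlockCode k n M) (P : ℝ) : Prop :=
  (M : ℝ)⁻¹ * ∑ w, ∑ t, C.enc w t ^ 2 ≤ n * P

/-- The probability of decoding error when the message is uniform, the taps have law `ν`, and
message, taps and noise are independent. -/
def BlockCode.errorProb {k n M : ℕ} (C : BlockCode k n M) (ν : Measure (Taps k)) : ℝ :=
  (M : ℝ)⁻¹ * ∑ w,
    (ν.prod (noise (n + k))).real {p | C.dec (output p.1 (C.enc w) p.2) ≠ w}

/-- `R` is achievable: some sequence of encoder-decoder pairs, which does not depend on the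
law of the taps, has vanishing error probability whatever that law is. -/
def Achievable {k : ℕ} (c r : Fin (k + 1) → ℝ) (P R : ℝ) : Prop :=
  0 ≤ R ∧ ∃ C : ∀ n, BlockCode k n (numMessages n R),
    (∀ n, (C n).PowerConstraint P) ∧
    ∀ ν : Measure (Taps k), IsTapLaw c r ν →
      Tendsto (fun n => (C n).errorProb ν) atTop (𝓝 0)

/-- The capacity `C*(c, r, P)`. -/
def capacity {k : ℕ} (c r : Fin (k + 1) → ℝ) (P : ℝ) : EReal :=
  sSup ((fun R : ℝ => (R : EReal)) '' {R | Achievable c r P R})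

/-! ### The lower bound -/

/-- Largest eigenvalue of a real symmetric matrix. -/
def lamMax {n : ℕ} (A : Matrix (Fin n) (Fin n) ℝ) : ℝ := sSup (spectrum ℝ A)

/-- Smallest eigenvalue of a real symmetric matrix. -/
def lamMin {n : ℕ} (A : Matrix (Fin n) (Fin n) ℝ) : ℝ := sInf (spectrum ℝ A)

/-- `|f(ω)|`, where `f(ω) = ∑ₗ cₗ exp(i l ω)`. -/
def gain {k : ℕ} (c : Fin (k + 1) → ℝ) (ω : ℝ) : ℝ :=
  ‖∑ l : Fin (k + 1), (c l : ℂ) * Complex.exp (Complex.I * ((l : ℕ) : ℂ) * (ω : ℂ))‖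

/-- The minimum of `|f|` over `[0, 2π]`. -/
def alpha {k : ℕ} (c : Fin (k + 1) → ℝ) : ℝ := sInf (gain c '' Set.Icc 0 (2 * Real.pi))

/-- The maximum of `|f|` over `[0, 2π]`. -/
def beta {k : ℕ} (c : Fin (k + 1) → ℝ) : ℝ := sSup (gain c '' Set.Icc 0 (2 * Real.pi))

/-- The sum of the radii. -/
def rSum {k : ℕ} (r : Fin (k + 1) → ℝ) : ℝ := ∑ i, r i

def phi1 {k n : ℕ} (c r : Fin (k + 1) → ℝ) (S : Matrix (Fin n) (Fin n) ℝ) : ℝ :=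
  rSum r * (rSum r + 2 * beta c) * lamMax S / (1 + alpha c ^ 2 * lamMin S)

def phi2 {k n : ℕ} (c r : Fin (k + 1) → ℝ) (S : Matrix (Fin n) (Fin n) ℝ) : ℝ :=
  rSum r * (rSum r + 2 * beta c) * (S.trace / ((n : ℝ) + k))

def phi3 {k n : ℕ} (c r : Fin (k + 1) → ℝ) (S : Matrix (Fin n) (Fin n) ℝ) : ℝ :=
  1 / (1 + rSum r * (rSum r + 2 * beta c) * lamMax S)

/-- The loss `δₙ`, in bits. -/
def delta {k n : ℕ} (c r : Fin (k + 1) → ℝ) (S : Matrix (Fin n) (Fin n) ℝ) : ℝ :=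
  -(1 / 2) * Real.logb 2 (1 - phi1 c r S)
    + 1 / (2 * Real.log 2) * (1 - max 0 (1 - phi2 c r S) * phi3 c r S)

/-- The `n`-th term of the lower bound; here `m + n = (n + k) + n`. -/
def boundTerm {k n : ℕ} (c r : Fin (k + 1) → ℝ) (S : Matrix (Fin n) (Fin n) ℝ) : ℝ :=
  1 / (2 * (n : ℝ)) *
      Real.logb 2 (1 + (centreMatrix n c).transpose * centreMatrix n c * S).det
    - Real.logb 2 (1 + ((k : ℝ) + 1) * (∑ i, r i ^ 2) * (S.trace / (((n : ℝ) + k) + n)))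
    - delta c r S

/-- `C*_LB`, the lower limit of the terms, as an extended real number. -/
def lowerBound {k : ℕ} (c r : Fin (k + 1) → ℝ) (S : ∀ n : ℕ, Matrix (Fin n) (Fin n) ℝ) : EReal :=
  liminf (fun n => ((boundTerm c r (S n) : ℝ) : EReal)) atTop

/-! ### Gaussian random codes and the joint-typicality decoder -/

/-- The law `N(0, S)` on `ℝⁿ`. -/
def codewordLaw {n : ℕ} (S : Matrix (Fin n) (Fin n) ℝ) : Measure (Fin n → ℝ) :=
  (multivariateGaussian 0 S).map WithLp.ofLp

/-- The Gaussian typical set `{a : |aᵀ S⁻¹ a / d - 1| < η}` of `N(0, S)`, where `d` is the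
dimension. -/
def typicalSet {ι : Type} [Fintype ι] [DecidableEq ι] (S : Matrix ι ι ℝ) (η : ℝ) : Set (ι → ℝ) :=
  {a | |1 / (Fintype.card ι : ℝ) * dotProduct a (S⁻¹.mulVec a) - 1| < η}

/-- The covariance matrix of `(x, H_c x + z)` for `x ∼ N(0, S)` and `z ∼ N(0, I)` independent. -/
def jointCov {k n : ℕ} (c : Fin (k + 1) → ℝ) (S : Matrix (Fin n) (Fin n) ℝ) :
    Matrix (Fin n ⊕ Fin (n + k)) (Fin n ⊕ Fin (n + k)) ℝ :=
  Matrix.fromBlocks S (S * (centreMatrix n c).transpose)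
    (centreMatrix n c * S) (1 + centreMatrix n c * S * (centreMatrix n c).transpose)

/-- The test of the joint-typicality decoder tuned to `H_c` for a codeword `x` and an
output `y`. -/
def JointlyTypical {k n : ℕ} (c : Fin (k + 1) → ℝ) (S : Matrix (Fin n) (Fin n) ℝ) (ε η : ℝ)
    (x : Fin n → ℝ) (y : Fin (n + k) → ℝ) : Prop :=
  x ∈ typicalSet S ε ∧ Sum.elim x y ∈ typicalSet (jointCov c S) η

open Classical in
/-- The joint-typicality decoder for the codebook `X`: it outputs the unique index that passes
the test, and declares a failure (`none`) if no index or more than one index passes. -/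
def jtDecode {k n M : ℕ} (c : Fin (k + 1) → ℝ) (S : Matrix (Fin n) (Fin n) ℝ) (ε η : ℝ)
    (X : Fin M → Fin n → ℝ) (y : Fin (n + k) → ℝ) : Option (Fin M) :=
  if h : ∃! i, JointlyTypical c S ε η (X i) y then some h.choose else none

/-- The error probability of the joint-typicality decoder, averaged over the Gaussian random
code with `M` independent `N(0, S)` codewords; code, message, taps and noise are independent. -/
def ensembleError {k n : ℕ} (c : Fin (k + 1) → ℝ) (S : Matrix (Fin n) (Fin n) ℝ) (ε η : ℝ)
    (M : ℕ) (ν : Measure (Taps k)) : ℝ :=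
  (M : ℝ)⁻¹ * ∑ w : Fin M,
    ((Measure.pi fun _ : Fin M => codewordLaw S).prod (ν.prod (noise (n + k)))).real
      {p | jtDecode c S ε η p.1 (output p.2.1 (p.1 w) p.2.2) ≠ some w}

end ISI

end

namespace ISI

open scoped ENNReal NNReal Matrix

/-! Fix the taps. The joint Gaussian density factors, so the decoder's statistic for `(x, y)` is `xᵀ
Σ⁻¹ x + |y - H_c x|²`. For the transmitted codeword the residual `y - H_c x` is `(H - H_c) x + z`.
Up to fluctuations, its energy exceeds that of the noise by at most `(k+1) ‖r‖² tr Σ`, and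
Chebyshev's inequality together with `λmax = o(n)` bounds the fluctuations uniformly over the taps
(`jointlyTypical_output`, `atypical_le`). This dictates `η`.

A wrong codeword is independent of the output, which is distributed as `T v` with `v` white and `T
Tᵀ = I + H Σ Hᵀ`. Passing the test confines the pair to an ellipsoid, and a change of Gaussian
measure bounds the probability of this by about `(1 + η)^((m+n)/2) / |det T|`
(`noise_prod_ellipsoid_le`). Comparing quadratic forms gives `det (T Tᵀ) ≥ (1 - φ₁)ⁿ det (I + H_cᵀ
H_c Σ)` (`det_output_cov_ge`). For `R < C*_LB` the union bound over the wrong codewords is then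
exponentially small (`badEvent_le`, `confusion_le`). Everything is uniform in the taps, so
integrating over an arbitrary tap law proves the statement on random codes.

Capacity asks for one code that serves all tap laws, and a small ensemble average for each tap array
separately does not provide it. The remedy is an elimination argument. Rounding the taps to a grid
costs little, because a bounded shift of the noise changes probabilities in a controlled way
(`noise_shift_le`); the grid has `exp (O(s²))` points. By a Chernoff bound, polynomially many
independent codebooks have a small average error at all grid points at once
(`exists_small_averages`, `exists_code_family`). The index of the codebook is made part of the
message and is sent ahead in `O(log n)` antipodal bits (`exists_prefixed_code`). These bits need a
tap whose sign is certain; if there is none, the zero channel is admissible and the lower bound is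
not positive (`exists_radius_lt_centre`). -/

theorem lintegral_pi_fin_prod {E : Type*} [MeasurableSpace E] {n : ℕ} (μ : Fin n → Measure E)
    [∀ i, SigmaFinite (μ i)] (f : Fin n → E → ℝ≥0∞) (hf : ∀ i, Measurable (f i)) :
    ∫⁻ x, ∏ i, f i (x i) ∂Measure.pi μ = ∏ i, ∫⁻ t, f i t ∂μ i := by
  induction n with
  | zero => simp
  | succ n ih =>
    have e := (measurePreserving_piFinSuccAbove μ 0).symm
    rw [← e.map_eq, lintegral_map_equiv, Fin.prod_univ_succ]
    simp only [Fin.prod_univ_succ, MeasurableEquiv.piFinSuccAbove_symm_apply,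
      Fin.insertNthEquiv_apply, Fin.insertNth_zero, Fin.cons_zero, Fin.cons_succ]
    refine (lintegral_prod_mul (hf 0).aemeasurable (g := fun y : Fin n → E =>
      ∏ x : Fin n, f x.succ (y x)) ?_).trans ?_
    rotate_left
    · rw [ih _ _ (fun i => hf i.succ)]
      simp
    · exact (Finset.measurable_prod _ fun i _ =>
        (hf i.succ).comp (measurable_pi_apply i)).aemeasurable

/-! ### White Gaussian noise: density and changes of measure -/

instance (n : ℕ) : IsProbabilityMeasure (noise n) := by
  unfold noise; infer_instance

/-- The centred Gaussian density on `ℝⁿ` with variance `v` in every coordinate. -/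
noncomputable def gaussDensity (n : ℕ) (v : ℝ≥0) (x : Fin n → ℝ) : ℝ≥0∞ := ∏ i, gaussianPDF 0 v (x i)

theorem measurable_gaussDensity (n : ℕ) (v : ℝ≥0) : Measurable (gaussDensity n v) :=
  Finset.measurable_prod _ fun i _ => (measurable_gaussianPDF 0 v).comp (measurable_pi_apply i)

theorem noise_eq_withDensity (n : ℕ) : noise n = volume.withDensity (gaussDensity n 1) := by
  refine Measure.pi_eq fun s hs => ?_
  rw [withDensity_apply _ (MeasurableSet.univ_pi hs), volume_pi, Measure.restrict_pi_pi]
  unfold gaussDensity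
  rw [lintegral_pi_fin_prod _ _ fun i => measurable_gaussianPDF 0 1]
  refine Finset.prod_congr rfl fun i _ => ?_
  rw [gaussianReal_apply 0 one_ne_zero]

theorem lintegral_gaussDensity (n : ℕ) {v : ℝ≥0} (hv : v ≠ 0) :
    ∫⁻ x, gaussDensity n v x = 1 := by
  unfold gaussDensity
  rw [volume_pi, lintegral_pi_fin_prod _ _ fun i => measurable_gaussianPDF 0 v]
  simp [lintegral_gaussianPDF_eq_one 0 hv]

theorem gaussDensity_eq (n : ℕ) (v : ℝ≥0) (x : Fin n → ℝ) :
    gaussDensity n v x = ENNReal.ofReal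
      ((√(2 * Real.pi * v))⁻¹ ^ n * Real.exp (-(x ⬝ᵥ x) / (2 * v))) := by
  unfold gaussDensity gaussianPDF
  rw [← ENNReal.ofReal_prod_of_nonneg fun i _ => gaussianPDFReal_nonneg 0 v _]
  congr 1
  simp only [gaussianPDFReal, sub_zero, Finset.prod_mul_distrib, Finset.prod_const,
    Finset.card_univ, Fintype.card_fin, ← Real.exp_sum]
  congr 2
  simp only [dotProduct, neg_div, Finset.sum_neg_distrib, ← Finset.sum_div, pow_two]

/-- Translating the noise by a short vector changes probabilities in a controlled way. -/
theorem noise_shift_le {m : ℕ} (a : Fin m → ℝ) {A : Set (Fin m → ℝ)} (hA : MeasurableSet A)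
    {t : ℝ} (ht : 0 < t) :
    (noise m).real {z | a + z ∈ A} ≤ t * (noise m).real A + Real.exp (a ⬝ᵥ a) / t := by
  -- The likelihood ratio of the shift is `L = exp (a ⬝ᵥ y - a ⬝ᵥ a / 2)`. Always `L ≤ t + L ^ 2 /
  -- t`, and the density times `L ^ 2` is `exp (a ⬝ᵥ a)` times the density shifted by `2 a`, whose
  -- total mass is one.
  have hpt : ∀ y, gaussDensity m 1 (y - a) ≤ ENNReal.ofReal t * gaussDensity m 1 y +
      ENNReal.ofReal (Real.exp (a ⬝ᵥ a) / t) * gaussDensity m 1 (y - (2 : ℝ) • a) := by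
    intro y
    simp only [gaussDensity_eq]
    rw [← ENNReal.ofReal_mul ht.le, ← ENNReal.ofReal_mul (by positivity),
      ← ENNReal.ofReal_add (by positivity) (by positivity)]
    refine ENNReal.ofReal_le_ofReal ?_
    set c := (√(2 * Real.pi * (1 : ℝ≥0)))⁻¹ ^ m with hc
    have hc0 : 0 ≤ c := by positivity
    have e1 : ∀ s : ℝ, (y - s • a) ⬝ᵥ (y - s • a) = y ⬝ᵥ y - 2 * s * (a ⬝ᵥ y) + s ^ 2 * (a ⬝ᵥ a) := by
      intro s
      simp only [dotProduct, Finset.mul_sum, ← Finset.sum_sub_distrib, ← Finset.sum_add_distrib]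
      exact Finset.sum_congr rfl fun i _ => by simp; ring
    have e2 := e1 1
    rw [one_smul] at e2
    rw [e2, e1 2]
    set p := Real.exp (-(y ⬝ᵥ y) / 2)
    set L := Real.exp (a ⬝ᵥ y - a ⬝ᵥ a / 2)
    have h1 : Real.exp (-(y ⬝ᵥ y - 2 * 1 * (a ⬝ᵥ y) + 1 ^ 2 * (a ⬝ᵥ a)) / (2 * (1 : ℝ≥0))) = p * L := by
      rw [← Real.exp_add]; congr 1; simp; ring
    have h2 : Real.exp (a ⬝ᵥ a) / t *
        (c * Real.exp (-(y ⬝ᵥ y - 2 * 2 * (a ⬝ᵥ y) + 2 ^ 2 * (a ⬝ᵥ a)) / (2 * (1 : ℝ≥0))))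
        = c * (p * (L ^ 2 / t)) := by
      have : p * L ^ 2 = Real.exp (a ⬝ᵥ a) *
          Real.exp (-(y ⬝ᵥ y - 2 * 2 * (a ⬝ᵥ y) + 2 ^ 2 * (a ⬝ᵥ a)) / (2 * (1 : ℝ≥0))) := by
        rw [← Real.exp_nat_mul, ← Real.exp_add, ← Real.exp_add]; congr 1; simp; ring
      field_simp
      rw [mul_assoc c p, this]; ring_nf
    have h3 : Real.exp (-(y ⬝ᵥ y) / (2 * (1 : ℝ≥0))) = p := by simp [p]
    rw [h1, h2, h3]
    have : L ≤ t + L ^ 2 / t := by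
      rw [← sub_nonneg]
      have : t + L ^ 2 / t - L = ((t - L / 2) ^ 2 + 3 / 4 * L ^ 2) / t := by field_simp; ring
      rw [this]; positivity
    calc c * (p * L) ≤ c * (p * (t + L ^ 2 / t)) := by gcongr
      _ = _ := by ring
  have hshift : ∀ b : Fin m → ℝ, ∫⁻ y, gaussDensity m 1 (y - b) = 1 := by
    intro b
    rw [lintegral_sub_right_eq_self (fun y => gaussDensity m 1 y) b,
      lintegral_gaussDensity m one_ne_zero]
  have hpre : MeasurableSet {z | a + z ∈ A} := measurable_const_add a hA
  have key : noise m {z | a + z ∈ A} ≤ ENNReal.ofReal t * noise m A +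
      ENNReal.ofReal (Real.exp (a ⬝ᵥ a) / t) := by
    have e1 : noise m {z | a + z ∈ A} = ∫⁻ y in A, gaussDensity m 1 (y - a) := by
      rw [noise_eq_withDensity, withDensity_apply _ hpre, ← lintegral_indicator hpre,
        ← lintegral_indicator hA,
        ← lintegral_sub_right_eq_self
          (fun z => Set.indicator {z | a + z ∈ A} (gaussDensity m 1) z) a]
      congr 1; ext y
      by_cases hy : y ∈ A
      · rw [Set.indicator_of_mem hy, Set.indicator_of_mem (by simpa using hy)]
      · rw [Set.indicator_of_notMem hy, Set.indicator_of_notMem (by simpa using hy)]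
    rw [e1]
    calc ∫⁻ y in A, gaussDensity m 1 (y - a)
        ≤ ∫⁻ y in A, (ENNReal.ofReal t * gaussDensity m 1 y +
          ENNReal.ofReal (Real.exp (a ⬝ᵥ a) / t) * gaussDensity m 1 (y - (2 : ℝ) • a)) :=
          lintegral_mono hpt
      _ = ENNReal.ofReal t * noise m A + ENNReal.ofReal (Real.exp (a ⬝ᵥ a) / t) *
          ∫⁻ y in A, gaussDensity m 1 (y - (2 : ℝ) • a) := by
          rw [lintegral_add_left ((measurable_gaussDensity m 1).const_mul _),
            lintegral_const_mul _ (measurable_gaussDensity m 1), lintegral_const_mul _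
            (f := fun y => gaussDensity m 1 (y - (2 : ℝ) • a))
            ((measurable_gaussDensity m 1).comp (measurable_id.sub_const _)),
            noise_eq_withDensity, withDensity_apply _ hA]
      _ ≤ _ := by
          gcongr
          calc _ ≤ ENNReal.ofReal (Real.exp (a ⬝ᵥ a) / t) *
              ∫⁻ y, gaussDensity m 1 (y - (2 : ℝ) • a) := by
                gcongr; exact Measure.restrict_le_self
            _ = _ := by rw [hshift, mul_one]
  have := ENNReal.toReal_mono (by finiteness) key
  rw [ENNReal.toReal_add (by finiteness) (by finiteness), ENNReal.toReal_mul,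
    ENNReal.toReal_ofReal ht.le, ENNReal.toReal_ofReal (by positivity)] at this
  exact this

/-- The probability that an independent pair of white vectors of typical energy lies in a
transformed ball. -/
theorem noise_prod_ellipsoid_le {n m : ℕ} (F : (Fin n → ℝ) → Fin m → ℝ) (hF : Measurable F)
    (T : Matrix (Fin m) (Fin m) ℝ) (hT : T.det ≠ 0) {ε q : ℝ} (hq : 1 ≤ q) :
    ((noise n).prod (noise m)).real {p | n * (1 - ε) ≤ p.1 ⬝ᵥ p.1 ∧ m * (1 - ε) ≤ p.2 ⬝ᵥ p.2 ∧
        p.1 ⬝ᵥ p.1 + (T.mulVec p.2 - F p.1) ⬝ᵥ (T.mulVec p.2 - F p.1) ≤ (n + m) * q}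
      ≤ (√q) ^ (n + m) * Real.exp (ε * (n + m) / 2) / |T.det| := by
  set A := {p : (Fin n → ℝ) × (Fin m → ℝ) | n * (1 - ε) ≤ p.1 ⬝ᵥ p.1 ∧ m * (1 - ε) ≤ p.2 ⬝ᵥ p.2 ∧
        p.1 ⬝ᵥ p.1 + (T.mulVec p.2 - F p.1) ⬝ᵥ (T.mulVec p.2 - F p.1) ≤ (n + m) * q} with hAdef
  have hq0 : 0 < q := by linarith
  set v : ℝ≥0 := ⟨q, hq0.le⟩
  have hv : v ≠ 0 := fun h => hq0.ne' (congrArg NNReal.toReal h)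
  have hvq : (v : ℝ) = q := rfl
  have mT : Measurable fun w : Fin m → ℝ => T.mulVec w := by
    fun_prop
  set K := (√q) ^ (n + m) * Real.exp (ε * (n + m) / 2) with hK
  have hK0 : 0 ≤ K := by positivity
  -- The comparison measure is Gaussian of variance `q` in the coordinates `(u, T w - F u)`. On `A`
  -- the exponent of the standard density is at most `-(n + m)(1 - ε)/2`, that of the comparison
  -- density is at least `-(n + m)/2`, and the normalizing constants differ by `√q ^ (n + m)`.
  have hpt : ∀ u w, A.indicator (fun p => gaussDensity n 1 p.1 * gaussDensity m 1 p.2) (u, w) ≤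
      ENNReal.ofReal K * (gaussDensity n v u * gaussDensity m v (T.mulVec w - F u)) := by
    intro u w
    by_cases h : (u, w) ∈ A
    · rw [Set.indicator_of_mem h]
      simp only [gaussDensity_eq]
      rw [← ENNReal.ofReal_mul (by positivity), ← ENNReal.ofReal_mul (by positivity),
        ← ENNReal.ofReal_mul hK0]
      refine ENNReal.ofReal_le_ofReal ?_
      obtain ⟨h1, h2, h3⟩ := h
      simp only at h1 h2 h3
      rw [hvq, hK]
      set a := u ⬝ᵥ u
      set b := w ⬝ᵥ w
      set d := (T.mulVec w - F u) ⬝ᵥ (T.mulVec w - F u)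
      have hs : √(2 * Real.pi * q) = √(2 * Real.pi) * √q := Real.sqrt_mul (by positivity) _
      have hsq : √q ≠ 0 := (Real.sqrt_pos.2 hq0).ne'
      have hexp : Real.exp (-a / 2) * Real.exp (-b / 2) ≤
          Real.exp (ε * (n + m) / 2) * (Real.exp (-a / (2 * q)) * Real.exp (-d / (2 * q))) := by
        rw [← Real.exp_add, ← Real.exp_add, ← Real.exp_add]
        refine Real.exp_le_exp.2 ?_
        have : (a + d) / (2 * q) ≤ (n + m) / 2 := by
          rw [div_le_div_iff₀ (by positivity) (by norm_num)]; nlinarith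
        have e : -a / (2 * q) + -d / (2 * q) = - ((a + d) / (2 * q)) := by ring
        rw [e]; linarith
      rw [hs]
      simp only [NNReal.coe_one, mul_one]
      have e1 : (√(2 * Real.pi))⁻¹ ^ n * Real.exp (-a / 2) * ((√(2 * Real.pi))⁻¹ ^ m * Real.exp (-b / 2))
        = ((√(2 * Real.pi))⁻¹ ^ n * (√(2 * Real.pi))⁻¹ ^ m) *
          (Real.exp (-a / 2) * Real.exp (-b / 2)) := by ring
      rw [e1]
      refine (mul_le_mul_of_nonneg_left hexp (by positivity)).trans (le_of_eq ?_)
      have hi : √q ^ n * (√q)⁻¹ ^ n = 1 := by rw [← mul_pow, mul_inv_cancel₀ hsq, one_pow]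
      have hj : √q ^ m * (√q)⁻¹ ^ m = 1 := by rw [← mul_pow, mul_inv_cancel₀ hsq, one_pow]
      simp only [mul_inv, mul_pow, pow_add]
      linear_combination (√(2 * Real.pi))⁻¹ ^ n * (√(2 * Real.pi))⁻¹ ^ m *
        Real.exp (ε * (n + m) / 2) * Real.exp (-a / (2 * q)) * Real.exp (-d / (2 * q)) *
        (-1 - (√q ^ m * (√q)⁻¹ ^ m - 1)) * hi - (√(2 * Real.pi))⁻¹ ^ n * (√(2 * Real.pi))⁻¹ ^ m *
        Real.exp (ε * (n + m) / 2) * Real.exp (-a / (2 * q)) * Real.exp (-d / (2 * q)) * hj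
    · rw [Set.indicator_of_notMem h]; exact zero_le
  have hAm : MeasurableSet A := by
    simp only [hAdef, dotProduct]
    have m1 : ∀ i, Measurable fun p : (Fin n → ℝ) × (Fin m → ℝ) => (T.mulVec p.2 - F p.1) i :=
      fun i => (measurable_pi_apply i).comp ((mT.comp measurable_snd).sub (hF.comp measurable_fst))
    have m2 : Measurable fun p : (Fin n → ℝ) × (Fin m → ℝ) => ∑ i, p.1 i * p.1 i := by fun_prop
    have m3 : Measurable fun p : (Fin n → ℝ) × (Fin m → ℝ) => ∑ i, p.2 i * p.2 i := by fun_prop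
    have m4 := m2.add (Finset.measurable_sum Finset.univ fun i _ => (m1 i).mul (m1 i))
    exact (measurableSet_le measurable_const m2).inter
      ((measurableSet_le measurable_const m3).inter (measurableSet_le m4 measurable_const))
  -- For fixed `u` the vector `F u` is a mere translation, so only the Jacobian of `T` remains.
  have hT1 : ∀ b : Fin m → ℝ, ∫⁻ w, gaussDensity m v (T.mulVec w - b) = ENNReal.ofReal |T.det|⁻¹ := by
    intro b
    have hmap := Real.map_matrix_volume_pi_eq_smul_volume_pi hT
    have mb : Measurable fun y => gaussDensity m v (y - b) :=
      (measurable_gaussDensity m v).comp (measurable_id.sub_const b)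
    have : ∫⁻ y, gaussDensity m v (y - b) ∂(Measure.map (Matrix.toLin' T) volume) =
        ∫⁻ w, gaussDensity m v (T.mulVec w - b) := by
      rw [lintegral_map mb (Matrix.toLin' T).continuous_of_finiteDimensional.measurable]; simp
    rw [← this, hmap, lintegral_smul_measure,
      lintegral_sub_right_eq_self (fun y => gaussDensity m v y) b, lintegral_gaussDensity m hv,
      abs_inv]
    simp
  have key : ((noise n).prod (noise m)) A ≤ ENNReal.ofReal K * ENNReal.ofReal |T.det|⁻¹ := by
    rw [noise_eq_withDensity, noise_eq_withDensity,
      prod_withDensity (measurable_gaussDensity n 1) (measurable_gaussDensity m 1),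
      withDensity_apply _ hAm, ← lintegral_indicator hAm, lintegral_prod _ ?_]
    · calc _ ≤ ∫⁻ u, ∫⁻ w, ENNReal.ofReal K *
              (gaussDensity n v u * gaussDensity m v (T.mulVec w - F u)) :=
            lintegral_mono fun u => lintegral_mono fun w => hpt u w
        _ = ∫⁻ u, ENNReal.ofReal K * (gaussDensity n v u * ENNReal.ofReal |T.det|⁻¹) := by
            congr 1; ext u
            have mm : Measurable fun w => gaussDensity m v (T.mulVec w - F u) :=
              (measurable_gaussDensity m v).comp (mT.sub_const _)
            rw [lintegral_const_mul _ (mm.const_mul _), lintegral_const_mul _ mm, hT1]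
        _ = _ := by
            rw [lintegral_const_mul _ ((measurable_gaussDensity n v).mul_const _),
              lintegral_mul_const _ (measurable_gaussDensity n v), lintegral_gaussDensity n hv,
              one_mul]
    · exact ((((measurable_gaussDensity n 1).comp measurable_fst).mul
        ((measurable_gaussDensity m 1).comp measurable_snd)).indicator hAm).aemeasurable
  have := ENNReal.toReal_mono (by finiteness) key
  rw [ENNReal.toReal_mul, ENNReal.toReal_ofReal hK0, ENNReal.toReal_ofReal (by positivity)] at this
  rwa [div_eq_mul_inv]

/-! ### Linear images of white noise -/

theorem charFunDual_noise {n : ℕ} (L : StrongDual ℝ (Fin n → ℝ)) :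
    charFunDual (noise n) L =
      Complex.exp (-((∑ i, L (Pi.single i 1) ^ 2 : ℝ) : ℂ) / 2) := by
  have hL : ∀ x, L x = ∑ i, x i * L (Pi.single i 1) := by
    intro x
    conv_lhs => rw [pi_eq_sum_univ' x]
    simp [map_sum]
  rw [charFunDual_apply, noise]
  have hx : ∀ x, Complex.exp ((L x : ℂ) * Complex.I) =
      ∏ i, Complex.exp (((x i * L (Pi.single i 1) : ℝ) : ℂ) * Complex.I) := by
    intro x
    rw [hL x, Complex.ofReal_sum, Finset.sum_mul, Complex.exp_sum]
  simp_rw [hx]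
  rw [integral_fintype_prod_eq_prod
    (f := fun i (x : ℝ) => Complex.exp (((x * L (Pi.single i 1) : ℝ) : ℂ) * Complex.I))]
  have : ∀ i, ∫ x : ℝ, Complex.exp (((x * L (Pi.single i 1) : ℝ) : ℂ) * Complex.I)
      ∂gaussianReal 0 1 = Complex.exp (-((L (Pi.single i 1) ^ 2 : ℝ) : ℂ) / 2) := by
    intro i
    have h := charFun_gaussianReal (μ := 0) (v := 1) (t := L (Pi.single i 1))
    rw [charFun_apply_real] at h
    simp only [Complex.ofReal_mul]
    simp_rw [mul_comm ((_ : ℝ) : ℂ) ((L (Pi.single i 1) : ℝ) : ℂ)]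
    rw [h]; congr 1; push_cast; ring
  simp_rw [this, ← Complex.exp_sum]
  congr 1
  push_cast
  rw [← Finset.sum_div, Finset.sum_neg_distrib]

theorem sum_sq_apply_single_mulVec {m n : ℕ} (A : Matrix (Fin m) (Fin n) ℝ)
    (L : StrongDual ℝ (Fin m → ℝ)) :
    ∑ j, L (A *ᵥ Pi.single j 1) ^ 2 =
      (fun i => L (Pi.single i 1)) ⬝ᵥ ((A * Aᵀ) *ᵥ fun i => L (Pi.single i 1)) := by
  have hL : ∀ x, L x = x ⬝ᵥ fun i => L (Pi.single i 1) := by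
    intro x
    conv_lhs => rw [pi_eq_sum_univ' x]
    simp [map_sum, dotProduct]
  set t := fun i => L (Pi.single i 1)
  rw [← Matrix.mulVec_mulVec, Matrix.dotProduct_mulVec, dotProduct]
  refine Finset.sum_congr rfl fun j _ => ?_
  rw [hL, pow_two, Matrix.mulVec_single_one, Matrix.mulVec_transpose]
  simp only [Matrix.vecMul, dotProduct_comm]
  rfl

theorem charFunDual_noise_map {m n : ℕ} (A : Matrix (Fin m) (Fin n) ℝ)
    (L : StrongDual ℝ (Fin m → ℝ)) :
    charFunDual ((noise n).map (A *ᵥ ·)) L =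
      Complex.exp (-(((fun i => L (Pi.single i 1)) ⬝ᵥ
        ((A * Aᵀ) *ᵥ fun i => L (Pi.single i 1)) : ℝ) : ℂ) / 2) := by
  have e : (fun x => A *ᵥ x) = ⇑(LinearMap.toContinuousLinearMap (Matrix.toLin' A)) := by
    ext x; simp
  rw [show (noise n).map (A *ᵥ ·) =
    (noise n).map ⇑(LinearMap.toContinuousLinearMap (Matrix.toLin' A)) from by rw [← e],
    charFunDual_map, charFunDual_noise, ← sum_sq_apply_single_mulVec]
  simp

theorem measurable_mulVec {m n : ℕ} (A : Matrix (Fin m) (Fin n) ℝ) :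
    Measurable fun x : Fin n → ℝ => A *ᵥ x :=
  (Matrix.toLin' A).continuous_of_finiteDimensional.measurable

instance {m n : ℕ} (A : Matrix (Fin m) (Fin n) ℝ) :
    IsProbabilityMeasure ((noise n).map (A *ᵥ ·)) :=
  Measure.isProbabilityMeasure_map (measurable_mulVec A).aemeasurable

/-- The characteristic function sees `A` only through the covariance `A * Aᵀ`. One square root of a
covariance may thus be exchanged for another, even one of a different width. -/
theorem noise_map_congr {m n n' : ℕ} {A : Matrix (Fin m) (Fin n) ℝ} {B : Matrix (Fin m) (Fin n') ℝ}
    (h : A * Aᵀ = B * Bᵀ) : (noise n).map (A *ᵥ ·) = (noise n').map (B *ᵥ ·) := by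
  apply Measure.ext_of_charFunDual
  ext L
  rw [charFunDual_noise_map, charFunDual_noise_map, h]

/-- Independence multiplies characteristic functions, that is, adds covariances. The sum becomes the
image of one white vector under a square matrix, the form in which the output enters the ellipsoid
bound. -/
theorem noise_map_mulVec_add {m n : ℕ} {A : Matrix (Fin m) (Fin n) ℝ}
    {T : Matrix (Fin m) (Fin m) ℝ} (h : 1 + A * Aᵀ = T * Tᵀ) :
    ((noise n).prod (noise m)).map (fun p => A *ᵥ p.1 + p.2) = (noise m).map (T *ᵥ ·) := by
  have e : ((noise n).prod (noise m)).map (fun p => A *ᵥ p.1 + p.2) =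
      ((noise n).map (A *ᵥ ·)) ∗ (noise m) := by
    have h2 : ((noise n).map (A *ᵥ ·)).prod (noise m) =
        ((noise n).prod (noise m)).map (Prod.map (A *ᵥ ·) id) := by
      rw [← Measure.map_prod_map _ _ (measurable_mulVec A) measurable_id, Measure.map_id]
    rw [Measure.conv, h2, Measure.map_map (by fun_prop)
      ((measurable_mulVec A).prodMap measurable_id)]
    rfl
  have : IsProbabilityMeasure (((noise n).prod (noise m)).map (fun p => A *ᵥ p.1 + p.2)) :=
    Measure.isProbabilityMeasure_map
      (((measurable_mulVec A).comp measurable_fst).add measurable_snd).aemeasurable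
  apply Measure.ext_of_charFunDual
  ext L
  rw [e, charFunDual_conv, charFunDual_noise_map, charFunDual_noise_map, charFunDual_noise, ← h,
    ← Complex.exp_add, Matrix.add_mulVec, Matrix.one_mulVec, dotProduct_add]
  congr 1
  simp only [dotProduct]
  push_cast
  simp_rw [← pow_two]
  ring

/-- The symmetric square root behind `multivariateGaussian` is exchanged for an arbitrary `B`. The
choice made later has orthogonal columns, so that `x ⬝ᵥ x` is a weighted sum of independent squares.
-/
theorem codewordLaw_eq {n : ℕ} {S B : Matrix (Fin n) (Fin n) ℝ} (hS : S.PosSemidef)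
    (hB : B * Bᵀ = S) : codewordLaw S = (noise n).map (B *ᵥ ·) := by
  open scoped MatrixOrder in
  have hself : (CFC.sqrt S)ᵀ = CFC.sqrt S := by
    have := (CFC.sqrt_nonneg S).isSelfAdjoint
    simpa [IsSelfAdjoint, Matrix.star_eq_conjTranspose] using this
  have hsq : CFC.sqrt S * (CFC.sqrt S)ᵀ = B * Bᵀ := by
    open scoped MatrixOrder in
    rw [hself, hB, CFC.sqrt_mul_sqrt_self _ hS.nonneg]
  rw [← noise_map_congr hsq, codewordLaw, multivariateGaussian, ← map_pi_eq_stdGaussian,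
    Measure.map_map (by fun_prop) (by fun_prop), Measure.map_map (by fun_prop) (by fun_prop)]
  rw [noise]
  congr 1
  ext x
  simp

instance {n : ℕ} (S : Matrix (Fin n) (Fin n) ℝ) : IsProbabilityMeasure (codewordLaw S) :=
  Measure.isProbabilityMeasure_map (by fun_prop)

/-! ### Gaussian moments and Chebyshev bounds -/

theorem memLp_sq_gaussianReal : MemLp (fun x : ℝ => x ^ 2) 2 (gaussianReal 0 1) := by
  have h4 : MemLp (id : ℝ → ℝ) 4 (gaussianReal 0 1) := memLp_id_gaussianReal 4
  rw [memLp_two_iff_integrable_sq (by fun_prop)]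
  have := h4.integrable_norm_rpow (by norm_num) (by norm_num)
  refine this.congr (ae_of_all _ fun x => ?_)
  simp only [id]
  norm_num [← pow_mul, (by decide : Even 4).pow_abs]

/-- The variance of the square of a standard Gaussian variable. -/
noncomputable def chiVar : ℝ := Var[fun x : ℝ => x ^ 2; gaussianReal 0 1]

theorem chiVar_nonneg : 0 ≤ chiVar := variance_nonneg _ _

theorem integral_sq_gaussianReal : ∫ x : ℝ, x ^ 2 ∂gaussianReal 0 1 = 1 := by
  have h := variance_id_gaussianReal (μ := 0) (v := 1)
  rw [variance_eq_integral (by fun_prop)] at h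
  simpa using h

/-- Chebyshev's inequality for a weighted sum of squares. -/
theorem noise_quadratic_chebyshev {n : ℕ} (d : Fin n → ℝ) {s : ℝ} (hs : 0 < s) :
    (noise n).real {z | s ≤ |∑ i, d i * z i ^ 2 - ∑ i, d i|} ≤ chiVar * (∑ i, d i ^ 2) / s ^ 2 := by
  have hm : ∀ i, MemLp (fun x : ℝ => d i * x ^ 2) 2 (gaussianReal 0 1) :=
    fun i => memLp_sq_gaussianReal.const_mul (d i)
  have hv := variance_sum_pi (μ := fun _ : Fin n => gaussianReal 0 1) hm
  have hmp : ∀ i, MemLp (fun z : Fin n → ℝ => d i * z i ^ 2) 2 (noise n) := fun i =>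
    (hm i).comp_measurePreserving (measurePreserving_eval (fun _ : Fin n => gaussianReal 0 1) i)
  have hsum : MemLp (∑ i, fun z : Fin n → ℝ => d i * z i ^ 2) 2 (noise n) :=
    memLp_finsetSum' _ fun i _ => hmp i
  have hmean : ∫ z, (∑ i, fun z : Fin n → ℝ => d i * z i ^ 2) z ∂noise n = ∑ i, d i := by
    simp only [Finset.sum_apply]
    rw [integral_finsetSum _ fun i _ => (hmp i).integrable (by norm_num)]
    refine Finset.sum_congr rfl fun i _ => ?_
    have := integral_comp_eval (μ := fun _ : Fin n => gaussianReal 0 1) (i := i)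
      (f := fun x : ℝ => d i * x ^ 2) (hm i).aestronglyMeasurable
    rw [noise, this, integral_const_mul, integral_sq_gaussianReal, mul_one]
  have := meas_ge_le_variance_div_sq hsum hs
  have hvar : Var[∑ i, fun z : Fin n → ℝ => d i * z i ^ 2; noise n] = chiVar * ∑ i, d i ^ 2 := by
    rw [noise, hv, Finset.mul_sum]
    refine Finset.sum_congr rfl fun i _ => ?_
    rw [variance_const_mul, chiVar, mul_comm]
  rw [hmean, hvar] at this
  have h2 := ENNReal.toReal_mono (by finiteness) this
  rw [ENNReal.toReal_ofReal (div_nonneg (mul_nonneg chiVar_nonneg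
    (Finset.sum_nonneg fun i _ => sq_nonneg _)) (sq_nonneg s))] at h2
  simpa [Measure.real] using h2

/-- Chebyshev's inequality for a linear form. -/
theorem noise_linear_chebyshev {n : ℕ} (a : Fin n → ℝ) {s : ℝ} (hs : 0 < s) :
    (noise n).real {z | s ≤ |a ⬝ᵥ z|} ≤ (a ⬝ᵥ a) / s ^ 2 := by
  have hm : ∀ i, MemLp (fun x : ℝ => a i * x) 2 (gaussianReal 0 1) :=
    fun i => (memLp_id_gaussianReal 2).const_mul (a i)
  have hv := variance_sum_pi (μ := fun _ : Fin n => gaussianReal 0 1) hm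
  have hmp : ∀ i, MemLp (fun z : Fin n → ℝ => a i * z i) 2 (noise n) := fun i =>
    (hm i).comp_measurePreserving (measurePreserving_eval (fun _ : Fin n => gaussianReal 0 1) i)
  have hsum : MemLp (∑ i, fun z : Fin n → ℝ => a i * z i) 2 (noise n) :=
    memLp_finsetSum' _ fun i _ => hmp i
  have hmean : ∫ z, (∑ i, fun z : Fin n → ℝ => a i * z i) z ∂noise n = 0 := by
    simp only [Finset.sum_apply]
    rw [integral_finsetSum _ fun i _ => (hmp i).integrable (by norm_num)]
    refine Finset.sum_eq_zero fun i _ => ?_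
    have := integral_comp_eval (μ := fun _ : Fin n => gaussianReal 0 1) (i := i)
      (f := fun x : ℝ => a i * x) (hm i).aestronglyMeasurable
    rw [noise, this, integral_const_mul, integral_id_gaussianReal, mul_zero]
  have := meas_ge_le_variance_div_sq hsum hs
  have hvar : Var[∑ i, fun z : Fin n → ℝ => a i * z i; noise n] = a ⬝ᵥ a := by
    rw [noise, hv, dotProduct]
    refine Finset.sum_congr rfl fun i _ => ?_
    have := variance_id_gaussianReal (μ := 0) (v := 1)
    rw [variance_const_mul, show Var[fun x : ℝ => x; gaussianReal 0 1] = 1 from this]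
    ring
  rw [hmean, hvar] at this
  have h2 := ENNReal.toReal_mono (by finiteness) this
  have h0 : 0 ≤ a ⬝ᵥ a := Finset.sum_nonneg fun i _ => mul_self_nonneg _
  rw [ENNReal.toReal_ofReal (by positivity)] at h2
  simpa [Measure.real, dotProduct] using h2

/-! ### Channel matrices -/

/-- The input seen by tap `i` in slot `t`. -/
def tapInput {n : ℕ} (x : Fin n → ℝ) (t i : ℕ) : ℝ := ∑ j : Fin n, if t = i + j then x j else 0

/-- The sum over taps removes the dependent index and exhibits the matrix as a superposition of
shifts. -/
theorem channelMatrix_apply {k n : ℕ} (h : Taps k) (t : Fin (n + k)) (j : Fin n) :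
    channelMatrix n h t j = ∑ i : Fin (k + 1), if (t : ℕ) = i + j then h t i else 0 := by
  simp only [channelMatrix, Matrix.of_apply]
  split_ifs with hj
  · rw [Finset.sum_eq_single ⟨(t : ℕ) - j, Nat.lt_succ_of_le hj.2⟩]
    · rw [if_pos (by simp only; omega)]
    · intro i _ hi
      rw [if_neg]
      intro he
      exact hi (Fin.ext (by simp only; omega))
    · simp
  · refine (Finset.sum_eq_zero fun i _ => if_neg fun he => hj ?_).symm
    have := i.2
    omega

theorem channelMatrix_mulVec {k n : ℕ} (h : Taps k) (x : Fin n → ℝ) (t : Fin (n + k)) :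
    (channelMatrix n h *ᵥ x) t = ∑ i : Fin (k + 1), h t i * tapInput x t i := by
  simp only [Matrix.mulVec, dotProduct, channelMatrix_apply, tapInput, Finset.sum_mul,
    Finset.mul_sum]
  rw [Finset.sum_comm]
  refine Finset.sum_congr rfl fun i _ => Finset.sum_congr rfl fun j _ => ?_
  split_ifs <;> simp

theorem channelMatrix_sub {k n : ℕ} (h g : Taps k) :
    channelMatrix n h - channelMatrix n g = channelMatrix n (h - g) := by
  ext t j
  simp only [channelMatrix, Matrix.sub_apply, Matrix.of_apply]
  split_ifs <;> simp

theorem tapInput_sq {n : ℕ} (x : Fin n → ℝ) (t i : ℕ) :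
    tapInput x t i ^ 2 = ∑ j : Fin n, if t = i + j then x j ^ 2 else 0 := by
  unfold tapInput
  by_cases hj : ∃ j : Fin n, t = i + j
  · obtain ⟨j, rfl⟩ := hj
    have hne : ∀ b : Fin n, b ≠ j → ¬ (i + (j : ℕ) = i + b) := fun b hb he =>
      hb (Fin.ext (by omega))
    rw [Finset.sum_eq_single j (fun b _ hb => if_neg (hne b hb)) (by simp),
      Finset.sum_eq_single j (fun b _ hb => if_neg (hne b hb)) (by simp)]
    simp
  · push Not at hj
    simp [hj]

/-- Each tap sees the entire input, delayed: the `k` extra output slots keep the end of the block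
from being cut off. -/
theorem sum_tapInput_sq {k n : ℕ} (x : Fin n → ℝ) (i : Fin (k + 1)) :
    ∑ t : Fin (n + k), tapInput x t i ^ 2 = x ⬝ᵥ x := by
  simp only [tapInput_sq, dotProduct]
  rw [Finset.sum_comm]
  refine Finset.sum_congr rfl fun j _ => ?_
  have hi := i.2
  have hj := j.2
  rw [Finset.sum_eq_single (⟨i + j, by omega⟩ : Fin (n + k))]
  · simp [pow_two]
  · intro b _ hb
    exact if_neg fun he => hb (Fin.ext he)
  · simp

/-- Cauchy–Schwarz over the `k + 1` taps in each slot; each tap then contributes the full input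
energy. Applied to `H - H_c`, this yields the constant inside the logarithm of the bound. -/
theorem channelMatrix_energy_le {k n : ℕ} {h : Taps k} {r : Fin (k + 1) → ℝ}
    (hr : ∀ (t : Fin (n + k)) i, |h t i| ≤ r i) (x : Fin n → ℝ) :
    (channelMatrix n h *ᵥ x) ⬝ᵥ (channelMatrix n h *ᵥ x) ≤
      ((k : ℝ) + 1) * (∑ i, r i ^ 2) * (x ⬝ᵥ x) := by
  have h1 : ∀ t : Fin (n + k), (channelMatrix n h *ᵥ x) t * (channelMatrix n h *ᵥ x) t ≤
      (∑ i, r i ^ 2) * ∑ i : Fin (k + 1), tapInput x t i ^ 2 := by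
    intro t
    rw [channelMatrix_mulVec, ← pow_two]
    refine (Finset.sum_mul_sq_le_sq_mul_sq _ _ _).trans ?_
    refine mul_le_mul_of_nonneg_right (Finset.sum_le_sum fun i _ => ?_)
      (Finset.sum_nonneg fun i _ => sq_nonneg _)
    rw [← sq_abs]
    exact pow_le_pow_left₀ (abs_nonneg _) (hr t i) 2
  calc _ ≤ ∑ t : Fin (n + k), (∑ i, r i ^ 2) * ∑ i : Fin (k + 1), tapInput x t i ^ 2 :=
        Finset.sum_le_sum fun t _ => h1 t
    _ = _ := by
        rw [← Finset.mul_sum, Finset.sum_comm]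
        simp only [sum_tapInput_sq, Finset.sum_const, Finset.card_univ, Fintype.card_fin,
          nsmul_eq_mul]
        push_cast; ring

/-- Cauchy–Schwarz with the weights `r i`, splitting each radius as `√(r i) * √(r i)`. This constant
is the one that enters `phi1`. -/
theorem channelMatrix_energy_le_rSum {k n : ℕ} {h : Taps k} {r : Fin (k + 1) → ℝ}
    (hr : ∀ t i, |h t i| ≤ r i) (x : Fin n → ℝ) :
    (channelMatrix n h *ᵥ x) ⬝ᵥ (channelMatrix n h *ᵥ x) ≤ rSum r ^ 2 * (x ⬝ᵥ x) := by
  have r0 : ∀ i, 0 ≤ r i := fun i => (abs_nonneg _).trans (hr 0 i)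
  have h1 : ∀ t : Fin (n + k), (channelMatrix n h *ᵥ x) t * (channelMatrix n h *ᵥ x) t ≤
      (∑ i, r i) * ∑ i : Fin (k + 1), r i * tapInput x t i ^ 2 := by
    intro t
    rw [channelMatrix_mulVec, ← pow_two]
    calc (∑ i : Fin (k + 1), h t i * tapInput x t i) ^ 2
        ≤ (∑ i : Fin (k + 1), √(r i) * (√(r i) * |tapInput x t i|)) ^ 2 := by
          rw [← sq_abs]
          gcongr
          refine (Finset.abs_sum_le_sum_abs _ _).trans (Finset.sum_le_sum fun i _ => ?_)
          rw [← mul_assoc, Real.mul_self_sqrt (r0 i), abs_mul]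
          gcongr
          exact hr t i
      _ ≤ _ := by
          refine (Finset.sum_mul_sq_le_sq_mul_sq _ _ _).trans (le_of_eq ?_)
          simp [mul_pow, Real.sq_sqrt (r0 _)]
  calc _ ≤ ∑ t : Fin (n + k), (∑ i, r i) * ∑ i : Fin (k + 1), r i * tapInput x t i ^ 2 :=
        Finset.sum_le_sum fun t _ => h1 t
    _ = _ := by
        rw [← Finset.mul_sum, Finset.sum_comm]
        simp only [← Finset.mul_sum, sum_tapInput_sq, ← Finset.sum_mul, rSum]
        ring

/-! ### Parseval's identity and the gain of the centre channel -/

open Polynomial in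
-- Parseval's identity, with the vector as the coefficients of a polynomial.
theorem circleAverage_sum_sq {N : ℕ} (a : Fin N → ℝ) :
    Real.circleAverage (fun z => ‖(∑ t : Fin N, C (a t : ℂ) * X ^ (t : ℕ)).eval z‖ ^ 2) 0 1 =
      a ⬝ᵥ a := by
  set p : ℂ[X] := ∑ t : Fin N, C (a t : ℂ) * X ^ (t : ℕ) with hp
  have hc : ∀ t : Fin N, p.coeff t = a t := by
    intro t
    simp only [hp, finsetSum_coeff, coeff_C_mul, coeff_X_pow]
    rw [Finset.sum_eq_single t]
    · simp
    · intro b _ hb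
      rw [if_neg fun he => hb (Fin.ext he.symm), mul_zero]
    · simp
  have hsub : p.support ⊆ Finset.univ.image (fun t : Fin N => (t : ℕ)) := by
    intro i hi
    by_contra hni
    simp only [Finset.mem_image, Finset.mem_univ, true_and, not_exists] at hni
    refine (mem_support_iff.1 hi) ?_
    simp only [hp, finsetSum_coeff, coeff_C_mul, coeff_X_pow]
    exact Finset.sum_eq_zero fun t _ => by rw [if_neg fun he => hni t he.symm, mul_zero]
  rw [← sum_sq_norm_coeff_eq_circleAverage, Finset.sum_subset hsub fun i _ hi => by
    rw [notMem_support_iff.1 hi]; simp, Finset.sum_image fun s _ t _ h => Fin.ext h]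
  simp only [hc, dotProduct, Complex.norm_real, Real.norm_eq_abs, pow_two, abs_mul_abs_self]

open Polynomial in
-- Time-invariant filtering is multiplication of polynomials, without truncation because a block has
-- `n + k` output slots.
theorem centre_polynomial {k n : ℕ} (c : Fin (k + 1) → ℝ) (x : Fin n → ℝ) :
    (∑ t : Fin (n + k), C (((centreMatrix n c *ᵥ x) t : ℝ) : ℂ) * X ^ (t : ℕ) : ℂ[X]) =
      (∑ i : Fin (k + 1), C (c i : ℂ) * X ^ (i : ℕ)) * ∑ j : Fin n, C (x j : ℂ) * X ^ (j : ℕ) := by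
  have h1 : ∀ t : Fin (n + k), (C (((centreMatrix n c *ᵥ x) t : ℝ) : ℂ) * X ^ (t : ℕ) : ℂ[X]) =
      ∑ i : Fin (k + 1), ∑ j : Fin n, if (t : ℕ) = i + j then
        C (c i : ℂ) * X ^ (i : ℕ) * (C (x j : ℂ) * X ^ (j : ℕ)) else 0 := by
    intro t
    rw [centreMatrix, channelMatrix_mulVec]
    simp only [tapInput, Finset.mul_sum]
    rw [Complex.ofReal_sum, map_sum, Finset.sum_mul]
    refine Finset.sum_congr rfl fun i _ => ?_
    rw [Complex.ofReal_sum, map_sum, Finset.sum_mul]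
    refine Finset.sum_congr rfl fun j _ => ?_
    split_ifs with he
    · rw [he, pow_add]
      simp only [Complex.ofReal_mul, map_mul]
      ring
    · simp
  simp_rw [h1]
  rw [Finset.sum_comm, Finset.sum_mul_sum]
  refine Finset.sum_congr rfl fun i _ => ?_
  rw [Finset.sum_comm]
  refine Finset.sum_congr rfl fun j _ => ?_
  have hi := i.2
  have hj := j.2
  rw [Finset.sum_eq_single (⟨i + j, by omega⟩ : Fin (n + k))]
  · simp
  · intro b _ hb
    exact if_neg fun he => hb (Fin.ext he)
  · simp

theorem continuous_gain {k : ℕ} (c : Fin (k + 1) → ℝ) : Continuous (gain c) := by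
  unfold gain; fun_prop

theorem gain_nonneg {k : ℕ} (c : Fin (k + 1) → ℝ) (ω : ℝ) : 0 ≤ gain c ω := norm_nonneg _

theorem isCompact_gain_image {k : ℕ} (c : Fin (k + 1) → ℝ) :
    IsCompact (gain c '' Set.Icc 0 (2 * Real.pi)) :=
  isCompact_Icc.image (continuous_gain c)

theorem alpha_nonneg {k : ℕ} (c : Fin (k + 1) → ℝ) : 0 ≤ alpha c :=
  Real.sInf_nonneg (by rintro _ ⟨ω, _, rfl⟩; exact gain_nonneg c ω)

theorem beta_nonneg {k : ℕ} (c : Fin (k + 1) → ℝ) : 0 ≤ beta c :=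
  Real.sSup_nonneg (by rintro _ ⟨ω, _, rfl⟩; exact gain_nonneg c ω)

open Polynomial in
-- By Parseval both energies are averages over the unit circle. The filter multiplies the integrand
-- by `|f|²`, which lies between `α²` and `β²`.
theorem centreMatrix_energy {k n : ℕ} (c : Fin (k + 1) → ℝ) (x : Fin n → ℝ) :
    alpha c ^ 2 * (x ⬝ᵥ x) ≤ (centreMatrix n c *ᵥ x) ⬝ᵥ (centreMatrix n c *ᵥ x) ∧
      (centreMatrix n c *ᵥ x) ⬝ᵥ (centreMatrix n c *ᵥ x) ≤ beta c ^ 2 * (x ⬝ᵥ x) := by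
  set q : ℂ[X] := ∑ j : Fin n, C (x j : ℂ) * X ^ (j : ℕ)
  have hg : ∀ θ : ℝ, ‖(∑ i : Fin (k + 1), C (c i : ℂ) * X ^ (i : ℕ) : ℂ[X]).eval
      (circleMap 0 1 θ)‖ = gain c θ := by
    intro θ
    unfold gain circleMap
    simp only [eval_finsetSum, eval_mul, eval_C, eval_pow, eval_X, zero_add, Complex.ofReal_one,
      one_mul, ← Complex.exp_nat_mul]
    congr 1
    refine Finset.sum_congr rfl fun i _ => ?_
    congr 2; ring
  have hy : (centreMatrix n c *ᵥ x) ⬝ᵥ (centreMatrix n c *ᵥ x) =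
      (2 * Real.pi)⁻¹ * ∫ θ in (0 : ℝ)..2 * Real.pi, gain c θ ^ 2 * ‖q.eval (circleMap 0 1 θ)‖ ^ 2 := by
    rw [← circleAverage_sum_sq, centre_polynomial, Real.circleAverage, smul_eq_mul]
    simp only [eval_mul, norm_mul, mul_pow, hg]
    rfl
  have hx : x ⬝ᵥ x =
      (2 * Real.pi)⁻¹ * ∫ θ in (0 : ℝ)..2 * Real.pi, ‖q.eval (circleMap 0 1 θ)‖ ^ 2 := by
    rw [← circleAverage_sum_sq, Real.circleAverage, smul_eq_mul]
  have hcq : Continuous fun θ : ℝ => ‖q.eval (circleMap 0 1 θ)‖ ^ 2 :=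
    ((q.continuous.comp (continuous_circleMap 0 1)).norm).pow 2
  have hcg := (continuous_gain c).pow 2
  have hpi := Real.two_pi_pos
  have hmem : ∀ θ ∈ Set.Icc 0 (2 * Real.pi), alpha c ≤ gain c θ ∧ gain c θ ≤ beta c := fun θ hθ =>
    ⟨csInf_le (isCompact_gain_image c).bddBelow ⟨θ, hθ, rfl⟩,
      le_csSup (isCompact_gain_image c).bddAbove ⟨θ, hθ, rfl⟩⟩
  have hα := alpha_nonneg c
  have hpi' : 0 ≤ (2 * Real.pi)⁻¹ := by positivity
  have hcc : ∀ a : ℝ, IntervalIntegrable (fun θ => a ^ 2 * ‖q.eval (circleMap 0 1 θ)‖ ^ 2) volume 0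
      (2 * Real.pi) := fun a => (continuous_const.mul hcq).intervalIntegrable _ _
  have hci : IntervalIntegrable (fun θ => gain c θ ^ 2 * ‖q.eval (circleMap 0 1 θ)‖ ^ 2) volume 0
      (2 * Real.pi) := (hcg.mul hcq).intervalIntegrable _ _
  rw [hy, hx, mul_left_comm, mul_left_comm (beta c ^ 2),
    ← intervalIntegral.integral_const_mul (alpha c ^ 2),
    ← intervalIntegral.integral_const_mul (beta c ^ 2)]
  constructor
  · refine mul_le_mul_of_nonneg_left (intervalIntegral.integral_mono_on hpi.le (hcc _) hci
      fun θ hθ => ?_) hpi'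
    have := (hmem θ hθ).1
    gcongr
  · refine mul_le_mul_of_nonneg_left (intervalIntegral.integral_mono_on hpi.le hci (hcc _)
      fun θ hθ => ?_) hpi'
    have := (hmem θ hθ).2
    have := gain_nonneg c θ
    gcongr

/-! ### Factorizations, determinants and quadratic forms -/

/-- A positive definite matrix is `B Bᵀ` for some `B` with orthogonal columns. -/
theorem exists_factor {n : ℕ} {S : Matrix (Fin n) (Fin n) ℝ} (hS : S.PosDef) :
    ∃ (B : Matrix (Fin n) (Fin n) ℝ) (d : Fin n → ℝ), B * Bᵀ = S ∧ Bᵀ * B = Matrix.diagonal d ∧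
      (∀ i, 0 < d i ∧ lamMin S ≤ d i ∧ d i ≤ lamMax S) ∧ ∑ i, d i = S.trace := by
  have hH := hS.isHermitian
  set d := hH.eigenvalues with hd
  set U : Matrix (Fin n) (Fin n) ℝ := ↑hH.eigenvectorUnitary with hU
  have hUU : Uᵀ * U = 1 := by
    have := Unitary.coe_star_mul_self hH.eigenvectorUnitary
    simpa [Matrix.star_eq_conjTranspose] using this
  have hpos : ∀ i, 0 < d i := fun i => hS.eigenvalues_pos i
  have hspec : S = U * Matrix.diagonal d * Uᵀ := by
    have := hH.spectral_theorem
    rw [Unitary.conjStarAlgAut_apply] at this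
    simpa [Matrix.star_eq_conjTranspose, Function.comp_def] using this
  have hsq : Matrix.diagonal (fun i => √(d i)) * Matrix.diagonal (fun i => √(d i)) =
      Matrix.diagonal d := by
    rw [Matrix.diagonal_mul_diagonal]
    congr 1; ext i; exact Real.mul_self_sqrt (hpos i).le
  have hfin : (spectrum ℝ S).Finite := by
    rw [hH.spectrum_real_eq_range_eigenvalues]; exact Set.finite_range _
  have hmem : ∀ i, d i ∈ spectrum ℝ S := fun i => by
    rw [hH.spectrum_real_eq_range_eigenvalues]; exact ⟨i, rfl⟩
  refine ⟨U * Matrix.diagonal fun i => √(d i), d, ?_, ?_, fun i => ⟨hpos i, ?_, ?_⟩, ?_⟩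
  · rw [Matrix.transpose_mul, Matrix.diagonal_transpose, hspec, ← hsq]
    simp only [Matrix.mul_assoc]
  · rw [Matrix.transpose_mul, Matrix.diagonal_transpose, Matrix.mul_assoc, ← Matrix.mul_assoc Uᵀ,
      hUU, Matrix.one_mul, hsq]
  · exact csInf_le hfin.bddBelow (hmem i)
  · exact le_csSup hfin.bddAbove (hmem i)
  · rw [hH.trace_eq_sum_eigenvalues]; simp [hd]

theorem dotProduct_mulVec_self {m n : ℕ} (A : Matrix (Fin m) (Fin n) ℝ) (u : Fin n → ℝ) :
    (A *ᵥ u) ⬝ᵥ (A *ᵥ u) = u ⬝ᵥ ((Aᵀ * A) *ᵥ u) := by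
  rw [← Matrix.mulVec_mulVec, Matrix.dotProduct_mulVec u, Matrix.vecMul_transpose]

theorem one_le_det {n : ℕ} {C : Matrix (Fin n) (Fin n) ℝ} (hC : C.IsHermitian)
    (h : ∀ u, u ⬝ᵥ u ≤ u ⬝ᵥ (C *ᵥ u)) : 1 ≤ C.det := by
  rw [hC.det_eq_prod_eigenvalues]
  simp only [RCLike.ofReal_real_eq_id, id]
  have h1 : ∀ i, 1 ≤ hC.eigenvalues i := by
    intro i
    set v : Fin n → ℝ := ⇑(hC.eigenvectorBasis i) with hv
    have hv0 : v ≠ 0 := fun h0 => hC.eigenvectorBasis.orthonormal.ne_zero i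
      ((WithLp.ofLp_injective 2) h0)
    have hvv : 0 < v ⬝ᵥ v := by
      refine lt_of_le_of_ne (Finset.sum_nonneg fun i _ => mul_self_nonneg _) fun h0 => hv0 ?_
      exact dotProduct_self_eq_zero.1 h0.symm
    have := h v
    rw [hC.mulVec_eigenvectorBasis i, dotProduct_smul, smul_eq_mul] at this
    exact le_of_mul_le_mul_right (by rw [one_mul]; exact this) hvv
  calc (1 : ℝ) = ∏ i : Fin n, 1 := by simp
    _ ≤ _ := Finset.prod_le_prod (fun _ _ => zero_le_one) fun i _ => h1 i

/-- Congruence by `B⁻¹`, where `A = B Bᵀ`, reduces the claim to `A = 1`; there every eigenvalue of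
the larger matrix is at least one. -/
theorem det_le_det_of_forall_le {n : ℕ} {A C : Matrix (Fin n) (Fin n) ℝ} (hA : A.PosDef)
    (hC : C.IsHermitian) (h : ∀ u, u ⬝ᵥ (A *ᵥ u) ≤ u ⬝ᵥ (C *ᵥ u)) : A.det ≤ C.det := by
  obtain ⟨B, d, hB, -, -, -⟩ := exists_factor hA
  have hdet : B.det * B.det = A.det := by rw [← hB, Matrix.det_mul, Matrix.det_transpose]
  have hB0 : IsUnit B.det := by
    refine isUnit_iff_ne_zero.2 fun h0 => hA.det_pos.ne' ?_
    rw [← hdet, h0, mul_zero]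
  have hBi : B⁻¹ * B = 1 := Matrix.nonsing_inv_mul B hB0
  have hBi' : B * B⁻¹ = 1 := Matrix.mul_nonsing_inv B hB0
  have hBt : Bᵀ * (B⁻¹)ᵀ = 1 := by rw [← Matrix.transpose_mul, hBi, Matrix.transpose_one]
  have hq : ∀ (G : Matrix (Fin n) (Fin n) ℝ) (u : Fin n → ℝ),
      u ⬝ᵥ ((B⁻¹ * G * (B⁻¹)ᵀ) *ᵥ u) = ((B⁻¹)ᵀ *ᵥ u) ⬝ᵥ (G *ᵥ ((B⁻¹)ᵀ *ᵥ u)) := by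
    intro G u
    rw [← Matrix.mulVec_mulVec, ← Matrix.mulVec_mulVec, Matrix.dotProduct_mulVec u,
      ← Matrix.mulVec_transpose]
  have h1 : 1 ≤ (B⁻¹ * C * (B⁻¹)ᵀ).det := by
    refine one_le_det ?_ fun u => ?_
    · have := Matrix.isHermitian_mul_mul_conjTranspose B⁻¹ hC
      simpa using this
    · have e : u ⬝ᵥ u = u ⬝ᵥ ((B⁻¹ * A * (B⁻¹)ᵀ) *ᵥ u) := by
        rw [← hB, ← Matrix.mul_assoc, hBi, Matrix.one_mul, hBt, Matrix.one_mulVec]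
      rw [e, hq, hq]
      exact h _
  have e2 : C.det = B.det * B.det * (B⁻¹ * C * (B⁻¹)ᵀ).det := by
    have e3 : B.det * B⁻¹.det = 1 := by rw [← Matrix.det_mul, hBi', Matrix.det_one]
    rw [Matrix.det_mul, Matrix.det_mul, Matrix.det_transpose]
    linear_combination (-B.det * B⁻¹.det * C.det - C.det) * e3
  rw [e2, hdet]
  exact le_mul_of_one_le_right hA.det_pos.le h1

/-- The Schur complement of `S` in the joint covariance is the noise covariance, namely the
identity; hence no further inverse appears. -/
theorem jointCov_inv {k n : ℕ} (c : Fin (k + 1) → ℝ) {S : Matrix (Fin n) (Fin n) ℝ}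
    (hS : IsUnit S.det) :
    (jointCov c S)⁻¹ = Matrix.fromBlocks (S⁻¹ + (centreMatrix n c)ᵀ * centreMatrix n c)
      (-(centreMatrix n c)ᵀ) (-centreMatrix n c) 1 := by
  refine Matrix.inv_eq_left_inv ?_
  have hi : S⁻¹ * S = 1 := Matrix.nonsing_inv_mul S hS
  rw [jointCov, Matrix.fromBlocks_multiply, ← Matrix.fromBlocks_one]
  have h1 : ∀ G : Matrix (Fin n) (Fin (n + k)) ℝ, S⁻¹ * (S * G) = G := fun G => by
    rw [← Matrix.mul_assoc, hi, Matrix.one_mul]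
  congr 1
  · rw [Matrix.add_mul, hi]; simp [Matrix.mul_assoc]
  · rw [Matrix.add_mul, h1]; simp only [Matrix.mul_add, Matrix.mul_assoc, Matrix.neg_mul, Matrix.mul_one]; abel
  · simp
  · simp [Matrix.mul_assoc]

/-- This is the factorization of the joint density into the input density and the density of the
residual. It makes the typicality test a test of energies. -/
theorem jointCov_inv_quadratic {k n : ℕ} (c : Fin (k + 1) → ℝ) {S : Matrix (Fin n) (Fin n) ℝ}
    (hS : IsUnit S.det) (x : Fin n → ℝ) (y : Fin (n + k) → ℝ) :
    Sum.elim x y ⬝ᵥ ((jointCov c S)⁻¹ *ᵥ Sum.elim x y) = x ⬝ᵥ (S⁻¹ *ᵥ x) +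
      (y - centreMatrix n c *ᵥ x) ⬝ᵥ (y - centreMatrix n c *ᵥ x) := by
  rw [jointCov_inv c hS, Matrix.fromBlocks_mulVec]
  have e1 : (Sum.elim x y : Fin n ⊕ Fin (n + k) → ℝ) ∘ Sum.inl = x := rfl
  have e2 : (Sum.elim x y : Fin n ⊕ Fin (n + k) → ℝ) ∘ Sum.inr = y := rfl
  rw [e1, e2, sumElim_dotProduct_sumElim]
  set H := centreMatrix n c
  have e3 : x ⬝ᵥ (Hᵀ *ᵥ y) = (H *ᵥ x) ⬝ᵥ y := by
    rw [Matrix.dotProduct_mulVec, Matrix.vecMul_transpose]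
  simp only [Matrix.add_mulVec, Matrix.neg_mulVec, Matrix.one_mulVec, dotProduct_add,
    dotProduct_neg, sub_dotProduct, dotProduct_sub, ← dotProduct_mulVec_self, e3]
  rw [dotProduct_comm y (H *ᵥ x)]
  ring

/-! ### Energies and determinants for perturbed taps -/

/-- Every tap lies in its interval. -/
def InBox {k : ℕ} (c r : Fin (k + 1) → ℝ) (h : Taps k) : Prop :=
  ∀ t i, h t i ∈ Set.Icc (c i - r i) (c i + r i)

theorem InBox.abs_sub_le {k : ℕ} {c r : Fin (k + 1) → ℝ} {h : Taps k} (hb : InBox c r h) :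
    ∀ t i, |(h - fun _ => c : Taps k) t i| ≤ r i := by
  intro t i
  have := hb t i
  simp only [Pi.sub_apply]
  rw [abs_le]
  constructor <;> linarith [this.1, this.2]

theorem dotProduct_self_nonneg_real {n : ℕ} (v : Fin n → ℝ) : 0 ≤ v ⬝ᵥ v :=
  Finset.sum_nonneg fun _ _ => mul_self_nonneg _

theorem abs_dotProduct_le {n : ℕ} {a b : Fin n → ℝ} {p q : ℝ} (hp : 0 ≤ p) (hq : 0 ≤ q)
    (ha : a ⬝ᵥ a ≤ p ^ 2) (hb : b ⬝ᵥ b ≤ q ^ 2) : |a ⬝ᵥ b| ≤ p * q := by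
  refine abs_le_of_sq_le_sq (?_ : (a ⬝ᵥ b) ^ 2 ≤ (p * q) ^ 2) (by positivity)
  have h1 : (a ⬝ᵥ b) ^ 2 ≤ (a ⬝ᵥ a) * (b ⬝ᵥ b) := by
    have := Finset.sum_mul_sq_le_sq_mul_sq Finset.univ a b
    simpa [dotProduct, pow_two] using this
  rw [mul_pow]
  exact h1.trans (mul_le_mul ha hb (dotProduct_self_nonneg_real _) (by positivity))

theorem channelMatrix_mulVec_split {k n : ℕ} (c : Fin (k + 1) → ℝ) (h : Taps k) (x : Fin n → ℝ) :
    channelMatrix n h *ᵥ x = centreMatrix n c *ᵥ x + channelMatrix n (h - fun _ => c) *ᵥ x := by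
  rw [← channelMatrix_sub, Matrix.sub_mulVec, centreMatrix]; abel

/-- Expand `|H_c x + (H - H_c) x|²` and drop the square of the perturbation. The cross term costs at
most `2 β r_s |x|²`; the further `r_s² |x|²` is slack that matches the constant in `phi1`. -/
theorem channelMatrix_energy_ge {k n : ℕ} {c r : Fin (k + 1) → ℝ} {h : Taps k} (hb : InBox c r h)
    (x : Fin n → ℝ) :
    (centreMatrix n c *ᵥ x) ⬝ᵥ (centreMatrix n c *ᵥ x) - rSum r * (rSum r + 2 * beta c) * (x ⬝ᵥ x) ≤
      (channelMatrix n h *ᵥ x) ⬝ᵥ (channelMatrix n h *ᵥ x) := by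
  have hr0 : ∀ i, 0 ≤ r i := fun i => (abs_nonneg _).trans (hb.abs_sub_le 0 i)
  have hrs : 0 ≤ rSum r := Finset.sum_nonneg fun i _ => hr0 i
  have hβ := beta_nonneg c
  rw [channelMatrix_mulVec_split c h x]
  set a := centreMatrix n c *ᵥ x
  set b := channelMatrix n (h - fun _ => c) *ᵥ x
  have hx := dotProduct_self_nonneg_real x
  set e := √(x ⬝ᵥ x)
  have he : e ^ 2 = x ⬝ᵥ x := Real.sq_sqrt hx
  have he0 : 0 ≤ e := Real.sqrt_nonneg _
  have h1 : |a ⬝ᵥ b| ≤ (beta c * e) * (rSum r * e) := by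
    refine abs_dotProduct_le (by positivity) (by positivity) ?_ ?_
    · rw [mul_pow, he]; exact (centreMatrix_energy c x).2
    · rw [mul_pow, he]; exact channelMatrix_energy_le_rSum hb.abs_sub_le x
  have h2 := (abs_le.1 h1).1
  have hbb := dotProduct_self_nonneg_real b
  rw [add_dotProduct, dotProduct_add, dotProduct_add, dotProduct_comm b a]
  have h3 : 0 ≤ rSum r * rSum r * (x ⬝ᵥ x) := by positivity
  have h4 : beta c * e * (rSum r * e) = beta c * rSum r * (x ⬝ᵥ x) := by rw [← he]; ring
  linarith

theorem posDef_one_add_mul_transpose {n m : ℕ} (A : Matrix (Fin m) (Fin n) ℝ) :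
    (1 + A * Aᵀ).PosDef := by
  have := Matrix.posSemidef_self_mul_conjTranspose A
  rw [Matrix.conjTranspose_eq_transpose_of_trivial] at this
  exact Matrix.PosDef.one.add_posSemidef this

theorem posDef_one_add_transpose_mul {n m : ℕ} (A : Matrix (Fin m) (Fin n) ℝ) :
    (1 + Aᵀ * A).PosDef := by
  simpa using posDef_one_add_mul_transpose Aᵀ

theorem lamMin_nonneg {n : ℕ} {S : Matrix (Fin n) (Fin n) ℝ} (hS : S.PosDef) : 0 ≤ lamMin S := by
  refine Real.sInf_nonneg fun x hx => ?_
  rw [hS.isHermitian.spectrum_real_eq_range_eigenvalues] at hx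
  obtain ⟨i, rfl⟩ := hx
  exact (hS.eigenvalues_pos i).le

theorem lamMax_nonneg {n : ℕ} {S : Matrix (Fin n) (Fin n) ℝ} (hS : S.PosDef) : 0 ≤ lamMax S := by
  refine Real.sSup_nonneg fun x hx => ?_
  rw [hS.isHermitian.spectrum_real_eq_range_eigenvalues] at hx
  obtain ⟨i, rfl⟩ := hx
  exact (hS.eigenvalues_pos i).le

/-- The output covariance under any admissible taps has a determinant not much smaller than for
the centre taps. -/
theorem det_output_cov_ge {k n : ℕ} {c r : Fin (k + 1) → ℝ} {h : Taps k} (hb : InBox c r h)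
    {S : Matrix (Fin n) (Fin n) ℝ} (hS : S.PosDef) (hphi : phi1 c r S < 1)
    {B : Matrix (Fin n) (Fin n) ℝ} {d : Fin n → ℝ} (hB : B * Bᵀ = S)
    (hBd : Bᵀ * B = Matrix.diagonal d)
    (hd : ∀ i, 0 < d i ∧ lamMin S ≤ d i ∧ d i ≤ lamMax S) :
    (1 - phi1 c r S) ^ n * (1 + (centreMatrix n c)ᵀ * centreMatrix n c * S).det ≤
      (1 + (channelMatrix n h * B) * (channelMatrix n h * B)ᵀ).det := by
  set H := channelMatrix n h
  set Hc := centreMatrix n c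
  have hr0 : ∀ i, 0 ≤ r i := fun i => (abs_nonneg _).trans (hb.abs_sub_le 0 i)
  have hrs : 0 ≤ rSum r := Finset.sum_nonneg fun i _ => hr0 i
  have hβ := beta_nonneg c
  have e1 : (1 + Hcᵀ * Hc * S).det = (1 + (Hc * B)ᵀ * (Hc * B)).det := by
    rw [← hB, ← Matrix.mul_assoc, Matrix.det_one_add_mul_comm, Matrix.transpose_mul]
    simp only [Matrix.mul_assoc]
  have e2 : (1 - phi1 c r S) ^ n * (1 + (Hc * B)ᵀ * (Hc * B)).det =
      ((1 - phi1 c r S) • (1 + (Hc * B)ᵀ * (Hc * B))).det := by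
    rw [Matrix.det_smul, Fintype.card_fin]
  have hq : ∀ (A : Matrix (Fin (n + k)) (Fin n) ℝ) (u : Fin n → ℝ), u ⬝ᵥ ((1 + Aᵀ * A) *ᵥ u) =
      u ⬝ᵥ u + (A *ᵥ u) ⬝ᵥ (A *ᵥ u) := fun A u => by
    rw [Matrix.add_mulVec, Matrix.one_mulVec, dotProduct_add, dotProduct_mulVec_self]
  -- Sylvester's identity passes to the `n × n` side, where scaling by `1 - phi1` costs the power
  -- `n` and not `n + k`.
  rw [e1, e2, Matrix.det_one_add_mul_comm]
  refine det_le_det_of_forall_le ((posDef_one_add_transpose_mul _).smul (by linarith))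
    (posDef_one_add_transpose_mul _).isHermitian fun u => ?_
  rw [Matrix.smul_mulVec, dotProduct_smul, hq, hq, smul_eq_mul, ← Matrix.mulVec_mulVec,
    ← Matrix.mulVec_mulVec]
  set x := B *ᵥ u with hx
  have hxu : x ⬝ᵥ x = ∑ i, d i * (u i * u i) := by
    rw [hx, dotProduct_mulVec_self, hBd]
    simp only [dotProduct, Matrix.mulVec_diagonal]
    exact Finset.sum_congr rfl fun i _ => by ring
  have hlo : lamMin S * (u ⬝ᵥ u) ≤ x ⬝ᵥ x := by
    rw [hxu, dotProduct, Finset.mul_sum]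
    exact Finset.sum_le_sum fun i _ => mul_le_mul_of_nonneg_right (hd i).2.1 (mul_self_nonneg _)
  have hhi : x ⬝ᵥ x ≤ lamMax S * (u ⬝ᵥ u) := by
    rw [hxu, dotProduct, Finset.mul_sum]
    exact Finset.sum_le_sum fun i _ => mul_le_mul_of_nonneg_right (hd i).2.2 (mul_self_nonneg _)
  have h1 := channelMatrix_energy_ge hb x
  have h2 := (centreMatrix_energy c x).1
  have hm := lamMin_nonneg hS
  have hden : 0 < 1 + alpha c ^ 2 * lamMin S := by positivity
  set κ := rSum r * (rSum r + 2 * beta c) with hκ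
  have hκ0 : 0 ≤ κ := by positivity
  have hφ : phi1 c r S * (1 + alpha c ^ 2 * lamMin S) = κ * lamMax S := by
    rw [phi1, div_mul_cancel₀ _ hden.ne']
  have hφ0 : 0 ≤ phi1 c r S := by
    rw [phi1]; have := lamMax_nonneg hS; positivity
  have huu := dotProduct_self_nonneg_real u
  -- The loss `κ |x|²` is absorbed into a fraction `phi1` of the centre form. `λmax` bounds `|x|²`
  -- from above by `|u|²`, and `λmin` with `α` returns part of this as output energy, whence the
  -- denominator of `phi1`.
  have h3 : κ * (x ⬝ᵥ x) ≤ phi1 c r S * (u ⬝ᵥ u + (Hc *ᵥ x) ⬝ᵥ (Hc *ᵥ x)) := by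
    calc κ * (x ⬝ᵥ x) ≤ κ * (lamMax S * (u ⬝ᵥ u)) := by gcongr
      _ = phi1 c r S * (u ⬝ᵥ u + alpha c ^ 2 * (lamMin S * (u ⬝ᵥ u))) := by
          linear_combination -(u ⬝ᵥ u) * hφ
      _ ≤ phi1 c r S * (u ⬝ᵥ u + alpha c ^ 2 * (x ⬝ᵥ x)) := by gcongr
      _ ≤ _ := by gcongr
  change _ ≤ u ⬝ᵥ u + (H *ᵥ x) ⬝ᵥ (H *ᵥ x)
  have h1' : (Hc *ᵥ x) ⬝ᵥ (Hc *ᵥ x) - κ * (x ⬝ᵥ x) ≤ (H *ᵥ x) ⬝ᵥ (H *ᵥ x) := h1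
  nlinarith

/-! ### Measurability and marginals -/

theorem measurableSet_typicalSet {ι : Type} [Fintype ι] [DecidableEq ι] (S : Matrix ι ι ℝ) (η : ℝ) :
    MeasurableSet (typicalSet S η) := by
  have m1 : Measurable fun a : ι → ℝ => a ⬝ᵥ (S⁻¹ *ᵥ a) := by
    have : Continuous fun a : ι → ℝ => a ⬝ᵥ (S⁻¹ *ᵥ a) :=
      continuous_id.dotProduct (continuous_const.matrix_mulVec continuous_id)
    exact this.measurable
  exact measurableSet_lt (((m1.const_mul _).sub_const _).abs) measurable_const

theorem measurable_sumElim {ι κ : Type} [Fintype ι] [Fintype κ] :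
    Measurable fun p : (ι → ℝ) × (κ → ℝ) => (Sum.elim p.1 p.2 : ι ⊕ κ → ℝ) := by
  refine measurable_pi_iff.2 fun s => ?_
  cases s with
  | inl i => exact (measurable_pi_apply i).comp measurable_fst
  | inr i => exact (measurable_pi_apply i).comp measurable_snd

theorem measurableSet_jointlyTypical {k n : ℕ} (c : Fin (k + 1) → ℝ) (S : Matrix (Fin n) (Fin n) ℝ)
    (ε η : ℝ) : MeasurableSet {p : (Fin n → ℝ) × (Fin (n + k) → ℝ) |
      JointlyTypical c S ε η p.1 p.2} :=
  (measurable_fst (measurableSet_typicalSet S ε)).inter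
    (measurable_sumElim (measurableSet_typicalSet (jointCov c S) η))

/-- The union bound treats one wrong codeword at a time, so the joint law of two codewords is all
that is used. -/
theorem measurePreserving_eval_pair {ι E : Type*} [Fintype ι] [MeasurableSpace E]
    (μ : ι → Measure E) [∀ i, IsProbabilityMeasure (μ i)] {i j : ι} (hij : i ≠ j) :
    MeasurePreserving (fun x : ι → E => (x i, x j)) (Measure.pi μ) ((μ i).prod (μ j)) := by
  refine ⟨(measurable_pi_apply i).prodMk (measurable_pi_apply j), ?_⟩
  have hI := (iIndepFun_pi (μ := μ) (X := fun _ => id) fun i => aemeasurable_id).indepFun hij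
  have hI' := (indepFun_iff_map_prod_eq_prod_map_map (measurable_pi_apply i).aemeasurable
    (measurable_pi_apply j).aemeasurable).1 hI
  rw [hI', (measurePreserving_eval μ i).map_eq, (measurePreserving_eval μ j).map_eq]

theorem measureReal_preimage_of_measurePreserving {α β : Type*} [MeasurableSpace α]
    [MeasurableSpace β] {μ : Measure α} {ν : Measure β} {f : α → β} (hf : MeasurePreserving f μ ν)
    {s : Set β} (hs : MeasurableSet s) : μ.real (f ⁻¹' s) = ν.real s := by
  rw [measureReal_def, measureReal_def, hf.measure_preimage hs.nullMeasurableSet]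

theorem prod_real_le_of_forall {α β : Type*} [MeasurableSpace α] [MeasurableSpace β]
    {μ : Measure α} {ν : Measure β} [IsProbabilityMeasure μ] [IsProbabilityMeasure ν]
    {s : Set (α × β)} (hs : MeasurableSet s) {b : ℝ} (hb : 0 ≤ b)
    (h : ∀ᵐ x ∂μ, ν.real (Prod.mk x ⁻¹' s) ≤ b) : (μ.prod ν).real s ≤ b := by
  have : (μ.prod ν) s ≤ ENNReal.ofReal b := by
    rw [Measure.prod_apply hs]
    calc _ ≤ ∫⁻ _, ENNReal.ofReal b ∂μ := lintegral_mono_ae (h.mono fun x hx => by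
          rw [measureReal_def] at hx
          exact (ENNReal.le_ofReal_iff_toReal_le (measure_ne_top _ _) hb).2 hx)
      _ = _ := by simp
  exact ENNReal.toReal_le_of_le_ofReal hb this

/-! ### The transmitted codeword -/

/-- The constant relating the energy of the tap perturbation to the energy of the input. -/
def tapConst {k : ℕ} (r : Fin (k + 1) → ℝ) : ℝ := ((k : ℝ) + 1) * ∑ i, r i ^ 2

theorem tapConst_nonneg {k : ℕ} (r : Fin (k + 1) → ℝ) : 0 ≤ tapConst r :=
  mul_nonneg (by positivity) (Finset.sum_nonneg fun _ _ => sq_nonneg _)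

theorem output_sub_centre {k n : ℕ} (c : Fin (k + 1) → ℝ) (h : Taps k) (x : Fin n → ℝ)
    (z : Fin (n + k) → ℝ) :
    output h x z - centreMatrix n c *ᵥ x = channelMatrix n (h - fun _ => c) *ᵥ x + z := by
  rw [output, channelMatrix_mulVec_split c h x]; abel

theorem jointlyTypical_iff {k n : ℕ} (c : Fin (k + 1) → ℝ) {S : Matrix (Fin n) (Fin n) ℝ}
    (hS : S.PosDef) (ε η : ℝ) (x : Fin n → ℝ) (y : Fin (n + k) → ℝ) :
    JointlyTypical c S ε η x y ↔ |1 / (n : ℝ) * (x ⬝ᵥ (S⁻¹ *ᵥ x)) - 1| < ε ∧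
      |1 / ((n : ℝ) + (n + k)) * (x ⬝ᵥ (S⁻¹ *ᵥ x) + (y - centreMatrix n c *ᵥ x) ⬝ᵥ
        (y - centreMatrix n c *ᵥ x)) - 1| < η := by
  have hu : IsUnit S.det := isUnit_iff_ne_zero.2 hS.det_pos.ne'
  rw [JointlyTypical, typicalSet, typicalSet, Set.mem_ofPred_eq, Set.mem_ofPred_eq,
    jointCov_inv_quadratic c hu]
  simp [Fintype.card_sum]

/-- With `a = (H - H_c) x`, the statistic deviates from `n + m` by `(xᵀ S⁻¹ x - n) + |a|² + 2 a·z +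
(|z|² - m)`. The middle square is at most `tapConst r * (tr S + ε n)`, and the other terms
contribute `1 + 2 + 1` times `ε n`: this is the constant `tapConst r + 4`. -/
theorem jointlyTypical_output {k n : ℕ} (hn : 0 < n) {c r : Fin (k + 1) → ℝ} {h : Taps k}
    (hb : InBox c r h) {S : Matrix (Fin n) (Fin n) ℝ} (hS : S.PosDef) {ε η : ℝ} (hε : 0 < ε)
    (hη : tapConst r * (S.trace / ((n : ℝ) + k + n)) + ε * (tapConst r + 4) ≤ η)
    {x : Fin n → ℝ} {z : Fin (n + k) → ℝ}
    (hx : |x ⬝ᵥ (S⁻¹ *ᵥ x) - n| < ε * n) (hx2 : x ⬝ᵥ x < S.trace + ε * n)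
    (hz : |z ⬝ᵥ z - (n + k : ℕ)| < ε * n)
    (hxz : |(channelMatrix n (h - fun _ => c) *ᵥ x) ⬝ᵥ z| < ε * n) :
    JointlyTypical c S ε η x (output h x z) := by
  have hn' : (0 : ℝ) < n := by exact_mod_cast hn
  have hk : (0 : ℝ) ≤ k := Nat.cast_nonneg k
  have hC := tapConst_nonneg r
  have htr : 0 ≤ S.trace := hS.posSemidef.trace_nonneg
  rw [jointlyTypical_iff c hS, output_sub_centre]
  constructor
  · have e : 1 / (n : ℝ) * (x ⬝ᵥ (S⁻¹ *ᵥ x)) - 1 = (x ⬝ᵥ (S⁻¹ *ᵥ x) - n) / n := by field_simp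
    rw [e, abs_div, abs_of_pos hn', div_lt_iff₀ hn']
    exact hx
  · set a := channelMatrix n (h - fun _ => c) *ᵥ x
    have ha : a ⬝ᵥ a ≤ tapConst r * (x ⬝ᵥ x) := channelMatrix_energy_le (fun t => hb.abs_sub_le t) x
    have ha2 : tapConst r * (x ⬝ᵥ x) ≤ tapConst r * (S.trace + ε * n) := by gcongr
    have ha0 := dotProduct_self_nonneg_real a
    set Q := x ⬝ᵥ (S⁻¹ *ᵥ x)
    have hN : (0 : ℝ) < (n : ℝ) + (n + k) := by positivity
    have e : 1 / ((n : ℝ) + (n + k)) * (Q + (a + z) ⬝ᵥ (a + z)) - 1 =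
        (Q - n + a ⬝ᵥ a + 2 * (a ⬝ᵥ z) + (z ⬝ᵥ z - (n + k))) / ((n : ℝ) + (n + k)) := by
      rw [add_dotProduct, dotProduct_add, dotProduct_add, dotProduct_comm z a]
      field_simp; ring
    push_cast at hz
    rw [abs_lt] at hx hz hxz
    rw [e, abs_lt, lt_div_iff₀ hN, div_lt_iff₀ hN]
    have hη' : tapConst r * S.trace + ε * (tapConst r + 4) * ((n : ℝ) + (n + k)) ≤
        η * ((n : ℝ) + (n + k)) := by
      have := mul_le_mul_of_nonneg_right hη hN.le
      refine le_trans (le_of_eq ?_) this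
      have : (n : ℝ) + k + n = (n : ℝ) + (n + k) := by ring
      rw [this]; field_simp
    have h1 : ε * (tapConst r + 4) * n ≤ ε * (tapConst r + 4) * ((n : ℝ) + (n + k)) := by
      gcongr; linarith
    have h2 : 0 ≤ tapConst r * S.trace := by positivity
    have h3 : 0 ≤ ε * tapConst r * n := by positivity
    constructor <;> nlinarith

theorem sum_mul_sq_eq {n : ℕ} {B : Matrix (Fin n) (Fin n) ℝ} {d : Fin n → ℝ}
    (hBd : Bᵀ * B = Matrix.diagonal d) (u : Fin n → ℝ) :
    (B *ᵥ u) ⬝ᵥ (B *ᵥ u) = ∑ i, d i * u i ^ 2 := by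
  rw [dotProduct_mulVec_self, hBd]
  simp only [dotProduct, Matrix.mulVec_diagonal]
  exact Finset.sum_congr rfl fun i _ => by ring

theorem inv_quadratic_factor {n : ℕ} {S B : Matrix (Fin n) (Fin n) ℝ} (hS : S.PosDef)
    (hB : B * Bᵀ = S) (u : Fin n → ℝ) : (B *ᵥ u) ⬝ᵥ (S⁻¹ *ᵥ (B *ᵥ u)) = u ⬝ᵥ u := by
  have hB0 : IsUnit B.det := by
    refine isUnit_iff_ne_zero.2 fun h0 => hS.det_pos.ne' ?_
    rw [← hB, Matrix.det_mul, h0, zero_mul]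
  have e : Bᵀ * (S⁻¹ * B) = 1 := by
    rw [← hB, Matrix.mul_inv_rev, Matrix.mul_assoc, Matrix.nonsing_inv_mul B hB0, Matrix.mul_one,
      Matrix.mul_nonsing_inv]
    rwa [Matrix.det_transpose]
  rw [Matrix.dotProduct_mulVec, Matrix.vecMul_mulVec, ← Matrix.dotProduct_mulVec,
    Matrix.mulVec_mulVec, Matrix.mul_assoc, e, Matrix.one_mulVec]

/-- The contribution of atypical inputs and noise to the error probability. -/
noncomputable def atypicalBound (n k : ℕ) (C trace lmax ε : ℝ) : ℝ :=
  -- The terms belong, in order, to the whitened input energy, the input energy, the noise energy,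
  -- the cross term and the whitened output energy.
  (chiVar * n + chiVar * (lmax * trace) + chiVar * (n + k) + C * (trace + ε * n) +
    chiVar * (n + k)) / (ε * n) ^ 2

section TrueCodeword

variable {k n : ℕ} {c r : Fin (k + 1) → ℝ} {h : Taps k} {S B : Matrix (Fin n) (Fin n) ℝ}
  {d : Fin n → ℝ} {ε : ℝ}

theorem noise_sq_chebyshev (m : ℕ) {s : ℝ} (hs : 0 < s) :
    (noise m).real {z | s ≤ |z ⬝ᵥ z - m|} ≤ chiVar * m / s ^ 2 := by
  have := noise_quadratic_chebyshev (fun _ : Fin m => (1 : ℝ)) hs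
  simpa [dotProduct, pow_two] using this

theorem prod_real_fst_eq {α β : Type*} [MeasurableSpace α] [MeasurableSpace β] {μ : Measure α}
    {ν : Measure β} [IsProbabilityMeasure μ] [IsProbabilityMeasure ν] (s : Set α) :
    (μ.prod ν).real {p | p.1 ∈ s} = μ.real s := by
  rw [measureReal_def, measureReal_def]
  have : {p : α × β | p.1 ∈ s} = s ×ˢ Set.univ := by ext; simp
  rw [this, Measure.prod_prod, measure_univ, mul_one]

theorem prod_real_snd_eq {α β : Type*} [MeasurableSpace α] [MeasurableSpace β] {μ : Measure α}
    {ν : Measure β} [IsProbabilityMeasure μ] [IsProbabilityMeasure ν] (s : Set β) :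
    (μ.prod ν).real {p | p.2 ∈ s} = ν.real s := by
  rw [measureReal_def, measureReal_def]
  have : {p : α × β | p.2 ∈ s} = Set.univ ×ˢ s := by ext; simp
  rw [this, Measure.prod_prod, measure_univ, one_mul]

theorem continuous_dotProduct_self (n : ℕ) : Continuous fun x : Fin n → ℝ => x ⬝ᵥ x :=
  continuous_id.dotProduct continuous_id

/-- One Chebyshev bound for each deviation. The variance of `x ⬝ᵥ x` is proportional to `∑ d i ^ 2 ≤
λmax tr S`, the only quantity here that the trace constraint alone does not make `o(n²)`. -/
theorem atypical_le (hn : 0 < n) (hb : InBox c r h) (hS : S.PosDef) (hε : 0 < ε)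
    (hBd : Bᵀ * B = Matrix.diagonal d)
    (hd : ∀ i, 0 < d i ∧ lamMin S ≤ d i ∧ d i ≤ lamMax S) (hdt : ∑ i, d i = S.trace) :
    ((noise n).prod (noise (n + k))).real {p | ε * n ≤ |p.1 ⬝ᵥ p.1 - n| ∨
      S.trace + ε * n ≤ (B *ᵥ p.1) ⬝ᵥ (B *ᵥ p.1) ∨ ε * n ≤ |p.2 ⬝ᵥ p.2 - (n + k : ℕ)| ∨
      ε * n ≤ |(channelMatrix n (h - fun _ => c) *ᵥ (B *ᵥ p.1)) ⬝ᵥ p.2|} ≤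
      (chiVar * n + chiVar * (lamMax S * S.trace) + chiVar * (n + k) +
        tapConst r * (S.trace + ε * n)) / (ε * n) ^ 2 := by
  have hn' : (0 : ℝ) < n := by exact_mod_cast hn
  have hs : 0 < ε * n := by positivity
  have hC := tapConst_nonneg r
  have hv := chiVar_nonneg
  have htr : 0 ≤ S.trace := hS.posSemidef.trace_nonneg
  set M := channelMatrix n (h - fun _ => c)
  set A1 := {u : Fin n → ℝ | ε * n ≤ |u ⬝ᵥ u - n|}
  set A2 := {u : Fin n → ℝ | ε * n ≤ |∑ i, d i * u i ^ 2 - ∑ i, d i|}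
  set A3 := {z : Fin (n + k) → ℝ | ε * n ≤ |z ⬝ᵥ z - (n + k : ℕ)|}
  -- Given the input, the cross term is linear in the noise with variance `|M x|²`. This is bounded
  -- only for inputs of moderate energy, so that restriction is built into the event.
  set A4 := {p : (Fin n → ℝ) × (Fin (n + k) → ℝ) | (B *ᵥ p.1) ⬝ᵥ (B *ᵥ p.1) ≤ S.trace + ε * n ∧
      ε * n ≤ |(M *ᵥ (B *ᵥ p.1)) ⬝ᵥ p.2|}
  have h1 : ((noise n).prod (noise (n + k))).real {p | p.1 ∈ A1} ≤ chiVar * n / (ε * n) ^ 2 := by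
    rw [prod_real_fst_eq]; exact noise_sq_chebyshev n hs
  have h2 : ((noise n).prod (noise (n + k))).real {p | p.1 ∈ A2} ≤
      chiVar * (lamMax S * S.trace) / (ε * n) ^ 2 := by
    rw [prod_real_fst_eq]
    refine (noise_quadratic_chebyshev d hs).trans ?_
    gcongr
    rw [← hdt, Finset.mul_sum]
    refine Finset.sum_le_sum fun i _ => ?_
    rw [pow_two]
    exact mul_le_mul_of_nonneg_right (hd i).2.2 (hd i).1.le
  have h3 : ((noise n).prod (noise (n + k))).real {p | p.2 ∈ A3} ≤
      chiVar * (n + k) / (ε * n) ^ 2 := by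
    rw [prod_real_snd_eq]
    have := noise_sq_chebyshev (n + k) hs
    push_cast at this ⊢
    simpa [A3] using this
  have cB : Continuous fun p : (Fin n → ℝ) × (Fin (n + k) → ℝ) => B *ᵥ p.1 :=
    continuous_const.matrix_mulVec continuous_fst
  have mA4 : MeasurableSet A4 := by
    have c1 := cB.dotProduct cB
    have c2 := (((continuous_const (y := M)).matrix_mulVec cB).dotProduct continuous_snd).abs
    exact (measurableSet_le c1.measurable measurable_const).inter
      (measurableSet_le measurable_const c2.measurable)
  have h4 : ((noise n).prod (noise (n + k))).real A4 ≤
      tapConst r * (S.trace + ε * n) / (ε * n) ^ 2 := by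
    have hnn : 0 ≤ tapConst r * (S.trace + ε * n) / (ε * n) ^ 2 := by positivity
    refine prod_real_le_of_forall mA4 hnn (ae_of_all _ fun u => ?_)
    by_cases hu : (B *ᵥ u) ⬝ᵥ (B *ᵥ u) ≤ S.trace + ε * n
    · refine (measureReal_mono (fun z hz => hz.2)).trans
        ((noise_linear_chebyshev (M *ᵥ (B *ᵥ u)) hs).trans ?_)
      gcongr
      exact (channelMatrix_energy_le (fun t => hb.abs_sub_le t) _).trans
        (mul_le_mul_of_nonneg_left hu hC)
    · have : Prod.mk u ⁻¹' A4 = ∅ := by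
        ext z; simp [A4, hu]
      rw [this]; simpa using hnn
  have hsub : {p : (Fin n → ℝ) × (Fin (n + k) → ℝ) | ε * n ≤ |p.1 ⬝ᵥ p.1 - n| ∨
      S.trace + ε * n ≤ (B *ᵥ p.1) ⬝ᵥ (B *ᵥ p.1) ∨ ε * n ≤ |p.2 ⬝ᵥ p.2 - (n + k : ℕ)| ∨
      ε * n ≤ |(M *ᵥ (B *ᵥ p.1)) ⬝ᵥ p.2|} ⊆
      (({p | p.1 ∈ A1} ∪ {p | p.1 ∈ A2}) ∪ {p | p.2 ∈ A3}) ∪ A4 := by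
    rintro ⟨u, z⟩ hp
    by_cases h1' : (u, z) ∈ ({p | p.1 ∈ A1} ∪ {p | p.1 ∈ A2} : Set _) ∪ {p | p.2 ∈ A3}
    · exact Or.inl h1'
    refine Or.inr ?_
    have ha1 : ¬ ε * n ≤ |u ⬝ᵥ u - n| := fun hh => h1' (Or.inl (Or.inl hh))
    have ha2 : ¬ ε * n ≤ |∑ i, d i * u i ^ 2 - ∑ i, d i| := fun hh => h1' (Or.inl (Or.inr hh))
    have ha3 : ¬ ε * n ≤ |z ⬝ᵥ z - (n + k : ℕ)| := fun hh => h1' (Or.inr hh)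
    have hxx : ¬ S.trace + ε * n ≤ (B *ᵥ u) ⬝ᵥ (B *ᵥ u) := by
      rw [sum_mul_sq_eq hBd, ← hdt]
      intro hh
      exact ha2 (le_trans (by linarith) (le_abs_self _))
    rcases hp with hp | hp | hp | hp
    · exact absurd hp ha1
    · exact absurd hp hxx
    · exact absurd hp ha3
    · exact ⟨(not_le.1 hxx).le, hp⟩
  calc _ ≤ _ := measureReal_mono hsub
    _ ≤ _ := measureReal_union_le _ _
    _ ≤ _ := add_le_add (measureReal_union_le _ _) le_rfl
    _ ≤ _ := add_le_add (add_le_add (measureReal_union_le _ _) le_rfl) le_rfl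
    _ ≤ _ := add_le_add (add_le_add (add_le_add h1 h2) h3) h4
    _ = _ := by ring

end TrueCodeword

/-! ### Random codes over a fixed tap array -/

theorem measurable_output {k n : ℕ} (h : Taps k) :
    Measurable fun q : (Fin n → ℝ) × (Fin (n + k) → ℝ) => output h q.1 q.2 :=
  ((measurable_mulVec _).comp measurable_fst).add measurable_snd

theorem measurePreserving_codeword {n : ℕ} {S B : Matrix (Fin n) (Fin n) ℝ} (hS : S.PosDef)
    (hB : B * Bᵀ = S) : MeasurePreserving (B *ᵥ ·) (noise n) (codewordLaw S) :=
  ⟨measurable_mulVec B, (codewordLaw_eq hS.posSemidef hB).symm⟩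

theorem measurePreserving_output {k n : ℕ} {S B : Matrix (Fin n) (Fin n) ℝ} (hS : S.PosDef)
    (hB : B * Bᵀ = S) (h : Taps k) {T : Matrix (Fin (n + k)) (Fin (n + k)) ℝ}
    (hT : T * Tᵀ = 1 + (channelMatrix n h * B) * (channelMatrix n h * B)ᵀ) :
    MeasurePreserving (fun q : (Fin n → ℝ) × (Fin (n + k) → ℝ) => output h q.1 q.2)
      ((codewordLaw S).prod (noise (n + k))) ((noise (n + k)).map (T *ᵥ ·)) := by
  refine ⟨measurable_output h, ?_⟩
  rw [← ((measurePreserving_codeword hS hB).prod (MeasurePreserving.id (noise (n + k)))).map_eq,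
    Measure.map_map (measurable_output h) ((measurable_mulVec B).prodMap measurable_id),
    ← noise_map_mulVec_add hT.symm]
  congr 1
  ext p : 1
  simp [output]

/-- A codebook and a noise vector for which the decoder may fail on message `w`: the transmitted
codeword fails the test or has too much energy, or another codeword passes the test. -/
def badEvent {k n M : ℕ} (c : Fin (k + 1) → ℝ) (S : Matrix (Fin n) (Fin n) ℝ) (ε η : ℝ)
    (h : Taps k) (w : Fin M) : Set ((Fin M → Fin n → ℝ) × (Fin (n + k) → ℝ)) :=
  {p | (¬ JointlyTypical c S ε η (p.1 w) (output h (p.1 w) p.2) ∨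
      S.trace + ε * n ≤ p.1 w ⬝ᵥ p.1 w) ∨
    ∃ i, i ≠ w ∧ JointlyTypical c S ε η (p.1 i) (output h (p.1 w) p.2)}

theorem det_factor {m : ℕ} {T K : Matrix (Fin m) (Fin m) ℝ} (hT : T * Tᵀ = K) (hK : K.PosDef) :
    T.det ≠ 0 ∧ |T.det| = √K.det := by
  have h : T.det * T.det = K.det := by rw [← hT, Matrix.det_mul, Matrix.det_transpose]
  refine ⟨fun h0 => hK.det_pos.ne' ?_, ?_⟩
  · rw [← h, h0, mul_zero]
  · rw [← h, Real.sqrt_mul_self_eq_abs]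

/-- The contribution of one wrong codeword to the error probability. -/
noncomputable def confusionBound (n k : ℕ) (ε η D : ℝ) : ℝ :=
  (√(1 + η)) ^ (n + (n + k)) * Real.exp (ε * (n + (n + k : ℕ)) / 2) / √D

/-- Union bound at fixed taps. The right side depends on the channel only through `c` and `r`, which
makes every later estimate uniform over tap arrays. -/
theorem badEvent_le {k n M : ℕ} (hn : 0 < n) {c r : Fin (k + 1) → ℝ} {h : Taps k}
    (hb : InBox c r h) {S : Matrix (Fin n) (Fin n) ℝ} (hS : S.PosDef) (hphi : phi1 c r S < 1)
    {ε η : ℝ} (hε : 0 < ε)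
    (hη : tapConst r * (S.trace / ((n : ℝ) + k + n)) + ε * (tapConst r + 4) ≤ η) (w : Fin M) :
    ((Measure.pi fun _ : Fin M => codewordLaw S).prod (noise (n + k))).real
        (badEvent c S ε η h w) ≤
      atypicalBound n k (tapConst r) S.trace (lamMax S) ε + ((M : ℝ) - 1) * confusionBound n k ε η
        ((1 - phi1 c r S) ^ n * (1 + (centreMatrix n c)ᵀ * centreMatrix n c * S).det) := by
  obtain ⟨B, d, hB, hBd, hd, hdt⟩ := exists_factor hS
  have hn' : (0 : ℝ) < n := by exact_mod_cast hn
  have hC := tapConst_nonneg r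
  have hv := chiVar_nonneg
  have htr : 0 ≤ S.trace := hS.posSemidef.trace_nonneg
  have hη0 : 0 ≤ η := le_trans (by positivity) hη
  set H := channelMatrix n h with hH
  set K := 1 + (H * B) * (H * B)ᵀ with hK
  have hKp : K.PosDef := posDef_one_add_mul_transpose _
  obtain ⟨T, -, hT, -, -, -⟩ := exists_factor hKp
  obtain ⟨hT0, hTdet⟩ := det_factor hT hKp
  have hTi : T⁻¹ * T = 1 := Matrix.nonsing_inv_mul T (isUnit_iff_ne_zero.2 hT0)
  set ν := (Measure.pi fun _ : Fin M => codewordLaw S).prod (noise (n + k)) with hν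
  set D := (1 - phi1 c r S) ^ n * (1 + (centreMatrix n c)ᵀ * centreMatrix n c * S).det with hD
  have hDK : D ≤ K.det := det_output_cov_ge hb hS hphi hB hBd hd
  have hD0 : 0 < D := by
    have e1 : (1 + (centreMatrix n c)ᵀ * centreMatrix n c * S).det =
        (1 + (centreMatrix n c * B)ᵀ * (centreMatrix n c * B)).det := by
      rw [← hB, ← Matrix.mul_assoc, Matrix.det_one_add_mul_comm, Matrix.transpose_mul]
      simp only [Matrix.mul_assoc]
    have : 0 < 1 - phi1 c r S := by linarith
    rw [hD, e1]
    exact mul_pos (by positivity) (posDef_one_add_transpose_mul _).det_pos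
  have mpB := measurePreserving_codeword hS hB
  have mpOut := measurePreserving_output hS hB h hT
  have mpw : MeasurePreserving (fun p : (Fin M → Fin n → ℝ) × (Fin (n + k) → ℝ) => (p.1 w, p.2)) ν
      ((codewordLaw S).prod (noise (n + k))) :=
    (measurePreserving_eval (fun _ : Fin M => codewordLaw S) w).prod (MeasurePreserving.id _)
  -- The ellipsoid bound needs the whitened output to have almost full energy. Its failure involves
  -- the output alone and is charged once, not once for each wrong codeword.
  set Y := {y : Fin (n + k) → ℝ | ((n + k : ℕ) : ℝ) * (1 - ε) ≤ (T⁻¹ *ᵥ y) ⬝ᵥ (T⁻¹ *ᵥ y)} with hY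
  have mY : MeasurableSet Y := by
    have c1 : Continuous fun y : Fin (n + k) → ℝ => T⁻¹ *ᵥ y :=
      continuous_const.matrix_mulVec continuous_id
    exact measurableSet_le measurable_const (c1.dotProduct c1).measurable
  have hTY : ∀ v, T *ᵥ v ∈ Y ↔ ((n + k : ℕ) : ℝ) * (1 - ε) ≤ v ⬝ᵥ v := by
    intro v
    rw [hY, Set.mem_ofPred_eq, Matrix.mulVec_mulVec, hTi, Matrix.one_mulVec]
  have mJ := measurableSet_jointlyTypical c S ε η
  -- the true codeword
  set D1 := {q : (Fin n → ℝ) × (Fin (n + k) → ℝ) |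
    ¬ JointlyTypical c S ε η q.1 (output h q.1 q.2) ∨ S.trace + ε * n ≤ q.1 ⬝ᵥ q.1} with hD1
  have mD1 : MeasurableSet D1 := by
    have m1 : MeasurableSet {q : (Fin n → ℝ) × (Fin (n + k) → ℝ) |
        JointlyTypical c S ε η q.1 (output h q.1 q.2)} :=
      (measurable_fst.prodMk (measurable_output h)) mJ
    exact m1.compl.union (measurableSet_le measurable_const
      ((continuous_dotProduct_self n).measurable.comp measurable_fst))
  have b1 : ν.real {p | (p.1 w, p.2) ∈ D1} ≤
      (chiVar * n + chiVar * (lamMax S * S.trace) + chiVar * (n + k) +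
        tapConst r * (S.trace + ε * n)) / (ε * n) ^ 2 := by
    have e1 : ν.real {p | (p.1 w, p.2) ∈ D1} = _ :=
      measureReal_preimage_of_measurePreserving mpw mD1
    have e2 := measureReal_preimage_of_measurePreserving
      (mpB.prod (MeasurePreserving.id (noise (n + k)))) mD1
    rw [e1, ← e2]
    refine (measureReal_mono ?_).trans (atypical_le hn hb hS hε hBd hd hdt)
    rintro ⟨u, z⟩ hp
    by_contra hcon
    simp only [Set.mem_ofPred_eq, not_or, not_le] at hcon
    obtain ⟨h1, h2, h3, h4⟩ := hcon
    have hp' : ¬ JointlyTypical c S ε η (B *ᵥ u) (output h (B *ᵥ u) z) ∨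
      S.trace + ε * n ≤ (B *ᵥ u) ⬝ᵥ (B *ᵥ u) := hp
    rcases hp' with hp' | hp'
    · refine hp' (jointlyTypical_output hn hb hS hε hη ?_ h2 h3 h4)
      rw [inv_quadratic_factor hS hB]; exact h1
    · exact absurd hp' (not_le.2 h2)
  -- an atypical output
  have b2 : ν.real {p | output h (p.1 w) p.2 ∉ Y} ≤ chiVar * (n + k) / (ε * n) ^ 2 := by
    have e1 : ν.real {p | output h (p.1 w) p.2 ∉ Y} = _ :=
      measureReal_preimage_of_measurePreserving (mpOut.comp mpw) mY.compl
    have e2 := measureReal_preimage_of_measurePreserving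
      (⟨measurable_mulVec T, rfl⟩ : MeasurePreserving (T *ᵥ ·) (noise (n + k)) _) mY.compl
    rw [e1, ← e2]
    refine (measureReal_mono (s₂ := {z : Fin (n + k) → ℝ | ε * n ≤ |z ⬝ᵥ z - (n + k : ℕ)|}) ?_).trans
      ((noise_sq_chebyshev (n + k) (by positivity)).trans (by push_cast; rfl))
    intro v hv
    have hv' : T *ᵥ v ∉ Y := hv
    rw [hTY, not_le] at hv'
    rw [Set.mem_ofPred_eq, le_abs]
    right
    push_cast at hv' ⊢
    have : 0 ≤ ε * k := by positivity
    nlinarith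
  -- a wrong codeword
  have b3 : ∀ i, i ≠ w → ν.real {p | JointlyTypical c S ε η (p.1 i) (output h (p.1 w) p.2) ∧
      output h (p.1 w) p.2 ∈ Y} ≤ confusionBound n k ε η D := by
    intro i hi
    -- A wrong codeword is independent of the transmitted one and of the noise together, hence of
    -- the output.
    have mpiw : MeasurePreserving (fun p : (Fin M → Fin n → ℝ) × (Fin (n + k) → ℝ) =>
        (p.1 i, (p.1 w, p.2))) ν
        ((codewordLaw S).prod ((codewordLaw S).prod (noise (n + k)))) :=
      (measurePreserving_prodAssoc _ _ _).comp
        ((measurePreserving_eval_pair (fun _ : Fin M => codewordLaw S) hi).prod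
          (MeasurePreserving.id (noise (n + k))))
    have mp2 := ((MeasurePreserving.id (codewordLaw S)).prod mpOut).comp mpiw
    have mE : MeasurableSet {q : (Fin n → ℝ) × (Fin (n + k) → ℝ) |
        JointlyTypical c S ε η q.1 q.2 ∧ q.2 ∈ Y} := mJ.inter (measurable_snd mY)
    have e1 : ν.real {p | JointlyTypical c S ε η (p.1 i) (output h (p.1 w) p.2) ∧
      output h (p.1 w) p.2 ∈ Y} = _ := measureReal_preimage_of_measurePreserving mp2 mE
    have e2 := measureReal_preimage_of_measurePreserving
      (mpB.prod (⟨measurable_mulVec T, rfl⟩ : MeasurePreserving (T *ᵥ ·) (noise (n + k)) _)) mE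
    rw [e1, ← e2]
    have hF : Measurable fun u : Fin n → ℝ => centreMatrix n c *ᵥ (B *ᵥ u) :=
      (measurable_mulVec _).comp (measurable_mulVec B)
    refine (measureReal_mono ?_).trans ((noise_prod_ellipsoid_le _ hF T hT0 (ε := ε)
      (q := 1 + η) (by linarith)).trans ?_)
    · rintro ⟨u, v⟩ ⟨hp1, hp2⟩
      have hp1' : JointlyTypical c S ε η (B *ᵥ u) (T *ᵥ v) := hp1
      rw [jointlyTypical_iff c hS, inv_quadratic_factor hS hB] at hp1'
      obtain ⟨g1, g2⟩ := hp1'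
      refine ⟨?_, (hTY v).1 hp2, ?_⟩
      · have := (abs_lt.1 g1).1
        have e : (n : ℝ) * (1 / n * (u ⬝ᵥ u)) = u ⬝ᵥ u := by field_simp
        simp only
        nlinarith
      · have hN : (0 : ℝ) < (n : ℝ) + (n + k) := by positivity
        have := (abs_lt.1 g2).2
        have h3 : 1 / ((n : ℝ) + (n + k)) * (u ⬝ᵥ u + (T *ᵥ v - centreMatrix n c *ᵥ (B *ᵥ u)) ⬝ᵥ
          (T *ᵥ v - centreMatrix n c *ᵥ (B *ᵥ u))) ≤ 1 + η := by linarith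
        rw [one_div, inv_mul_le_iff₀ hN] at h3
        simpa using h3
    · rw [confusionBound, hTdet]
      push_cast
      gcongr
  have hsub : badEvent c S ε η h w ⊆ ({p | (p.1 w, p.2) ∈ D1} ∪ {p | output h (p.1 w) p.2 ∉ Y}) ∪
      ⋃ i ∈ Finset.univ.erase w, {p | JointlyTypical c S ε η (p.1 i) (output h (p.1 w) p.2) ∧
      output h (p.1 w) p.2 ∈ Y} := by
    rintro p (hp | ⟨i, hi, hp⟩)
    · exact Or.inl (Or.inl hp)
    · by_cases hy : output h (p.1 w) p.2 ∈ Y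
      · refine Or.inr (Set.mem_biUnion (x := i) ?_ ⟨hp, hy⟩)
        simpa using hi
      · exact Or.inl (Or.inr hy)
  have hM : ((M : ℝ) - 1) = ((Finset.univ.erase w).card : ℝ) := by
    rw [Finset.card_erase_of_mem (Finset.mem_univ w), Finset.card_univ, Fintype.card_fin,
      Nat.cast_sub (Nat.one_le_iff_ne_zero.2 (by rintro rfl; exact w.elim0))]
    simp
  calc _ ≤ _ := measureReal_mono hsub
    _ ≤ _ := measureReal_union_le _ _
    _ ≤ _ := add_le_add (measureReal_union_le _ _) (measureReal_biUnion_finset_le _ _)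
    _ ≤ _ := add_le_add (add_le_add b1 b2) (Finset.sum_le_sum fun i hi =>
        b3 i (Finset.ne_of_mem_erase hi))
    _ = _ := by
        rw [Finset.sum_const, nsmul_eq_mul, ← hM, atypicalBound]
        ring

/-! ### From determinants to rates -/

/-- The second summand of `delta` is nonnegative, since `phi2 ≥ 0` and `0 ≤ phi3 ≤ 1`. The estimate
of wrong codewords costs only the first. -/
theorem delta_ge {k n : ℕ} {c r : Fin (k + 1) → ℝ} (hr : ∀ i, 0 ≤ r i)
    {S : Matrix (Fin n) (Fin n) ℝ} (hS : S.PosDef) :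
    -(1 / 2) * Real.logb 2 (1 - phi1 c r S) ≤ delta c r S := by
  have hrs : 0 ≤ rSum r := Finset.sum_nonneg fun i _ => hr i
  have hβ := beta_nonneg c
  have htr : 0 ≤ S.trace := hS.posSemidef.trace_nonneg
  have hl := lamMax_nonneg hS
  have h2 : 0 ≤ phi2 c r S := by unfold phi2; positivity
  have h3 : 0 ≤ phi3 c r S := by unfold phi3; positivity
  have h3' : phi3 c r S ≤ 1 := by
    unfold phi3
    refine div_le_one_of_le₀ ?_ (by positivity)
    have : 0 ≤ rSum r * (rSum r + 2 * beta c) * lamMax S := by positivity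
    linarith
  have h4 : max 0 (1 - phi2 c r S) ≤ 1 := max_le zero_le_one (by linarith)
  have h5 : max 0 (1 - phi2 c r S) * phi3 c r S ≤ 1 := mul_le_one₀ h4 h3 h3'
  have hlog : 0 < Real.log 2 := Real.log_pos one_lt_two
  have : 0 ≤ 1 / (2 * Real.log 2) * (1 - max 0 (1 - phi2 c r S) * phi3 c r S) :=
    mul_nonneg (by positivity) (by linarith)
  rw [delta]
  linarith

theorem det_centre_pos {k n : ℕ} (c : Fin (k + 1) → ℝ) {S : Matrix (Fin n) (Fin n) ℝ}
    (hS : S.PosDef) : 0 < (1 + (centreMatrix n c)ᵀ * centreMatrix n c * S).det := by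
  obtain ⟨B, d, hB, -, -, -⟩ := exists_factor hS
  rw [← hB, ← Matrix.mul_assoc, Matrix.det_one_add_mul_comm,
    show Bᵀ * ((centreMatrix n c)ᵀ * centreMatrix n c * B) =
      (centreMatrix n c * B)ᵀ * (centreMatrix n c * B) by
      rw [Matrix.transpose_mul]; simp only [Matrix.mul_assoc]]
  exact (posDef_one_add_transpose_mul _).det_pos

/-- The exponent of the determinant in the confusion bound, in terms of the lower bound. -/
theorem boundTerm_le {k n : ℕ} (hn : 0 < n) {c r : Fin (k + 1) → ℝ} (hr : ∀ i, 0 ≤ r i)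
    {S : Matrix (Fin n) (Fin n) ℝ} (hS : S.PosDef) (hphi : phi1 c r S < 1) :
    n * Real.log 2 * boundTerm c r S + n * Real.log (1 + tapConst r * (S.trace / ((n : ℝ) + k + n)))
      ≤ 1 / 2 * Real.log ((1 - phi1 c r S) ^ n *
        (1 + (centreMatrix n c)ᵀ * centreMatrix n c * S).det) := by
  have hn' : (0 : ℝ) < n := by exact_mod_cast hn
  have hlog : 0 < Real.log 2 := Real.log_pos one_lt_two
  have h1 : 0 < 1 - phi1 c r S := by linarith
  have hdet := det_centre_pos c hS
  rw [Real.log_mul (by positivity) hdet.ne', Real.log_pow]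
  have hδ := delta_ge (c := c) hr hS
  rw [boundTerm]
  simp only [Real.logb] at hδ ⊢
  set X := Real.log (1 - phi1 c r S)
  set Y := Real.log (1 + (centreMatrix n c)ᵀ * centreMatrix n c * S).det
  change n * Real.log 2 * (_ - Real.log (1 + tapConst r * (S.trace / ((n : ℝ) + k + n))) /
    Real.log 2 - _) + _ ≤ _
  set Z := Real.log (1 + tapConst r * (S.trace / ((n : ℝ) + k + n)))
  have e : n * Real.log 2 * (1 / (2 * n) * (Y / Real.log 2) - Z / Real.log 2 - delta c r S) + n * Z =
      1 / 2 * Y - n * (Real.log 2 * delta c r S) := by field_simp; ring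
  rw [e]
  have h2 : -(1 / 2) * X ≤ Real.log 2 * delta c r S := by
    calc -(1 / 2) * X = Real.log 2 * (-(1 / 2) * (X / Real.log 2)) := by field_simp
      _ ≤ _ := by gcongr
  nlinarith

theorem log_one_add_sub_le {a b : ℝ} (ha : 0 ≤ a) (hab : a ≤ b) :
    Real.log (1 + b) ≤ Real.log (1 + a) + (b - a) := by
  have h1 : (0 : ℝ) < 1 + a := by linarith
  have h2 : (0 : ℝ) < 1 + b := by linarith
  have := Real.log_le_sub_one_of_pos (div_pos h2 h1)
  rw [Real.log_div h2.ne' h1.ne'] at this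
  have h3 : (1 + b) / (1 + a) - 1 = (b - a) / (1 + a) := by field_simp; ring
  have h4 : (b - a) / (1 + a) ≤ b - a := div_le_self (by linarith) (by linarith)
  linarith

theorem power_pos {P : ℝ} {S : ∀ n : ℕ, Matrix (Fin n) (Fin n) ℝ} (hS : ∀ n, (S n).PosDef)
    (htr : ∀ n, (S n).trace ≤ n * P) : 0 < P := by
  have h1 := htr 1
  have h2 : 0 < (S 1).trace := (hS 1).trace_pos
  simp at h1
  linarith

/-- Per input slot, replacing `η` by its limit `ρ` costs `ε * (tapConst r + 4)` and the energy
tolerance costs `ε`. Together they use up at most half of the gap `log 2 * (R₁ - R)`. As `(n + m) /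
2 = n + k / 2`, the tail of the block leaves a factor that does not depend on `n`. -/
theorem confusion_le {k n : ℕ} (hn : 0 < n) {c r : Fin (k + 1) → ℝ} (hr : ∀ i, 0 ≤ r i) {P : ℝ}
    {S : Matrix (Fin n) (Fin n) ℝ} (hS : S.PosDef) (htr : S.trace ≤ n * P)
    (hphi : phi1 c r S < 1) {R R₁ ε : ℝ} (hε : 0 < ε)
    (hεg : ε * (tapConst r + 5) ≤ Real.log 2 * (R₁ - R) / 2) (hR : R₁ ≤ boundTerm c r S) :
    (2 : ℝ) ^ ((n : ℝ) * R) * confusionBound n k ε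
      (tapConst r * (S.trace / ((n : ℝ) + k + n)) + ε * (tapConst r + 4))
      ((1 - phi1 c r S) ^ n * (1 + (centreMatrix n c)ᵀ * centreMatrix n c * S).det) ≤
    Real.exp (-(n * (Real.log 2 * (R₁ - R) / 2)) +
      k / 2 * (tapConst r * P + ε * (tapConst r + 5))) := by
  have hn' : (0 : ℝ) < n := by exact_mod_cast hn
  have hC := tapConst_nonneg r
  have htr0 : 0 ≤ S.trace := hS.posSemidef.trace_nonneg
  have hlog : 0 < Real.log 2 := Real.log_pos one_lt_two
  have h1 : 0 < 1 - phi1 c r S := by linarith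
  have hdet := det_centre_pos c hS
  have hb := boundTerm_le hn hr hS hphi
  set ρ := tapConst r * (S.trace / ((n : ℝ) + k + n)) with hρ
  set η := ρ + ε * (tapConst r + 4) with hη
  set D := (1 - phi1 c r S) ^ n * (1 + (centreMatrix n c)ᵀ * centreMatrix n c * S).det
  have hD : 0 < D := by positivity
  have hρ0 : 0 ≤ ρ := by positivity
  have hηρ : 0 ≤ ε * (tapConst r + 4) := by positivity
  have hη1 : 0 < 1 + η := by linarith
  have hk : (0 : ℝ) ≤ k := Nat.cast_nonneg k
  have hP : 0 ≤ P := by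
    by_contra hneg
    push Not at hneg
    nlinarith
  have hρP : ρ ≤ tapConst r * P := by
    rw [hρ]
    gcongr
    rw [div_le_iff₀ (by positivity)]
    nlinarith
  have e1 : (2 : ℝ) ^ ((n : ℝ) * R) = Real.exp (Real.log 2 * (n * R)) :=
    Real.rpow_def_of_pos two_pos _
  have e2 : ∀ a : ℝ, 0 < a → √a = Real.exp (Real.log a / 2) := fun a ha => by
    rw [← Real.log_sqrt ha.le, Real.exp_log (Real.sqrt_pos.2 ha)]
  rw [confusionBound, e1, e2 _ hη1, e2 _ hD, ← Real.exp_nat_mul, ← Real.exp_add, ← Real.exp_sub,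
    ← Real.exp_add]
  refine Real.exp_le_exp.2 ?_
  push_cast
  have l1 := log_one_add_sub_le hρ0 (show ρ ≤ η by linarith)
  have l2 : Real.log (1 + η) ≤ η := by
    have := Real.log_le_sub_one_of_pos hη1; linarith
  have l3 : n * Real.log 2 * R₁ ≤ n * Real.log 2 * boundTerm c r S := by gcongr
  have l4 : n * Real.log (1 + η) ≤ n * (Real.log (1 + ρ) + (η - ρ)) := by gcongr
  have l5 : (k : ℝ) / 2 * Real.log (1 + η) ≤ k / 2 * (tapConst r * P + ε * (tapConst r + 4)) := by
    gcongr; linarith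
  have l6 : n * (ε * (tapConst r + 5)) ≤ n * (Real.log 2 * (R₁ - R) / 2) := by gcongr
  have l7 : η - ρ = ε * (tapConst r + 4) := by rw [hη]; ring
  rw [l7] at l4
  nlinarith

/-- The numerator is `O(n) + O(n λmax)` against `ε² n²`; the condition `λmax / n → 0` is exactly
what the second term requires. -/
theorem tendsto_atypicalBound {k : ℕ} {P C ε : ℝ} (hC : 0 ≤ C) (hε : 0 < ε)
    {S : ∀ n : ℕ, Matrix (Fin n) (Fin n) ℝ} (hS : ∀ n, (S n).PosDef)
    (htr : ∀ n, (S n).trace ≤ n * P)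
    (hmax : Tendsto (fun n : ℕ => 1 / (n : ℝ) * lamMax (S n)) atTop (𝓝 0)) :
    Tendsto (fun n => atypicalBound n k C (S n).trace (lamMax (S n)) ε) atTop (𝓝 0) := by
  have hv := chiVar_nonneg
  have hup : Tendsto (fun n : ℕ => 1 / (n : ℝ) * ((3 * chiVar + 2 * chiVar * k + C * (P + ε)) / ε ^ 2)
      + (1 / (n : ℝ) * lamMax (S n)) * (chiVar * P / ε ^ 2)) atTop (𝓝 0) := by
    have := (tendsto_one_div_atTop_nhds_zero_nat (𝕜 := ℝ)).mul_const
      ((3 * chiVar + 2 * chiVar * k + C * (P + ε)) / ε ^ 2)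
    simpa using this.add (hmax.mul_const (chiVar * P / ε ^ 2))
  refine squeeze_zero' (Eventually.of_forall fun n => ?_) ?_ hup
  · have h1 := (hS n).posSemidef.trace_nonneg
    have h2 := lamMax_nonneg (hS n)
    unfold atypicalBound
    positivity
  · filter_upwards [eventually_ge_atTop 1] with n hn
    have hn' : (1 : ℝ) ≤ n := by exact_mod_cast hn
    have h1 := (hS n).posSemidef.trace_nonneg
    have h2 := lamMax_nonneg (hS n)
    have h3 := htr n
    have e : 1 / (n : ℝ) * ((3 * chiVar + 2 * chiVar * k + C * (P + ε)) / ε ^ 2)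
      + (1 / (n : ℝ) * lamMax (S n)) * (chiVar * P / ε ^ 2) =
      ((3 * chiVar + 2 * chiVar * k + C * (P + ε)) * n + lamMax (S n) * (chiVar * P) * n) /
        (ε * n) ^ 2 := by
      field_simp
    rw [e]
    unfold atypicalBound
    refine div_le_div_of_nonneg_right ?_ (by positivity)
    have h4 : lamMax (S n) * (S n).trace ≤ lamMax (S n) * (n * P) := by gcongr
    have h5 : C * (S n).trace ≤ C * (n * P) := by gcongr
    have h6 : chiVar * (lamMax (S n) * (S n).trace) ≤ chiVar * (lamMax (S n) * (n * P)) := by gcongr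
    have h7 : chiVar * k ≤ chiVar * k * n := le_mul_of_one_le_right (by positivity) hn'
    nlinarith

/-- The uniformity in taps, message and codebook size serves the construction of fixed codes: those
use smaller codebooks, and they need the energy tolerance `ε` below a prescribed `θ`. -/
theorem uniform_badEvent {k : ℕ} {c r : Fin (k + 1) → ℝ} (hr : ∀ i, 0 ≤ r i) {P : ℝ}
    {S : ∀ n : ℕ, Matrix (Fin n) (Fin n) ℝ} (hS : ∀ n, (S n).PosDef)
    (htr : ∀ n, (S n).trace ≤ n * P)
    (hmax : Tendsto (fun n : ℕ => 1 / (n : ℝ) * lamMax (S n)) atTop (𝓝 0))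
    (hphi : ∀ n, phi1 c r (S n) < 1) {R : ℝ} (hR : (R : EReal) < lowerBound c r S)
    {θ : ℝ} (hθ : 0 < θ) :
    ∃ ε, 0 < ε ∧ ε ≤ θ ∧ ∃ η : ℕ → ℝ, (∀ n, 0 < η n) ∧ ∀ δ > 0, ∀ᶠ n in atTop,
      ∀ M ≤ numMessages n R, ∀ h, InBox c r h → ∀ w : Fin M,
        ((Measure.pi fun _ : Fin M => codewordLaw (S n)).prod (noise (n + k))).real
          (badEvent c (S n) ε (η n) h w) ≤ δ := by
  obtain ⟨R₁, hR1, hR2⟩ := EReal.lt_iff_exists_real_btwn.1 hR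
  have hRR : R < R₁ := by exact_mod_cast hR1
  have hev : ∀ᶠ n in atTop, R₁ < boundTerm c r (S n) := by
    filter_upwards [eventually_lt_of_lt_liminf hR2] with n hn
    exact_mod_cast hn
  have hC := tapConst_nonneg r
  have hlog : 0 < Real.log 2 := Real.log_pos one_lt_two
  set g := Real.log 2 * (R₁ - R) / 2 with hg
  have hg0 : 0 < g := by have : 0 < R₁ - R := by linarith
                         positivity
  set ε := min θ (g / (tapConst r + 5)) with hεdef
  have hε : 0 < ε := lt_min hθ (by positivity)
  have hεg : ε * (tapConst r + 5) ≤ g := by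
    rw [← le_div_iff₀ (by positivity)]; exact min_le_right _ _
  refine ⟨ε, hε, min_le_left _ _,
    fun n => tapConst r * ((S n).trace / ((n : ℝ) + k + n)) + ε * (tapConst r + 4), fun n => ?_,
    fun δ hδ => ?_⟩
  · have h1 := (hS n).posSemidef.trace_nonneg
    positivity
  have t1 := tendsto_atypicalBound (k := k) hC hε hS htr hmax
  have t2 : Tendsto (fun n : ℕ => Real.exp (-(n * g) +
      k / 2 * (tapConst r * P + ε * (tapConst r + 5)))) atTop (𝓝 0) := by
    refine Real.tendsto_exp_atBot.comp (tendsto_atBot_add_const_right _ _ ?_)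
    exact tendsto_neg_atTop_atBot.comp
      (tendsto_natCast_atTop_atTop.atTop_mul_const hg0)
  have t3 := t1.add t2
  rw [add_zero] at t3
  filter_upwards [t3.eventually_lt_const hδ, hev, eventually_gt_atTop 0] with n h1 h2 hn
  intro M hM h hb w
  refine (badEvent_le hn hb (hS n) (hphi n) hε le_rfl w).trans (le_trans ?_ h1.le)
  gcongr
  refine le_trans ?_ (confusion_le hn hr (hS n) (htr n) (hphi n) hε hεg h2.le)
  -- There are `M - 1` wrong codewords, and this one less outweighs the rounding up in
  -- `numMessages`.
  refine mul_le_mul_of_nonneg_right ?_ (by unfold confusionBound; positivity)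
  have h3 : (0 : ℝ) ≤ 2 ^ ((n : ℝ) * R) := by positivity
  have h4 := Nat.ceil_lt_add_one h3
  have h5 : (M : ℝ) ≤ (numMessages n R : ℕ) := by exact_mod_cast hM
  rw [numMessages] at h5
  linarith

/-! ### Random taps and the ensemble error -/

theorem jtDecode_eq_some {k n M : ℕ} {c : Fin (k + 1) → ℝ} {S : Matrix (Fin n) (Fin n) ℝ} {ε η : ℝ}
    {X : Fin M → Fin n → ℝ} {y : Fin (n + k) → ℝ} {w : Fin M}
    (hw : JointlyTypical c S ε η (X w) y)
    (hne : ∀ i, i ≠ w → ¬ JointlyTypical c S ε η (X i) y) : jtDecode c S ε η X y = some w := by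
  have h : ∃! i, JointlyTypical c S ε η (X i) y :=
    ⟨w, hw, fun i hi => by by_contra hiw; exact hne i hiw hi⟩
  rw [jtDecode, dif_pos h]
  exact congrArg some (h.unique h.choose_spec.1 hw)

theorem measurable_channelMatrix_apply {k n : ℕ} (t : Fin (n + k)) (j : Fin n) :
    Measurable fun h : Taps k => channelMatrix n h t j := by
  simp only [channelMatrix_apply]
  refine Finset.measurable_sum _ fun i _ => ?_
  split_ifs
  · exact (measurable_pi_apply i).comp (measurable_pi_apply (t : ℕ))
  · exact measurable_const

theorem measurable_output_joint {k n : ℕ} :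
    Measurable fun q : Taps k × (Fin n → ℝ) × (Fin (n + k) → ℝ) => output q.1 q.2.1 q.2.2 := by
  refine measurable_pi_iff.2 fun t => ?_
  have h2 : Measurable fun q : Taps k × (Fin n → ℝ) × (Fin (n + k) → ℝ) => q.2.2 t :=
    (measurable_pi_apply t).comp (measurable_snd.comp measurable_snd)
  have h1 : Measurable fun q : Taps k × (Fin n → ℝ) × (Fin (n + k) → ℝ) =>
      ∑ j, channelMatrix n q.1 t j * q.2.1 j :=
    Finset.measurable_sum _ fun j _ =>
      ((measurable_channelMatrix_apply t j).comp measurable_fst).mul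
        ((measurable_pi_apply j).comp (measurable_fst.comp measurable_snd))
  exact h1.add h2

theorem measurableSet_badEvent_joint {k n M : ℕ} (c : Fin (k + 1) → ℝ)
    (S : Matrix (Fin n) (Fin n) ℝ) (ε η : ℝ) (w : Fin M) :
    MeasurableSet {q : Taps k × (Fin M → Fin n → ℝ) × (Fin (n + k) → ℝ) |
      q.2 ∈ badEvent c S ε η q.1 w} := by
  have mx : ∀ i, Measurable fun q : Taps k × (Fin M → Fin n → ℝ) × (Fin (n + k) → ℝ) => q.2.1 i :=
    fun i => (measurable_pi_apply i).comp (measurable_fst.comp measurable_snd)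
  have mo : Measurable fun q : Taps k × (Fin M → Fin n → ℝ) × (Fin (n + k) → ℝ) =>
      output q.1 (q.2.1 w) q.2.2 :=
by
    have h1 : Measurable fun q : Taps k × (Fin M → Fin n → ℝ) × (Fin (n + k) → ℝ) =>
        (q.1, q.2.1 w, q.2.2) :=
      measurable_fst.prodMk ((mx w).prodMk (measurable_snd.comp measurable_snd))
    have h2 := Measurable.comp (g := fun q : Taps k × (Fin n → ℝ) × (Fin (n + k) → ℝ) =>
      output q.1 q.2.1 q.2.2) measurable_output_joint h1
    exact h2
  set J : Fin M → Set (Taps k × (Fin M → Fin n → ℝ) × (Fin (n + k) → ℝ)) := fun i =>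
    (fun q => (q.2.1 i, output q.1 (q.2.1 w) q.2.2)) ⁻¹'
      {p | JointlyTypical c S ε η p.1 p.2} with hJ
  have mj : ∀ i, MeasurableSet (J i) := fun i =>
    measurableSet_preimage ((mx i).prodMk mo) (measurableSet_jointlyTypical c S ε η)
  have m1 : MeasurableSet {q : Taps k × (Fin M → Fin n → ℝ) × (Fin (n + k) → ℝ) |
      S.trace + ε * n ≤ q.2.1 w ⬝ᵥ q.2.1 w} :=
    measurableSet_le measurable_const ((continuous_dotProduct_self n).measurable.comp (mx w))
  have m2 : MeasurableSet (⋃ i ∈ {i : Fin M | i ≠ w}, J i) :=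
    MeasurableSet.biUnion (Set.to_countable _) fun i _ => mj i
  convert ((mj w).compl.union m1).union m2 using 1
  ext q
  simp [badEvent, hJ]

theorem IsTapLaw.ae_inBox {k : ℕ} {c r : Fin (k + 1) → ℝ} {ν : Measure (Taps k)}
    (hν : IsTapLaw c r ν) : ∀ᵐ h ∂ν, InBox c r h :=
  ae_all_iff.2 fun t => ae_all_iff.2 fun i => hν.supp t i

theorem measurePreserving_prod_left_comm {α β γ : Type*} [MeasurableSpace α] [MeasurableSpace β]
    [MeasurableSpace γ] (μ : Measure α) (ν : Measure β) (ξ : Measure γ) [IsProbabilityMeasure μ]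
    [IsProbabilityMeasure ν] [IsProbabilityMeasure ξ] :
    MeasurePreserving (fun p : α × β × γ => (p.2.1, p.1, p.2.2)) (μ.prod (ν.prod ξ))
      (ν.prod (μ.prod ξ)) :=
  (measurePreserving_prodAssoc ν μ ξ).comp ((Measure.measurePreserving_swap.prod
    (MeasurePreserving.id ξ)).comp ((measurePreserving_prodAssoc μ ν ξ).symm _))

/-- Taps are independent of code and noise, so Fubini reduces to fixed taps. Almost every tap array
lies in the box, whatever the dependence between the taps. -/
theorem ensembleError_le {k n M : ℕ} {c r : Fin (k + 1) → ℝ} {S : Matrix (Fin n) (Fin n) ℝ}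
    {ε η δ : ℝ} (hδ : 0 ≤ δ)
    (hbad : ∀ h, InBox c r h → ∀ w : Fin M,
        ((Measure.pi fun _ : Fin M => codewordLaw S).prod (noise (n + k))).real
          (badEvent c S ε η h w) ≤ δ) {ν : Measure (Taps k)} (hν : IsTapLaw c r ν) :
    ensembleError c S ε η M ν ≤ δ := by
  have := hν.prob
  rw [ensembleError]
  have hw : ∀ w : Fin M, ((Measure.pi fun _ : Fin M => codewordLaw S).prod
      (ν.prod (noise (n + k)))).real
      {p | jtDecode c S ε η p.1 (output p.2.1 (p.1 w) p.2.2) ≠ some w} ≤ δ := by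
    intro w
    have mb := measurableSet_badEvent_joint (k := k) c S ε η w
    have e := measureReal_preimage_of_measurePreserving (measurePreserving_prod_left_comm
      (Measure.pi fun _ : Fin M => codewordLaw S) ν (noise (n + k))) mb
    refine (measureReal_mono ?_).trans (e.le.trans (prod_real_le_of_forall mb hδ ?_))
    · intro p hp
      by_contra hcon
      refine hp ?_
      have hcon' : ¬ ((p.1, p.2.2) ∈ badEvent c S ε η p.2.1 w) := hcon
      simp only [badEvent, Set.mem_ofPred_eq, not_or, not_not, not_exists, not_and] at hcon'
      exact jtDecode_eq_some hcon'.1.1 hcon'.2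
    · filter_upwards [hν.ae_inBox] with h hb
      exact hbad h hb w
  rcases Nat.eq_zero_or_pos M with rfl | hM
  · simpa using hδ
  · rw [inv_mul_le_iff₀ (by exact_mod_cast hM)]
    refine (Finset.sum_le_sum fun w _ => hw w).trans ?_
    simp

theorem ensembleError_nonneg {k n M : ℕ} (c : Fin (k + 1) → ℝ) (S : Matrix (Fin n) (Fin n) ℝ)
    (ε η : ℝ) (ν : Measure (Taps k)) : 0 ≤ ensembleError c S ε η M ν :=
  mul_nonneg (by positivity) (Finset.sum_nonneg fun _ _ => measureReal_nonneg)

theorem tendsto_zero_of_eventually_le {u : ℕ → ℝ} (h0 : ∀ n, 0 ≤ u n)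
    (h : ∀ δ > 0, ∀ᶠ n in atTop, u n ≤ δ) : Tendsto u atTop (𝓝 0) := by
  refine tendsto_order.2 ⟨fun a ha => Eventually.of_forall fun n => ha.trans_le (h0 n),
    fun a ha => ?_⟩
  filter_upwards [h (a / 2) (by linarith)] with n hn
  linarith

theorem tendsto_ensembleError {k : ℕ} {c r : Fin (k + 1) → ℝ} (hr : ∀ i, 0 ≤ r i) {P : ℝ}
    {S : ∀ n : ℕ, Matrix (Fin n) (Fin n) ℝ} (hS : ∀ n, (S n).PosDef)
    (htr : ∀ n, (S n).trace ≤ n * P)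
    (hmax : Tendsto (fun n : ℕ => 1 / (n : ℝ) * lamMax (S n)) atTop (𝓝 0))
    (hphi : ∀ n, phi1 c r (S n) < 1) {R : ℝ} (hR : (R : EReal) < lowerBound c r S) :
    ∃ ε : ℝ, 0 < ε ∧ ∃ η : ℕ → ℝ, (∀ n, 0 < η n) ∧
      ∀ ν : Measure (Taps k), IsTapLaw c r ν →
        Tendsto (fun n => ensembleError c (S n) ε (η n) (numMessages n R) ν) atTop (𝓝 0) := by
  obtain ⟨ε, hε, -, η, hη, hb⟩ := uniform_badEvent hr hS htr hmax hphi hR one_pos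
  refine ⟨ε, hε, η, hη, fun ν hν => tendsto_zero_of_eventually_le
    (fun n => ensembleError_nonneg _ _ _ _ _) fun δ hδ => ?_⟩
  filter_upwards [hb δ hδ] with n hn
  exact ensembleError_le hδ.le (hn _ le_rfl) hν

/-! ### Derandomization -/

theorem exp_le_one_add_two_mul {t : ℝ} (h0 : 0 ≤ t) (h1 : t ≤ 1) : Real.exp t ≤ 1 + 2 * t := by
  have hc := convexOn_exp.2 (Set.mem_univ 0) (Set.mem_univ 1) (by linarith : 0 ≤ 1 - t) h0
    (by ring)
  simp only [smul_eq_mul, mul_zero, mul_one, zero_add, Real.exp_zero] at hc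
  have : Real.exp 1 ≤ 3 := Real.exp_one_lt_three.le
  nlinarith

/-- Among independent samples there is one whose empirical averages are small simultaneously for
all members of a finite family of bounded functions of small mean. -/
theorem exists_small_averages {E G : Type*} [MeasurableSpace E] [Fintype G] (π : Measure E)
    [IsProbabilityMeasure π] {e : G → E → ℝ} (hm : ∀ g, Measurable (e g)) (h0 : ∀ g x, 0 ≤ e g x)
    (h1 : ∀ g x, e g x ≤ 1) {δ lam : ℝ} (hδ : ∀ g, ∫ x, e g x ∂π ≤ δ) {K : ℕ}
    (hK : Fintype.card G * Real.exp (-(K * (lam - 2 * δ))) < 1) :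
    ∃ X : Fin K → E, ∀ g, ∑ κ, e g (X κ) < lam * K := by
  by_contra hcon
  push Not at hcon
  have hint : ∀ g, Integrable (e g) π := fun g =>
    Integrable.of_bound (hm g).aestronglyMeasurable 1
      (ae_of_all _ fun x => by rw [Real.norm_of_nonneg (h0 g x)]; exact h1 g x)
  -- On `[0, 1]` the exponential lies below `1 + 2 t`, so a mean of at most `δ` gives an exponential
  -- moment of at most `exp (2 δ)`.
  have hexp : ∀ g, ∫⁻ x, ENNReal.ofReal (Real.exp (e g x)) ∂π ≤ ENNReal.ofReal (Real.exp (2 * δ)) := by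
    intro g
    have hi : Integrable (fun x => 1 + 2 * e g x) π := (integrable_const _).add ((hint g).const_mul 2)
    calc _ ≤ ∫⁻ x, ENNReal.ofReal (1 + 2 * e g x) ∂π := lintegral_mono fun x =>
          ENNReal.ofReal_le_ofReal (exp_le_one_add_two_mul (h0 g x) (h1 g x))
      _ = ENNReal.ofReal (∫ x, (1 + 2 * e g x) ∂π) :=
          (ofReal_integral_eq_lintegral_ofReal hi (ae_of_all _ fun x => by
            have := h0 g x
            simp only [Pi.zero_apply]; linarith)).symm
      _ ≤ _ := by
          refine ENNReal.ofReal_le_ofReal ?_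
          rw [integral_add (integrable_const _) ((hint g).const_mul 2), integral_const_mul]
          simp only [integral_const, probReal_univ, smul_eq_mul, mul_one]
          have := Real.add_one_le_exp (2 * δ)
          linarith [hδ g]
  have hmexp : ∀ g, Measurable fun x => ENNReal.ofReal (Real.exp (e g x)) := fun g =>
    (Real.measurable_exp.comp (hm g)).ennreal_ofReal
  set Q := Measure.pi fun _ : Fin K => π
  -- If every sample fails for some `g`, the sum over `g` of the Chernoff weights is at least one
  -- everywhere. Integrating, with independence of the samples, contradicts `hK`.
  have hone : (1 : ℝ≥0∞) ≤ ∑ g : G, ENNReal.ofReal (Real.exp (-(lam * K))) *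
      ∏ _κ : Fin K, ∫⁻ x, ENNReal.ofReal (Real.exp (e g x)) ∂π := by
    calc (1 : ℝ≥0∞) = ∫⁻ _, 1 ∂Q := by simp
      _ ≤ ∫⁻ X : Fin K → E, ∑ g : G, ENNReal.ofReal (Real.exp (-(lam * K))) *
          ∏ κ, ENNReal.ofReal (Real.exp (e g (X κ))) ∂Q := by
          refine lintegral_mono fun X => ?_
          obtain ⟨g, hg⟩ := hcon X
          refine le_trans ?_ (Finset.single_le_sum (fun _ _ => zero_le) (Finset.mem_univ g))
          rw [← ENNReal.ofReal_prod_of_nonneg (fun _ _ => (Real.exp_pos _).le),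
            ← ENNReal.ofReal_mul (Real.exp_pos _).le, ← Real.exp_sum, ← Real.exp_add,
            ENNReal.one_le_ofReal]
          exact Real.one_le_exp (by linarith)
      _ = _ := by
          have hmp : ∀ g, Measurable fun X : Fin K → E =>
              ∏ κ, ENNReal.ofReal (Real.exp (e g (X κ))) := fun g =>
            Finset.measurable_prod _ fun κ _ => (hmexp g).comp (measurable_pi_apply κ)
          rw [lintegral_finsetSum _ fun g _ => (hmp g).const_mul _]
          refine Finset.sum_congr rfl fun g _ => ?_
          rw [lintegral_const_mul _ (hmp g),
            lintegral_pi_fin_prod _ (fun _ x => ENNReal.ofReal (Real.exp (e g x))) fun _ => hmexp g]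
  have hlt : ∑ g : G, ENNReal.ofReal (Real.exp (-(lam * K))) *
      ∏ _κ : Fin K, ∫⁻ x, ENNReal.ofReal (Real.exp (e g x)) ∂π < 1 := by
    calc _ ≤ ∑ g : G, ENNReal.ofReal (Real.exp (-(lam * K))) *
          ∏ _κ : Fin K, ENNReal.ofReal (Real.exp (2 * δ)) := by
          gcongr with g _ κ _
          exact hexp g
      _ = ENNReal.ofReal (Fintype.card G * Real.exp (-(K * (lam - 2 * δ)))) := by
          rw [Finset.prod_const, Finset.sum_const, Finset.card_univ, Finset.card_univ,
            Fintype.card_fin, nsmul_eq_mul, ← ENNReal.ofReal_pow (Real.exp_pos _).le,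
            ← ENNReal.ofReal_mul (Real.exp_pos _).le, ← Real.exp_nat_mul, ← Real.exp_add,
            ENNReal.ofReal_mul (by positivity), ENNReal.ofReal_natCast]
          congr 3; ring
      _ < 1 := by rwa [ENNReal.ofReal_lt_one]
  exact absurd hone (not_le.2 hlt)

/-! ### A finite grid of tap arrays -/

/-- A tap array on the grid with `q` steps per interval, at the centre from time `N` on. -/
noncomputable def gridTaps {k : ℕ} (c r : Fin (k + 1) → ℝ) (N q : ℕ) (j : Fin N → Fin (k + 1) → Fin (q + 1)) :
    Taps k := fun t i =>
  if ht : t < N then c i - r i + 2 * r i * ((j ⟨t, ht⟩ i : ℕ) / (q : ℝ)) else c i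

theorem inBox_gridTaps {k : ℕ} {c r : Fin (k + 1) → ℝ} (hr : ∀ i, 0 ≤ r i) (N : ℕ) {q : ℕ}
    (hq : 0 < q) (j : Fin N → Fin (k + 1) → Fin (q + 1)) : InBox c r (gridTaps c r N q j) := by
  intro t i
  have hri := hr i
  have hq' : (0 : ℝ) < q := by exact_mod_cast hq
  unfold gridTaps
  split_ifs with ht
  · have h1 : ((j ⟨t, ht⟩ i : ℕ) : ℝ) / q ≤ 1 := by
      rw [div_le_one hq']
      exact_mod_cast Nat.lt_succ_iff.1 (j ⟨t, ht⟩ i).2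
    have h0 : 0 ≤ ((j ⟨t, ht⟩ i : ℕ) : ℝ) / q := by positivity
    constructor
    · have : 0 ≤ 2 * r i * (((j ⟨t, ht⟩ i : ℕ) : ℝ) / q) := by positivity
      linarith
    · nlinarith
  · constructor <;> linarith

theorem exists_gridTaps_near {k : ℕ} {c r : Fin (k + 1) → ℝ} {h : Taps k} (hb : InBox c r h)
    (N : ℕ) {q : ℕ} (hq : 0 < q) : ∃ j : Fin N → Fin (k + 1) → Fin (q + 1),
      ∀ (t : Fin N) i, |(h - gridTaps c r N q j) t i| ≤ 2 * r i / q := by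
  have hq' : (0 : ℝ) < q := by exact_mod_cast hq
  have key : ∀ (t : Fin N) i, ∃ a : Fin (q + 1),
      |h t i - (c i - r i + 2 * r i * ((a : ℕ) / (q : ℝ)))| ≤ 2 * r i / q := by
    intro t i
    obtain ⟨h1, h2⟩ := hb t i
    -- An interval of radius zero is a single point, and rescaling by `2 * r i` would be meaningless
    -- there.
    rcases (show 0 ≤ r i by linarith).eq_or_lt with hr | hr
    · refine ⟨0, ?_⟩
      rw [← hr] at h1 h2 ⊢
      simp only [mul_zero, zero_mul, zero_div, abs_nonpos_iff]
      linarith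
    · set s := (h t i - (c i - r i)) / (2 * r i) * q with hs
      have hs0 : 0 ≤ s := by
        have : 0 ≤ h t i - (c i - r i) := by linarith
        positivity
      have hsq : s ≤ q := by
        rw [hs]
        refine mul_le_of_le_one_left hq'.le ?_
        rw [div_le_one (by positivity)]; linarith
      have f1 := Nat.floor_le hs0
      have f2 := Nat.lt_floor_add_one s
      refine ⟨⟨⌊s⌋₊, Nat.lt_succ_iff.2 (Nat.floor_le_of_le hsq)⟩, ?_⟩
      have e : h t i - (c i - r i + 2 * r i * ((⌊s⌋₊ : ℕ) / (q : ℝ))) =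
          2 * r i / q * (s - ⌊s⌋₊) := by
        rw [hs]; field_simp; ring
      simp only
      rw [e, abs_of_nonneg (mul_nonneg (by positivity) (by linarith))]
      exact mul_le_of_le_one_right (by positivity) (by linarith)
  choose j hj using key
  refine ⟨j, fun t i => ?_⟩
  have := hj t i
  simp only [Pi.sub_apply, gridTaps, t.2, dite_true]
  exact this

theorem output_eq_shift {k n : ℕ} (h g : Taps k) (x : Fin n → ℝ) (z : Fin (n + k) → ℝ) :
    output h x z = channelMatrix n (h - g) *ᵥ x + z + channelMatrix n g *ᵥ x := by
  rw [output, ← channelMatrix_sub, Matrix.sub_mulVec]; abel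

/-- Moving the taps to a nearby grid point changes error probabilities in a controlled way. -/
theorem noise_output_le {k n : ℕ} {r : Fin (k + 1) → ℝ} {h g : Taps k} {q : ℕ} (hq : 0 < q)
    (hgh : ∀ (t : Fin (n + k)) i, |(h - g) t i| ≤ 2 * r i / q) {x : Fin n → ℝ}
    (hx : 4 * tapConst r * (x ⬝ᵥ x) ≤ (q : ℝ) ^ 2) {A : Set (Fin (n + k) → ℝ)}
    (hA : MeasurableSet A) {t : ℝ} (ht : 0 < t) :
    (noise (n + k)).real {z | output h x z ∈ A} ≤
      t * (noise (n + k)).real {z | output g x z ∈ A} + 3 / t := by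
  have hq' : (0 : ℝ) < q := by exact_mod_cast hq
  set a := channelMatrix n (h - g) *ᵥ x
  -- The shift between the two outputs has energy at most `4 * tapConst r * |x|² / q ^ 2`; once this
  -- is at most one, `exp (a ⬝ᵥ a) ≤ 3`.
  have ha : a ⬝ᵥ a ≤ 1 := by
    refine (channelMatrix_energy_le hgh x).trans ?_
    have e : ((k : ℝ) + 1) * (∑ i, (2 * r i / q) ^ 2) * (x ⬝ᵥ x) =
        4 * tapConst r * (x ⬝ᵥ x) / (q : ℝ) ^ 2 := by
      have : ∑ i, (2 * r i / q) ^ 2 = 4 / (q : ℝ) ^ 2 * ∑ i, r i ^ 2 := by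
        rw [Finset.mul_sum]
        exact Finset.sum_congr rfl fun i _ => by ring
      rw [this, tapConst]; ring
    rw [e, div_le_one (by positivity)]
    exact hx
  have hA' : MeasurableSet ((fun z => z + channelMatrix n g *ᵥ x) ⁻¹' A) :=
    (measurable_id.add_const _) hA
  have := noise_shift_le a hA' ht
  have e1 : {z | output h x z ∈ A} =
      {z | a + z ∈ (fun z => z + channelMatrix n g *ᵥ x) ⁻¹' A} := by
    ext z
    rw [Set.mem_ofPred_eq, output_eq_shift h g]
    rfl
  have e2 : {z | output g x z ∈ A} = (fun z => z + channelMatrix n g *ᵥ x) ⁻¹' A := by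
    ext z
    rw [Set.mem_ofPred_eq, output, add_comm (channelMatrix n g *ᵥ x) z]
    rfl
  rw [e1, e2]
  refine this.trans ?_
  have : Real.exp (a ⬝ᵥ a) ≤ 3 :=
    (Real.exp_le_exp.2 ha).trans Real.exp_one_lt_three.le
  gcongr

theorem integral_real_section {α β : Type*} [MeasurableSpace α] [MeasurableSpace β] {μ : Measure α}
    {ν : Measure β} [IsProbabilityMeasure μ] [IsProbabilityMeasure ν] {s : Set (α × β)}
    (hs : MeasurableSet s) : ∫ x, ν.real (Prod.mk x ⁻¹' s) ∂μ = (μ.prod ν).real s := by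
  simp only [measureReal_def]
  rw [integral_toReal (measurable_measure_prodMk_left hs).aemeasurable
    (ae_of_all _ fun _ => measure_lt_top _ _), Measure.prod_apply hs]

theorem measurable_real_section {α β : Type*} [MeasurableSpace α] [MeasurableSpace β]
    {ν : Measure β} [IsProbabilityMeasure ν] {s : Set (α × β)}
    (hs : MeasurableSet s) : Measurable fun x => ν.real (Prod.mk x ⁻¹' s) :=
  (measurable_measure_prodMk_left hs).ennreal_toReal

theorem measurableSet_badEvent {k n M : ℕ} (c : Fin (k + 1) → ℝ)
    (S : Matrix (Fin n) (Fin n) ℝ) (ε η : ℝ) (h : Taps k) (w : Fin M) :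
    MeasurableSet (badEvent c S ε η h w) :=
  measurableSet_preimage (measurable_const.prodMk measurable_id)
    (measurableSet_badEvent_joint c S ε η w)

theorem jtDecode_eq_some_iff {k n M : ℕ} {c : Fin (k + 1) → ℝ} {S : Matrix (Fin n) (Fin n) ℝ}
    {ε η : ℝ} {X : Fin M → Fin n → ℝ} {y : Fin (n + k) → ℝ} {w : Fin M} :
    jtDecode c S ε η X y = some w ↔ JointlyTypical c S ε η (X w) y ∧
      ∀ i, i ≠ w → ¬ JointlyTypical c S ε η (X i) y := by
  refine ⟨fun h => ?_, fun h => jtDecode_eq_some h.1 h.2⟩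
  rw [jtDecode] at h
  split_ifs at h with hex
  have hw : hex.choose = w := Option.some.inj h
  have hs := hex.choose_spec
  rw [hw] at hs
  exact ⟨hs.1, fun i hi hJ => hi (hs.2 i hJ)⟩

theorem measurableSet_jtDecode_eq {k n M : ℕ} (c : Fin (k + 1) → ℝ) (S : Matrix (Fin n) (Fin n) ℝ)
    (ε η : ℝ) (X : Fin M → Fin n → ℝ) (o : Option (Fin M)) :
    MeasurableSet {y : Fin (n + k) → ℝ | jtDecode c S ε η X y = o} := by
  have mJ : ∀ i, MeasurableSet {y : Fin (n + k) → ℝ | JointlyTypical c S ε η (X i) y} := fun i =>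
    measurableSet_preimage (f := fun y : Fin (n + k) → ℝ => (X i, y))
      (measurable_const.prodMk measurable_id) (measurableSet_jointlyTypical c S ε η)
  have ms : ∀ w : Fin M, MeasurableSet {y : Fin (n + k) → ℝ | jtDecode c S ε η X y = some w} := by
    intro w
    have e : {y : Fin (n + k) → ℝ | jtDecode c S ε η X y = some w} =
        {y | JointlyTypical c S ε η (X w) y} ∩
        ⋂ i ∈ {i : Fin M | i ≠ w}, {y | JointlyTypical c S ε η (X i) y}ᶜ := by
      ext y
      rw [Set.mem_ofPred_eq, jtDecode_eq_some_iff]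
      simp
    rw [e]
    exact (mJ w).inter (MeasurableSet.biInter (Set.to_countable _) fun i _ => (mJ i).compl)
  cases o with
  | some w => exact ms w
  | none =>
    have e : {y : Fin (n + k) → ℝ | jtDecode c S ε η X y = none} =
        (⋃ w : Fin M, {y | jtDecode c S ε η X y = some w})ᶜ := by
      ext y
      simp [Option.eq_none_iff_forall_ne_some]
    rw [e]
    exact (MeasurableSet.iUnion ms).compl

/-- The crude bound `s + 1 ≤ exp s` gives at most `exp (s (s + k) (k + 1))` grid arrays. The
exponent is quadratic in `s`, so cubically many codebooks win. -/
theorem card_grid_lt {s k K : ℕ} {lam : ℝ}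
    (hs : (s : ℝ) * (s + k) * (k + 1) < s ^ 3 * lam) (hlam : 0 < lam) (hK : s ^ 3 ≤ K) :
    (Fintype.card (Fin (s + k) → Fin (k + 1) → Fin (s + 1)) : ℝ) * Real.exp (-(K * lam)) < 1 := by
  have hK' : (s : ℝ) ^ 3 ≤ K := by exact_mod_cast hK
  have h1 : (Fintype.card (Fin (s + k) → Fin (k + 1) → Fin (s + 1)) : ℝ) ≤
      Real.exp ((s : ℝ) * (s + k) * (k + 1)) := by
    simp only [Fintype.card_fun, Fintype.card_fin]
    push_cast
    rw [← pow_mul]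
    have h2 := Real.add_one_le_exp (s : ℝ)
    calc ((s : ℝ) + 1) ^ ((k + 1) * (s + k)) ≤ Real.exp s ^ ((k + 1) * (s + k)) := by gcongr
      _ = _ := by rw [← Real.exp_nat_mul]; push_cast; ring_nf
  calc _ ≤ Real.exp ((s : ℝ) * (s + k) * (k + 1)) * Real.exp (-(K * lam)) := by gcongr
    _ = Real.exp ((s : ℝ) * (s + k) * (k + 1) - K * lam) := by rw [← Real.exp_add]; ring_nf
    _ < 1 := by
        rw [Real.exp_lt_one_iff]
        have : (s : ℝ) ^ 3 * lam ≤ K * lam := by gcongr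
        linarith

theorem eventually_cubic_lt (k : ℕ) {lam : ℝ} (hlam : 0 < lam) :
    ∀ᶠ s : ℕ in atTop, (s : ℝ) * (s + k) * (k + 1) < s ^ 3 * lam := by
  have h := tendsto_natCast_atTop_atTop (R := ℝ)
  filter_upwards [h.eventually_gt_atTop ((k + 1) * (k + 1) / lam), eventually_ge_atTop 1] with s hs h1
  have h1' : (1 : ℝ) ≤ s := by exact_mod_cast h1
  have hk : (0 : ℝ) ≤ k := Nat.cast_nonneg k
  rw [div_lt_iff₀ hlam] at hs
  have h2 : (s : ℝ) + k ≤ s * (k + 1) := by nlinarith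
  calc (s : ℝ) * (s + k) * (k + 1) ≤ s * (s * (k + 1)) * (k + 1) := by gcongr
    _ = s ^ 2 * ((k + 1) * (k + 1)) := by ring
    _ < s ^ 2 * (s * lam) := by gcongr
    _ = _ := by ring

/-- Many codes of length `s` whose average error probability, over codes and messages, is small
for every tap array at once. -/
theorem exists_code_family {k : ℕ} {c r : Fin (k + 1) → ℝ} (hr : ∀ i, 0 ≤ r i) {P : ℝ}
    {S : ∀ n : ℕ, Matrix (Fin n) (Fin n) ℝ} (hS : ∀ n, (S n).PosDef)
    (htr : ∀ n, (S n).trace ≤ n * P)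
    (hmax : Tendsto (fun n : ℕ => 1 / (n : ℝ) * lamMax (S n)) atTop (𝓝 0))
    (hphi : ∀ n, phi1 c r (S n) < 1) {R : ℝ} (hR : (R : EReal) < lowerBound c r S)
    {θ τ : ℝ} (hθ : 0 < θ) (hτ : 0 < τ) :
    ∀ᶠ s : ℕ in atTop, ∀ V ≤ numMessages s R, ∀ K, s ^ 3 ≤ K →
      ∃ (X : Fin K → Fin V → Fin s → ℝ) (D : Fin K → (Fin (s + k) → ℝ) → Option (Fin V)),
        (∀ κ o, MeasurableSet {y | D κ y = o}) ∧
        (∀ κ v, X κ v ⬝ᵥ X κ v ≤ s * (P + θ)) ∧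
        ∀ h, InBox c r h → ∑ κ, ∑ v, (noise (s + k)).real {z | D κ (output h (X κ v) z) ≠ some v}
          ≤ τ * (K * V) := by
  obtain ⟨ε, hε, hεθ, η, hη, hb⟩ := uniform_badEvent hr hS htr hmax hphi hR hθ
  have hP := power_pos hS htr
  have hC := tapConst_nonneg r
  -- The shift parameter `6 / τ` makes the additive loss `3 / t` equal to `τ / 2`, and `6 / τ * lam
  -- = τ / 2` supplies the other half. A mean of at most `lam / 4` leaves the Chernoff exponent `lam
  -- / 2`.
  set lam := τ ^ 2 / 12 with hlam
  have hlam0 : 0 < lam := by positivity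
  filter_upwards [hb (lam / 4) (by positivity), eventually_gt_atTop 0,
    eventually_cubic_lt k (half_pos hlam0),
    -- Input energies are `O(s)`, so a grid with `s` steps per interval is fine enough for large
    -- `s`.
    (tendsto_natCast_atTop_atTop (R := ℝ)).eventually_ge_atTop (4 * tapConst r * (P + θ))]
    with s hbad hs hcub hbig
  intro V hV K hK
  have hs' : (0 : ℝ) < s := by exact_mod_cast hs
  set π := Measure.pi fun _ : Fin V => codewordLaw (S s) with hπ
  set e : (Fin (s + k) → Fin (k + 1) → Fin (s + 1)) → (Fin V → Fin s → ℝ) → ℝ := fun g X =>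
    (V : ℝ)⁻¹ * ∑ v, (noise (s + k)).real
      (Prod.mk X ⁻¹' badEvent c (S s) ε (η s) (gridTaps c r (s + k) s g) v) with he
  have hgbox : ∀ g, InBox c r (gridTaps c r (s + k) s g) := inBox_gridTaps hr (s + k) hs
  have hsum1 : ∀ g (X : Fin V → Fin s → ℝ), ∑ v, (noise (s + k)).real
      (Prod.mk X ⁻¹' badEvent c (S s) ε (η s) (gridTaps c r (s + k) s g) v) ≤ (V : ℝ) := by
    intro g X
    calc _ ≤ ∑ _v : Fin V, (1 : ℝ) := Finset.sum_le_sum fun v _ => measureReal_le_one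
      _ = V := by simp
  obtain ⟨X, hX⟩ := exists_small_averages (K := K) (lam := lam) (δ := lam / 4) π (e := e)
    (fun g => (Finset.measurable_sum _ fun v _ => measurable_real_section
      (measurableSet_badEvent c (S s) ε (η s) _ v)).const_mul _)
    (fun g X => mul_nonneg (by positivity) (Finset.sum_nonneg fun _ _ => measureReal_nonneg))
    (fun g X => inv_mul_le_one_of_le₀ (hsum1 g X) (by positivity))
    (fun g => by
      rw [he]
      simp only
      rw [integral_const_mul, integral_finsetSum _ fun v _ =>
        Integrable.of_bound (measurable_real_section
          (measurableSet_badEvent c (S s) ε (η s) _ v)).aestronglyMeasurable 1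
          (ae_of_all _ fun X => by
            rw [Real.norm_of_nonneg measureReal_nonneg]; exact measureReal_le_one)]
      have h1 : ∀ v : Fin V, ∫ X, (noise (s + k)).real
          (Prod.mk X ⁻¹' badEvent c (S s) ε (η s) (gridTaps c r (s + k) s g) v) ∂π ≤ lam / 4 := by
        intro v
        rw [integral_real_section (measurableSet_badEvent c (S s) ε (η s) _ v)]
        exact hbad V hV _ (hgbox g) v
      calc _ ≤ (V : ℝ)⁻¹ * ∑ _v : Fin V, lam / 4 := by gcongr with v _; exact h1 v
        _ ≤ lam / 4 := by
          rw [Finset.sum_const, Finset.card_univ, Fintype.card_fin, nsmul_eq_mul, ← mul_assoc]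
          exact mul_le_of_le_one_left (by positivity) inv_mul_le_one)
    (by
      have := card_grid_lt hcub (half_pos hlam0) hK
      rwa [show lam - 2 * (lam / 4) = lam / 2 by ring])
  -- Codewords of excessive energy are sent as zero, which bounds the power of every codeword. The
  -- decoder keeps the original codebook: a replaced codeword already counts as a bad event, so no
  -- new error arises.
  set Y : Fin K → Fin V → Fin s → ℝ := fun κ v =>
    if X κ v ⬝ᵥ X κ v < (S s).trace + ε * s then X κ v else 0 with hY
  have hYe : ∀ κ v, Y κ v ⬝ᵥ Y κ v ≤ s * (P + θ) := by
    intro κ v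
    simp only [hY]
    split_ifs with hlt
    · have := htr s
      have : ε * s ≤ θ * s := by gcongr
      nlinarith
    · rw [zero_dotProduct]; positivity
  refine ⟨Y, fun κ => jtDecode c (S s) ε (η s) (X κ),
    fun κ o => measurableSet_jtDecode_eq c (S s) ε (η s) (X κ) o, hYe, fun h hbox => ?_⟩
  obtain ⟨g, hg⟩ := exists_gridTaps_near hbox (s + k) hs
  have hpt : ∀ κ v, (noise (s + k)).real
      {z | jtDecode c (S s) ε (η s) (X κ) (output h (Y κ v) z) ≠ some v} ≤
      6 / τ * (noise (s + k)).real
        (Prod.mk (X κ) ⁻¹' badEvent c (S s) ε (η s) (gridTaps c r (s + k) s g) v) + τ / 2 := by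
    intro κ v
    have hx : 4 * tapConst r * (Y κ v ⬝ᵥ Y κ v) ≤ (s : ℝ) ^ 2 := by
      calc 4 * tapConst r * (Y κ v ⬝ᵥ Y κ v) ≤ 4 * tapConst r * (s * (P + θ)) := by
            have := hYe κ v
            gcongr
        _ = s * (4 * tapConst r * (P + θ)) := by ring
        _ ≤ s * s := by gcongr
        _ = _ := by ring
    have h1 := noise_output_le hs hg hx
      (measurableSet_jtDecode_eq c (S s) ε (η s) (X κ) (some v)).compl
      (show 0 < 6 / τ by positivity)
    have h2 : 3 / (6 / τ) = τ / 2 := by field_simp; norm_num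
    rw [h2] at h1
    refine h1.trans ?_
    refine add_le_add (mul_le_mul_of_nonneg_left (measureReal_mono fun z hz => ?_)
      (by positivity)) le_rfl
    have hz' : jtDecode c (S s) ε (η s) (X κ)
      (output (gridTaps c r (s + k) s g) (Y κ v) z) ≠ some v := hz
    by_contra hcon
    have hcon' : (X κ, z) ∉ badEvent c (S s) ε (η s) (gridTaps c r (s + k) s g) v := hcon
    simp only [badEvent, Set.mem_ofPred_eq, not_or, not_not, not_exists, not_and, not_le] at hcon'
    obtain ⟨⟨g1, g2⟩, g3⟩ := hcon'
    have hYX : Y κ v = X κ v := by simp only [hY]; rw [if_pos g2]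
    rw [hYX] at hz'
    exact hz' (jtDecode_eq_some g1 g3)
  rcases Nat.eq_zero_or_pos V with rfl | hVpos
  · simp
  have hV' : (0 : ℝ) < V := by exact_mod_cast hVpos
  calc _ ≤ ∑ κ : Fin K, ∑ v : Fin V, (6 / τ * (noise (s + k)).real
        (Prod.mk (X κ) ⁻¹' badEvent c (S s) ε (η s) (gridTaps c r (s + k) s g) v) + τ / 2) :=
        Finset.sum_le_sum fun κ _ => Finset.sum_le_sum fun v _ => hpt κ v
    _ = 6 / τ * V * ∑ κ, e g (X κ) + K * V * (τ / 2) := by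
        simp only [Finset.sum_add_distrib, ← Finset.mul_sum, he, Finset.sum_const, Finset.card_univ,
          Fintype.card_fin, nsmul_eq_mul]
        field_simp
    _ ≤ 6 / τ * V * (lam * K) + K * V * (τ / 2) := by
        have := (hX g).le
        gcongr
    _ = τ * (K * V) := by rw [hlam]; field_simp; ring

/-! ### Codewords with an antipodal prefix -/

theorem measurePreserving_noise_comp {m n : ℕ} {f : Fin m → Fin n} (hf : Function.Injective f) :
    MeasurePreserving (fun z : Fin n → ℝ => z ∘ f) (noise n) (noise m) := by
  set A : Matrix (Fin m) (Fin n) ℝ := Matrix.of fun i j => if f i = j then 1 else 0 with hA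
  have hAz : ∀ z : Fin n → ℝ, A *ᵥ z = z ∘ f := by
    intro z; ext i
    simp [hA, Matrix.mulVec, dotProduct]
  have h : A * Aᵀ = (1 : Matrix (Fin m) (Fin m) ℝ) * 1ᵀ := by
    ext i j
    simp [hA, Matrix.mul_apply, Matrix.one_apply, hf.eq_iff, eq_comm]
  have h2 := noise_map_congr h
  simp only [hAz, Matrix.one_mulVec, Measure.map_id'] at h2
  exact ⟨measurable_pi_lambda _ fun i => measurable_pi_apply _, h2⟩

/-- The embedding of the last `N` coordinates. -/
def suffixIndex {s k : ℕ} (l : ℕ) (j : Fin (s + k)) : Fin (l + s + k) := ⟨l + j, by omega⟩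

theorem suffixIndex_injective {s k : ℕ} (l : ℕ) :
    Function.Injective (suffixIndex l : Fin (s + k) → Fin (l + s + k)) := by
  intro i j hij
  simpa [suffixIndex, Fin.ext_iff] using hij

theorem tapInput_append {l s : ℕ} (p : Fin l → ℝ) (x : Fin s → ℝ) (t i : ℕ) :
    tapInput (Fin.append p x) t i =
      tapInput p t i + ∑ j : Fin s, if t = i + (l + j) then x j else 0 := by
  simp [tapInput, Fin.sum_univ_add]

/-- The last `k` symbols of the prefix vanish, so nothing leaks into the final `s + k` slots. These
carry a block of length `s` over the delayed taps, which obey the same constraints. -/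
theorem output_append_suffix {k l s : ℕ} (h : Taps k) {p : Fin l → ℝ}
    (hp : ∀ j : Fin l, l ≤ j + k → p j = 0) (x : Fin s → ℝ) (z : Fin (l + s + k) → ℝ) :
    output h (Fin.append p x) z ∘ suffixIndex l =
      output (fun t => h (l + t)) x (z ∘ suffixIndex l) := by
  ext j
  simp only [output, Function.comp_apply, Pi.add_apply, channelMatrix_mulVec, tapInput_append]
  congr 1
  refine Finset.sum_congr rfl fun i _ => ?_
  have h0 : tapInput p (suffixIndex l j : Fin (l + s + k)) i = 0 := by
    refine Finset.sum_eq_zero fun q _ => ?_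
    split_ifs with hq
    · refine hp q ?_
      simp only [suffixIndex] at hq
      omega
    · rfl
  rw [h0, zero_add]
  congr 1
  refine Finset.sum_congr rfl fun q _ => ?_
  have : ((suffixIndex l j : Fin (l + s + k)) : ℕ) = i + (l + q) ↔ (j : ℕ) = i + q := by
    simp only [suffixIndex]; omega
  simp only [this]

/-- Antipodal signalling of the bits `b`, one bit every `k + 1` slots. -/
def bitPrefix (k : ℕ) {L : ℕ} (l : ℕ) (A : ℝ) (b : Fin L → Bool) (j : Fin l) : ℝ :=
  ∑ i : Fin L, if (j : ℕ) = (k + 1) * i then (if b i then A else -A) else 0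

/-- The last bit sits at `(k + 1) * (L - 1)`, which leaves at least `k` empty slots as a guard
interval. -/
theorem bitPrefix_eq_zero {k L l : ℕ} (hl : (k + 1) * L ≤ l) (A : ℝ) (b : Fin L → Bool) (j : Fin l)
    (hj : l ≤ j + k) : bitPrefix k l A b j = 0 := by
  refine Finset.sum_eq_zero fun i _ => if_neg fun h => ?_
  have : (k + 1) * (i + 1) ≤ (k + 1) * L := Nat.mul_le_mul_left _ i.2
  rw [mul_add] at this
  omega

theorem bitPrefix_apply {k L l : ℕ} (A : ℝ) (b : Fin L → Bool) (j : Fin l) (i : Fin L)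
    (hj : (j : ℕ) = (k + 1) * i) : bitPrefix k l A b j = if b i then A else -A := by
  rw [bitPrefix, Finset.sum_eq_single i]
  · rw [if_pos hj]
  · intro i' _ hne
    refine if_neg fun h => hne (Fin.ext ?_)
    exact Nat.eq_of_mul_eq_mul_left (Nat.succ_pos k) (h.symm.trans hj)
  · simp

theorem bitPrefix_energy_le (k : ℕ) {L : ℕ} (l : ℕ) (A : ℝ) (b : Fin L → Bool) :
    ∑ j, bitPrefix k l A b j ^ 2 ≤ L * A ^ 2 := by
  have h : ∀ j : Fin l, bitPrefix k l A b j ^ 2 ≤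
      ∑ i : Fin L, if (j : ℕ) = (k + 1) * i then A ^ 2 else 0 := by
    intro j
    have hnn : ∀ i ∈ Finset.univ, 0 ≤ (if (j : ℕ) = (k + 1) * (i : Fin L) then A ^ 2 else 0) :=
      fun i _ => by split_ifs <;> positivity
    by_cases hj : ∃ i : Fin L, (j : ℕ) = (k + 1) * i
    · obtain ⟨i, hi⟩ := hj
      refine le_trans ?_ (Finset.single_le_sum hnn (Finset.mem_univ i))
      rw [bitPrefix_apply A b j i hi, if_pos hi]
      split_ifs <;> simp
    · have : bitPrefix k l A b j = 0 := Finset.sum_eq_zero fun i _ => if_neg fun h => hj ⟨i, h⟩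
      rw [this]
      simpa using Finset.sum_nonneg hnn
  calc _ ≤ ∑ j : Fin l, ∑ i : Fin L, if (j : ℕ) = (k + 1) * i then A ^ 2 else 0 :=
        Finset.sum_le_sum fun j _ => h j
    _ = ∑ i : Fin L, ∑ j : Fin l, if (j : ℕ) = (k + 1) * i then A ^ 2 else 0 := Finset.sum_comm
    _ ≤ ∑ _i : Fin L, A ^ 2 := by
        refine Finset.sum_le_sum fun i _ => ?_
        by_cases hi : (k + 1) * (i : ℕ) < l
        · rw [Finset.sum_eq_single (⟨(k + 1) * i, hi⟩ : Fin l)]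
          · simp
          · intro j _ hne
            exact if_neg fun h => hne (Fin.ext h)
          · simp
        · rw [Finset.sum_eq_zero]
          · positivity
          · intro j _
            exact if_neg fun (h : (j : ℕ) = (k + 1) * i) => hi (h ▸ j.2)
    _ = _ := by simp

/-- The slot in which the tap `a` acts on the bit `i` of the prefix. -/
def bitSlot {k L l : ℕ} (s : ℕ) (hl : (k + 1) * L ≤ l) (a : Fin (k + 1)) (i : Fin L) :
    Fin (l + s + k) := ⟨(k + 1) * i + a, by
  have : (k + 1) * (i + 1) ≤ (k + 1) * L := Nat.mul_le_mul_left _ i.2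
  rw [mul_add] at this
  omega⟩

/-- Bits are `k + 1` slots apart and delays are at most `k`, so each slot of the prefix receives one
bit through one tap. -/
theorem output_bitSlot {k L l s : ℕ} (hl : (k + 1) * L ≤ l) (a : Fin (k + 1)) (h : Taps k) (A : ℝ)
    (b : Fin L → Bool) (x : Fin s → ℝ) (z : Fin (l + s + k) → ℝ) (i : Fin L) :
    output h (Fin.append (bitPrefix k l A b) x) z (bitSlot s hl a i) =
      h ((k + 1) * i + a) a * (if b i then A else -A) + z (bitSlot s hl a i) := by
  have hlt : (k + 1) * (i : ℕ) + k < l := by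
    have : (k + 1) * (i + 1) ≤ (k + 1) * L := Nat.mul_le_mul_left _ i.2
    rw [mul_add] at this
    omega
  simp only [output, Pi.add_apply, channelMatrix_mulVec, tapInput_append]
  congr 1
  have hsuf : ∀ q : Fin (k + 1), (∑ j : Fin s,
      if ((bitSlot s hl a i : Fin (l + s + k)) : ℕ) = q + (l + j) then x j else 0) = 0 := by
    intro q
    refine Finset.sum_eq_zero fun j _ => if_neg ?_
    simp only [bitSlot]
    omega
  simp only [hsuf, add_zero]
  rw [Finset.sum_eq_single a]
  · congr 1
    rw [tapInput, Finset.sum_eq_single (⟨(k + 1) * i, by omega⟩ : Fin l)]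
    · rw [if_pos (by simp only [bitSlot]; omega)]
      exact bitPrefix_apply A b _ i rfl
    · intro j _ hne
      refine if_neg fun h => hne (Fin.ext ?_)
      simp only [bitSlot] at h ⊢
      omega
    · simp
  · intro q _ hq
    rw [tapInput, Finset.sum_eq_zero, mul_zero]
    intro j _
    split_ifs with hj
    · refine Finset.sum_eq_zero fun i' _ => if_neg fun hi' => hq (Fin.ext ?_)
      simp only [bitSlot] at hj
      rw [hi', add_comm (q : ℕ)] at hj
      -- The delay is the residue of the slot modulo `k + 1`.
      have := congrArg (· % (k + 1)) hj
      simp only [Nat.mul_add_mod, Nat.mod_eq_of_lt a.2, Nat.mod_eq_of_lt q.2] at this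
      exact this.symm
    · rfl
  · simp

/-- Sign detection of the bits of the prefix. -/
noncomputable def bitDecode {k L l : ℕ} (s : ℕ) (hl : (k + 1) * L ≤ l) (c : Fin (k + 1) → ℝ)
    (a : Fin (k + 1)) (y : Fin (l + s + k) → ℝ) (i : Fin L) : Bool :=
  decide (0 < c a * y (bitSlot s hl a i))

theorem measurableSet_bitDecode_eq {k L l s : ℕ} (hl : (k + 1) * L ≤ l) (c : Fin (k + 1) → ℝ)
    (a : Fin (k + 1)) (b : Fin L → Bool) : MeasurableSet {y | bitDecode s hl c a y = b} := by
  have e : {y | bitDecode s hl c a y = b} = ⋂ i : Fin L, {y | bitDecode s hl c a y i = b i} := by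
    ext y; simp [funext_iff]
  rw [e]
  refine MeasurableSet.iInter fun i => ?_
  have m : MeasurableSet {y : Fin (l + s + k) → ℝ | 0 < c a * y (bitSlot s hl a i)} :=
    measurableSet_lt measurable_const ((measurable_pi_apply _).const_mul _)
  cases hb : b i with
  | true => simpa [bitDecode] using m
  | false => simpa [bitDecode, Set.compl_ofPred] using m.compl

/-- Wherever the tap lies in its interval, it has the sign of `c a` and modulus at least `|c a| - r
a`. Noise below `A` times this margin cannot flip a bit. -/
theorem bitDecode_output {k L l s : ℕ} (hl : (k + 1) * L ≤ l) {c r : Fin (k + 1) → ℝ}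
    {a : Fin (k + 1)} {h : Taps k} (hb : InBox c r h) {A : ℝ} (hA : 0 < A)
    (b : Fin L → Bool) (x : Fin s → ℝ) {z : Fin (l + s + k) → ℝ}
    (hz : ∀ i : Fin L, |z (bitSlot s hl a i)| < A * (|c a| - r a)) :
    bitDecode s hl c a (output h (Fin.append (bitPrefix k l A b) x) z) = b := by
  ext i
  rw [bitDecode, output_bitSlot]
  set u := h ((k + 1) * i + a) a
  set ζ := z (bitSlot s hl a i)
  have hzi : |ζ| < A * (|c a| - r a) := hz i
  have hu : c a - r a ≤ u ∧ u ≤ c a + r a := hb _ a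
  obtain ⟨z1, z2⟩ := abs_lt.1 hzi
  cases hbi : b i <;> simp only [if_true, if_false, Bool.false_eq_true, decide_eq_true_eq,
    decide_eq_false_iff_not, not_lt]
  · rcases le_or_gt 0 (c a) with hc | hc
    · rw [abs_of_nonneg hc] at z1 z2
      have : u * -A + ζ ≤ 0 := by nlinarith [hu.1]
      nlinarith
    · rw [abs_of_neg hc] at z1 z2
      have : 0 ≤ u * -A + ζ := by nlinarith [hu.2]
      nlinarith
  · rcases lt_trichotomy 0 (c a) with hc | hc | hc
    · rw [abs_of_pos hc] at z1 z2
      have : 0 < u * A + ζ := by nlinarith [hu.1]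
      positivity
    -- Vacuous: `c a = 0` would make the noise bound force `r a < 0`, and the tap interval would be
    -- empty.
    · rw [← hc] at z1 z2 hu
      have : r a < 0 := by
        by_contra hcon
        simp only [abs_zero] at z1 z2
        nlinarith
      linarith [hu.1, hu.2]
    · rw [abs_of_neg hc] at z1 z2
      have : u * A + ζ < 0 := by nlinarith [hu.2]
      nlinarith

/-! ### One code from a family of codes -/

theorem noise_coordinate_le {n : ℕ} (i : Fin n) {t : ℝ} (ht : 0 < t) :
    (noise n).real {z | t ≤ |z i|} ≤ 1 / t ^ 2 := by
  have := noise_linear_chebyshev (Pi.single i (1 : ℝ)) ht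
  simpa using this

/-- The family of codes controls only the sum of the errors over messages at each tap array. The sum
must therefore be formed before integrating over the taps. -/
theorem sum_prod_real_le {α β ι : Type*} [MeasurableSpace α] [MeasurableSpace β] [Fintype ι]
    {μ : Measure α} {ν : Measure β} [IsProbabilityMeasure μ] [IsProbabilityMeasure ν]
    {s : ι → Set (α × β)} (hs : ∀ w, MeasurableSet (s w)) {b : ℝ}
    (h : ∀ᵐ x ∂μ, ∑ w, ν.real (Prod.mk x ⁻¹' s w) ≤ b) : ∑ w, (μ.prod ν).real (s w) ≤ b := by
  have hint : ∀ w, Integrable (fun x => ν.real (Prod.mk x ⁻¹' s w)) μ := fun w =>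
    Integrable.of_bound (measurable_real_section (hs w)).aestronglyMeasurable 1
      (ae_of_all _ fun x => by
        rw [Real.norm_of_nonneg measureReal_nonneg]; exact measureReal_le_one)
  simp only [← integral_real_section (hs _)]
  rw [← integral_finsetSum _ fun w _ => hint w]
  calc _ ≤ ∫ _, b ∂μ := integral_mono_ae (integrable_finsetSum _ fun w _ => hint w)
        (integrable_const b) h
    _ = b := by simp

theorem measurable_of_finite_decisions {Y G Ω : Type*} [MeasurableSpace Y] [MeasurableSpace Ω]
    [Countable Ω] [Countable G] {g : Y → G} (hg : ∀ o, MeasurableSet {y | g y = o}) (F : G → Ω) :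
    Measurable fun y => F (g y) := by
  let _ : MeasurableSpace G := ⊤
  refine (measurable_from_top (f := F)).comp (measurable_to_countable' fun o => hg o)

theorem measurableSet_error {k n M : ℕ} {d : (Fin (n + k) → ℝ) → Fin M} (hd : Measurable d)
    (x : Fin n → ℝ) (w : Fin M) :
    MeasurableSet {p : Taps k × (Fin (n + k) → ℝ) | d (output p.1 x p.2) ≠ w} := by
  have h1 : Measurable fun p : Taps k × (Fin (n + k) → ℝ) => (p.1, x, p.2) :=
    measurable_fst.prodMk (measurable_const.prodMk measurable_snd)
  have h2 := Measurable.comp (g := fun q : Taps k × (Fin n → ℝ) × (Fin (n + k) → ℝ) =>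
    output q.1 q.2.1 q.2.2) measurable_output_joint h1
  exact ((hd.comp h2) (measurableSet_singleton w)).compl

/-- A family of `2 ^ L` codes, together with a prefix that tells the receiver which member of the
family is in use, forms a single code whose error probability is controlled by the average over
the family. -/
theorem exists_prefixed_code {k : ℕ} {c r : Fin (k + 1) → ℝ} {a : Fin (k + 1)}
    (ha : r a < |c a|) {l s L M V : ℕ} (hM : 0 < M) (hl : (k + 1) * L ≤ l)
    (hMV : M ≤ 2 ^ L * V) {A E B : ℝ} (hA : 0 < A)
    {X : Fin (2 ^ L) → Fin V → Fin s → ℝ} {D : Fin (2 ^ L) → (Fin (s + k) → ℝ) → Option (Fin V)}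
    (hD : ∀ κ o, MeasurableSet {y | D κ y = o}) (hX : ∀ κ v, X κ v ⬝ᵥ X κ v ≤ E)
    (hB : ∀ h, InBox c r h →
      ∑ κ, ∑ v, (noise (s + k)).real {z | D κ (output h (X κ v) z) ≠ some v} ≤ B) :
    ∃ C : BlockCode k (l + s) M, (∀ w, ∑ t, C.enc w t ^ 2 ≤ L * A ^ 2 + E) ∧
      ∀ ν, IsTapLaw c r ν →
        C.errorProb ν ≤ L * (1 / (A * (|c a| - r a)) ^ 2) + (M : ℝ)⁻¹ * B := by
  have : Nonempty (Fin M) := ⟨⟨0, hM⟩⟩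
  let b : Fin (2 ^ L) ≃ (Fin L → Bool) := Fintype.equivOfCardEq (by simp)
  obtain ⟨e⟩ : Nonempty (Fin M ↪ Fin (2 ^ L) × Fin V) :=
    Function.Embedding.nonempty_of_card_le (by simpa using hMV)
  -- Messages are labelled by pairs of codebook and codeword. A declared failure or an unused pair
  -- is decoded arbitrarily.
  let F : (Fin (2 ^ L) × Option (Fin V)) → Fin M :=
    Function.invFun fun w : Fin M => ((e w).1, some (e w).2)
  have hF : ∀ w, F ((e w).1, some (e w).2) = w := by
    refine Function.leftInverse_invFun fun w w' hw => e.injective (Prod.ext ?_ ?_)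
    · exact (Prod.ext_iff.1 hw).1
    · exact Option.some.inj (Prod.ext_iff.1 hw).2
  let g : (Fin (l + s + k) → ℝ) → Fin (2 ^ L) × Option (Fin V) := fun y =>
    (b.symm (bitDecode s hl c a y), D (b.symm (bitDecode s hl c a y)) (y ∘ suffixIndex l))
  have hsuf : Measurable fun y : Fin (l + s + k) → ℝ => y ∘ (suffixIndex l : Fin (s + k) → _) :=
    (measurePreserving_noise_comp (suffixIndex_injective l)).measurable
  have hg : ∀ o, MeasurableSet {y | g y = o} := by
    rintro ⟨κ, o⟩
    have he : {y | g y = (κ, o)} = {y | bitDecode s hl c a y = b κ} ∩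
        (fun y => y ∘ suffixIndex l) ⁻¹' {y | D κ y = o} := by
      ext y
      simp only [g, Set.mem_ofPred_eq, Prod.mk.injEq, Set.mem_inter_iff, Set.mem_preimage,
        Equiv.symm_apply_eq]
      refine and_congr_right fun h1 => ?_
      rw [h1, Equiv.symm_apply_apply]
    rw [he]
    exact (measurableSet_bitDecode_eq hl c a (b κ)).inter (hsuf (hD κ o))
  let C : BlockCode k (l + s) M :=
    { enc := fun w => Fin.append (bitPrefix k l A (b (e w).1)) (X (e w).1 (e w).2)
      dec := fun y => F (g y)
      measurable_dec := measurable_of_finite_decisions hg F }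
  refine ⟨C, fun w => ?_, fun ν hν => ?_⟩
  · simp only [C, Fin.sum_univ_add, Fin.append_left, Fin.append_right]
    refine add_le_add (bitPrefix_energy_le k l A _) ?_
    have := hX (e w).1 (e w).2
    simpa [dotProduct, sq] using this
  set δ := 1 / (A * (|c a| - r a)) ^ 2
  have hpos : 0 < A * (|c a| - r a) := mul_pos hA (by linarith)
  have hpt : ∀ h, InBox c r h → ∀ w : Fin M,
      (noise (l + s + k)).real {z | C.dec (output h (C.enc w) z) ≠ w} ≤ L * δ +
        (noise (s + k)).real {z | D (e w).1 (output (fun t => h (l + t)) (X (e w).1 (e w).2) z) ≠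
          some (e w).2} := by
    intro h hb w
    have hm : MeasurableSet {z : Fin (s + k) → ℝ |
        D (e w).1 (output (fun t => h (l + t)) (X (e w).1 (e w).2) z) ≠ some (e w).2} :=
      ((measurable_output _).comp (measurable_const.prodMk measurable_id)
        (hD (e w).1 (some (e w).2))).compl
    rw [← measureReal_preimage_of_measurePreserving
      (measurePreserving_noise_comp (suffixIndex_injective l)) hm]
    calc _ ≤ (noise (l + s + k)).real ((⋃ i : Fin L, {z : Fin (l + s + k) → ℝ |
            A * (|c a| - r a) ≤ |z (bitSlot s hl a i)|}) ∪
          (fun z => z ∘ suffixIndex l) ⁻¹' {z : Fin (s + k) → ℝ | D (e w).1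
            (output (fun t => h (l + t)) (X (e w).1 (e w).2) z) ≠ some (e w).2}) := by
          refine measureReal_mono fun z hz => ?_
          by_contra hcon
          simp only [Set.mem_union, Set.mem_iUnion, Set.mem_ofPred_eq, Set.mem_preimage, not_or,
            not_exists, not_le, not_not] at hcon
          refine hz ?_
          have h1 : bitDecode s hl c a (output h (C.enc w) z) = b (e w).1 :=
            bitDecode_output hl hb hA _ _ hcon.1
          have h2 : output h (C.enc w) z ∘ suffixIndex l =
              output (fun t => h (l + t)) (X (e w).1 (e w).2) (z ∘ suffixIndex l) :=
            output_append_suffix h (bitPrefix_eq_zero hl A _) _ z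
          change F (g (output h (C.enc w) z)) = w
          have h3 : g (output h (C.enc w) z) = ((e w).1, some (e w).2) := by
            simp only [g, h1, h2, Equiv.symm_apply_apply, hcon.2]
          rw [h3, hF]
      _ ≤ _ := by
          refine (measureReal_union_le _ _).trans (add_le_add ?_ le_rfl)
          refine (measureReal_iUnion_fintype_le _).trans ?_
          calc _ ≤ ∑ _i : Fin L, δ := Finset.sum_le_sum fun i _ => noise_coordinate_le _ hpos
            _ = _ := by simp
  have := hν.prob
  have hsum : ∑ w, (ν.prod (noise (l + s + k))).real {p | C.dec (output p.1 (C.enc w) p.2) ≠ w} ≤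
      M * (L * δ) + B := by
    refine sum_prod_real_le (fun w => measurableSet_error C.measurable_dec _ w) ?_
    filter_upwards [hν.ae_inBox] with h hb
    have hb' : InBox c r fun t => h (l + t) := fun t => hb (l + t)
    set G : Fin (2 ^ L) × Fin V → ℝ := fun q => (noise (s + k)).real
      {z | D q.1 (output (fun t => h (l + t)) (X q.1 q.2) z) ≠ some q.2}
    calc _ ≤ ∑ w : Fin M, (L * δ + G (e w)) := Finset.sum_le_sum fun w _ => hpt h hb w
      _ = M * (L * δ) + ∑ q ∈ Finset.univ.map e, G q := by
          simp [Finset.sum_add_distrib]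
      -- Pairs that label no message only enlarge the sum.
      _ ≤ M * (L * δ) + ∑ q, G q := by
          exact add_le_add le_rfl (Finset.sum_le_sum_of_subset_of_nonneg (Finset.subset_univ _)
            fun _ _ _ => measureReal_nonneg)
      _ ≤ M * (L * δ) + B := by
          rw [Fintype.sum_prod_type]
          have := hB _ hb'
          gcongr
  have hM' : (0 : ℝ) < M := by exact_mod_cast hM
  calc C.errorProb ν ≤ (M : ℝ)⁻¹ * (M * (L * δ) + B) := by
        unfold BlockCode.errorProb; gcongr
    _ = _ := by field_simp

/-! ### Rates below the bound are achievable -/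

/-- If all taps could vanish, the lower bound would not be positive. -/
theorem exists_radius_lt_centre {k : ℕ} {c r : Fin (k + 1) → ℝ} (hr : ∀ i, 0 ≤ r i)
    {S : ∀ n : ℕ, Matrix (Fin n) (Fin n) ℝ} (hS : ∀ n, (S n).PosDef)
    (hphi : ∀ n, phi1 c r (S n) < 1) (hLB : ((0 : ℝ) : EReal) < lowerBound c r S) :
    ∃ a, r a < |c a| := by
  by_contra! hcon
  obtain ⟨n, hn, hn0⟩ := ((eventually_lt_of_lt_liminf hLB).and (eventually_gt_atTop 0)).exists
  have hbT : 0 < boundTerm c r (S n) := by exact_mod_cast hn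
  -- The zero channel is admissible and has output covariance `1`. The determinant comparison then
  -- gives `(1 - phi1)ⁿ det (I + H_cᵀ H_c S) ≤ 1`, so `boundTerm` is not positive.
  have hb : InBox c r (0 : Taps k) := fun t i => by
    have := abs_le.1 (hcon i)
    simp only [Pi.zero_apply, Set.mem_Icc]
    constructor <;> linarith
  obtain ⟨B, d, hB, hBd, hd, -⟩ := exists_factor (hS n)
  have h1 := det_output_cov_ge hb (hS n) (hphi n) hB hBd hd
  have h0 : channelMatrix n (0 : Taps k) = 0 := by
    ext t j
    simp [channelMatrix]
  rw [h0, Matrix.zero_mul, Matrix.zero_mul, add_zero, Matrix.det_one] at h1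
  have h2 := boundTerm_le hn0 hr (hS n) (hphi n)
  have h3 := Real.log_nonpos (mul_nonneg (pow_nonneg (by linarith [hphi n]) n)
    (det_centre_pos c (hS n)).le) h1
  have hn' : (0 : ℝ) < n := by exact_mod_cast hn0
  have h4 : 0 ≤ tapConst r * ((S n).trace / ((n : ℝ) + k + n)) :=
    mul_nonneg (tapConst_nonneg r) (div_nonneg (hS n).posSemidef.trace_nonneg (by positivity))
  have h5 : 0 ≤ (n : ℝ) * Real.log (1 + tapConst r * ((S n).trace / ((n : ℝ) + k + n))) :=
    mul_nonneg hn'.le (Real.log_nonneg (by linarith))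
  have h6 : 0 < n * Real.log 2 * boundTerm c r (S n) := by
    have := Real.log_pos one_lt_two
    positivity
  linarith

theorem eventually_mul_log_sq_le {q : ℝ} (hq : 0 < q) :
    ∀ᶠ n : ℕ in atTop, q * Real.log n ^ 2 ≤ n := by
  have h := (Real.isLittleO_pow_log_id_atTop (n := 2)).comp_tendsto
    (tendsto_natCast_atTop_atTop (R := ℝ))
  filter_upwards [h.def (show 0 < 1 / q by positivity)] with n hn
  simp only [Function.comp_apply, id, norm_pow, Real.norm_eq_abs, sq_abs, Nat.abs_cast] at hn
  rwa [div_mul_eq_mul_div, one_mul, le_div_iff₀ hq, mul_comm] at hn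

theorem numMessages_pos (n : ℕ) (R : ℝ) : 0 < numMessages n R :=
  Nat.ceil_pos.2 (by positivity)

theorem cube_le_two_pow {n L : ℕ} (hn : 0 < n) (hL : 5 * Real.log n ≤ L) : n ^ 3 ≤ 2 ^ L := by
  have hn' : (0 : ℝ) < n := by exact_mod_cast hn
  have hlog : 0 ≤ Real.log n := Real.log_natCast_nonneg n
  -- What matters is `5 * log 2 > 3`.
  have h2 := Real.log_two_gt_d9
  have : ((n : ℝ)) ^ 3 ≤ 2 ^ L := by
    rw [← Real.log_le_log_iff (by positivity) (by positivity), Real.log_pow, Real.log_pow]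
    push_cast
    nlinarith
  exact_mod_cast this

/-- A fraction `γ` of the block is given to the prefix and the rest carries a code of the slightly
larger rate `R'`. The prefix has only `O(log n)` bits but energy proportional to `n`, so even the
Chebyshev bound on its error, of order `(log n)² / n`, vanishes. -/
theorem exists_code_of_lt_lowerBound {k : ℕ} {c r : Fin (k + 1) → ℝ} (hr : ∀ i, 0 ≤ r i) {P : ℝ}
    {S : ∀ n : ℕ, Matrix (Fin n) (Fin n) ℝ} (hS : ∀ n, (S n).PosDef)
    (htr : ∀ n, (S n).trace ≤ n * P)
    (hmax : Tendsto (fun n : ℕ => 1 / (n : ℝ) * lamMax (S n)) atTop (𝓝 0))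
    (hphi : ∀ n, phi1 c r (S n) < 1) {R R' : ℝ} (hR0 : 0 < R) (hRR : R < R')
    (hR : (R' : EReal) < lowerBound c r S) {τ : ℝ} (hτ : 0 < τ) :
    ∀ᶠ n : ℕ in atTop, ∃ C : BlockCode k n (numMessages n R), C.PowerConstraint P ∧
      ∀ ν, IsTapLaw c r ν → C.errorProb ν ≤ τ := by
  have hP := power_pos hS htr
  have hR' : 0 < R' := hR0.trans hRR
  obtain ⟨a, ha⟩ := exists_radius_lt_centre hr hS hphi
    (lt_trans (by exact_mod_cast hR') hR)
  set Δ := |c a| - r a with hΔ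
  have hΔ0 : 0 < Δ := by linarith
  -- Then `(1 - γ) * R'` is the midpoint of `R` and `R'`, which leaves room for rounding `s` down.
  set γ := (R' - R) / (2 * R') with hγ
  have hγ0 : 0 < γ := div_pos (by linarith) (by linarith)
  have hγ1 : γ < 1 := by rw [hγ, div_lt_one (by linarith)]; linarith
  have hγR : (1 - γ) * R' = (R' + R) / 2 := by rw [hγ]; field_simp; ring
  have hfam := exists_code_family hr hS htr hmax hphi hR
    (show 0 < γ * P / 2 by positivity) (show 0 < τ / 4 by positivity)
  have hcast := tendsto_natCast_atTop_atTop (R := ℝ)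
  have hst : Tendsto (fun n : ℕ => ⌊(1 - γ) * (n : ℝ)⌋₊) atTop atTop :=
    tendsto_nat_floor_atTop.comp (hcast.const_mul_atTop (by linarith))
  filter_upwards [hst.eventually hfam, eventually_gt_atTop 0,
    (Real.tendsto_log_atTop.comp hcast).eventually_ge_atTop 1,
    -- As `L ≤ 6 * log n`, the next three conditions ensure in turn that the prefix fits, that `2 ^
    -- L ≤ M`, and that the bits fail with probability at most `τ / 2` (`144 = 4 * 6 ^ 2`).
    eventually_mul_log_sq_le (show 0 < 6 * (k + 1) / γ by positivity),
    eventually_mul_log_sq_le (show 0 < 6 / R by positivity),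
    eventually_mul_log_sq_le (show 0 < 144 / (γ * P * Δ ^ 2 * τ) by positivity),
    hcast.eventually_ge_atTop (2 * R' / (R' - R))] with n hs hn hlog hq1 hq2 hq3 hn2
  simp only [Function.comp_apply] at hlog
  have hn' : (0 : ℝ) < n := by exact_mod_cast hn
  set Λ := Real.log n with hΛ
  set s := ⌊(1 - γ) * (n : ℝ)⌋₊ with hsdef
  have hs1 : (s : ℝ) ≤ (1 - γ) * n := Nat.floor_le (by nlinarith)
  have hs2 : (1 - γ) * n < s + 1 := Nat.lt_floor_add_one _
  set L := ⌈5 * Λ⌉₊ with hLdef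
  have hL1 : 5 * Λ ≤ L := Nat.le_ceil _
  have hL2 : (L : ℝ) ≤ 6 * Λ := by
    have := Nat.ceil_lt_add_one (show 0 ≤ 5 * Λ by linarith)
    linarith
  have hL0 : (0 : ℝ) < L := by linarith
  have hLnat : 0 < L := by exact_mod_cast hL0
  have hΛ2 : Λ ≤ Λ ^ 2 := by nlinarith
  rw [div_mul_eq_mul_div, div_le_iff₀ hγ0] at hq1
  rw [div_mul_eq_mul_div, div_le_iff₀ hR0] at hq2
  rw [div_mul_eq_mul_div, div_le_iff₀ (by positivity)] at hq3
  set M := numMessages n R with hM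
  have hMpos : 0 < M := numMessages_pos n R
  have hKM : 2 ^ L ≤ M := by
    have h1 : (2 : ℝ) ^ L ≤ M := by
      refine le_trans ?_ (Nat.le_ceil _)
      rw [← Real.rpow_natCast]
      exact Real.rpow_le_rpow_of_exponent_le one_le_two (by nlinarith)
    exact_mod_cast h1
  have hK2 : 2 ≤ 2 ^ L := Nat.le_self_pow hLnat.ne' 2
  have hsn : s ≤ n := by
    have : (s : ℝ) ≤ n := by nlinarith
    exact_mod_cast this
  have hnR : (n : ℝ) * R ≤ s * R' := by
    rw [div_le_iff₀ (by linarith)] at hn2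
    nlinarith
  have hMs : M ≤ numMessages s R' :=
    Nat.ceil_le_ceil (Real.rpow_le_rpow_of_exponent_le one_le_two hnR)
  -- The pairs number between `M` and `2 * M`, so unused pairs at most double the average error.
  set V := M / 2 ^ L + 1 with hV
  have hVM : V ≤ M := by
    have := Nat.div_le_div_left (a := M) hK2 two_pos
    omega
  have hKV1 : M ≤ 2 ^ L * V := by
    have := Nat.lt_mul_div_succ M (show 0 < 2 ^ L by positivity)
    exact this.le
  have hKV2 : 2 ^ L * V ≤ 2 * M := by
    have := Nat.mul_div_le M (2 ^ L)
    rw [hV, mul_add]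
    omega
  obtain ⟨X, D, hD, hX, hB⟩ := hs V (hVM.trans hMs) (2 ^ L)
    ((Nat.pow_le_pow_left hsn 3).trans (cube_le_two_pow hn hL1))
  obtain ⟨l, hl⟩ : ∃ l, n = l + s := ⟨n - s, by omega⟩
  have hln : γ * n ≤ l := by
    have : (n : ℝ) = l + s := by exact_mod_cast hl
    linarith
  have hlL : (k + 1) * L ≤ l := by
    have : ((k : ℝ) + 1) * L ≤ l := by
      have h1 : ((k : ℝ) + 1) * L ≤ (k + 1) * (6 * Λ ^ 2) := by
        have : (L : ℝ) ≤ 6 * Λ ^ 2 := by linarith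
        gcongr
      linarith
    exact_mod_cast this
  -- This amplitude spends `γ n P / 2` on the `L` bits. With the tolerance `θ = γ P / 2` the total
  -- energy is at most `n P (1 - γ² / 2)`.
  have hA : 0 < √(γ * n * P / (2 * L)) := Real.sqrt_pos.2 (by positivity)
  obtain ⟨C, hC1, hC2⟩ := exists_prefixed_code ha hMpos hlL hKV1 hA hD hX hB
  rw [Real.sq_sqrt (by positivity)] at hC1
  have hMr : (0 : ℝ) < M := by exact_mod_cast hMpos
  have hpow : ∀ w, ∑ t, C.enc w t ^ 2 ≤ n * P := by
    intro w
    refine (hC1 w).trans ?_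
    have e : (L : ℝ) * (γ * n * P / (2 * L)) = γ * n * P / 2 := by field_simp
    rw [e]
    calc γ * n * P / 2 + s * (P + γ * P / 2)
        ≤ γ * n * P / 2 + (1 - γ) * n * (P + γ * P / 2) := by gcongr
      _ = n * P - γ ^ 2 * (n * P) / 2 := by ring
      _ ≤ n * P := by have : 0 ≤ γ ^ 2 * (n * P) / 2 := by positivity
                      linarith
  have herr : ∀ ν, IsTapLaw c r ν → C.errorProb ν ≤ τ := by
    intro ν hν
    refine (hC2 ν hν).trans ?_
    have h1 : (L : ℝ) * (1 / (√(γ * n * P / (2 * L)) * Δ) ^ 2) ≤ τ / 2 := by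
      rw [mul_pow, Real.sq_sqrt (by positivity)]
      have e : (L : ℝ) * (1 / (γ * n * P / (2 * L) * Δ ^ 2)) = 2 * L ^ 2 / (n * (γ * P * Δ ^ 2)) := by
        field_simp
      rw [e, div_le_iff₀ (by positivity)]
      have : (L : ℝ) ^ 2 ≤ (6 * Λ) ^ 2 := by gcongr
      linarith
    have h2 : (M : ℝ)⁻¹ * (τ / 4 * (((2 ^ L : ℕ) : ℝ) * V)) ≤ τ / 2 := by
      have : ((2 ^ L : ℕ) : ℝ) * V ≤ 2 * M := by exact_mod_cast hKV2
      calc _ ≤ (M : ℝ)⁻¹ * (τ / 4 * (2 * M)) := by gcongr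
        _ = τ / 2 := by field_simp; norm_num
    linarith
  have hpc : (M : ℝ)⁻¹ * ∑ w, ∑ t, C.enc w t ^ 2 ≤ n * P := by
    calc _ ≤ (M : ℝ)⁻¹ * ∑ _w : Fin M, (n : ℝ) * P := by gcongr with w _; exact hpow w
      _ = n * P := by
        rw [Finset.sum_const, Finset.card_univ, Fintype.card_fin, nsmul_eq_mul]
        field_simp
  clear_value M s L Λ
  subst hl
  exact ⟨C, hpc, herr⟩

theorem BlockCode.errorProb_nonneg {k n M : ℕ} (C : BlockCode k n M) (ν : Measure (Taps k)) :
    0 ≤ C.errorProb ν :=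
  mul_nonneg (by positivity) (Finset.sum_nonneg fun _ _ => measureReal_nonneg)

theorem BlockCode.errorProb_le_one {k n M : ℕ} (C : BlockCode k n M) (ν : Measure (Taps k))
    [IsProbabilityMeasure ν] : C.errorProb ν ≤ 1 := by
  refine inv_mul_le_one_of_le₀ ?_ (by positivity)
  calc _ ≤ ∑ _w : Fin M, (1 : ℝ) := Finset.sum_le_sum fun w _ => measureReal_le_one
    _ = M := by simp

/-- The code that always sends zero. -/
def BlockCode.zero (k n : ℕ) {M : ℕ} (hM : 0 < M) : BlockCode k n M where
  enc _ _ := 0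
  dec _ := ⟨0, hM⟩
  measurable_dec := measurable_const

theorem BlockCode.zero_powerConstraint (k n : ℕ) {M : ℕ} (hM : 0 < M) {P : ℝ} (hP : 0 ≤ P) :
    (BlockCode.zero k n hM).PowerConstraint P := by
  simp only [PowerConstraint, zero, ne_eq, OfNat.ofNat_ne_zero, not_false_eq_true, zero_pow,
    Finset.sum_const_zero, mul_zero]
  positivity

/-- Diagonal choice of codes. -/
theorem achievable_of_forall_eventually {k : ℕ} {c r : Fin (k + 1) → ℝ} {P R : ℝ} (hP : 0 ≤ P)
    (hR : 0 ≤ R) (h : ∀ τ > 0, ∀ᶠ n : ℕ in atTop, ∃ C : BlockCode k n (numMessages n R),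
      C.PowerConstraint P ∧ ∀ ν, IsTapLaw c r ν → C.errorProb ν ≤ τ) : Achievable c r P R := by
  classical
  let Q : ℕ → ℕ → Prop := fun n j => ∃ C : BlockCode k n (numMessages n R),
    C.PowerConstraint P ∧ ∀ ν, IsTapLaw c r ν → C.errorProb ν ≤ 1 / ((j : ℝ) + 1)
  -- At level `0` the error bound is `1`, which any code meets, so a code exists at every block
  -- length. The best level not above `n` tends to infinity.
  have h0 : ∀ n, Q n 0 := fun n =>
    ⟨BlockCode.zero k n (numMessages_pos n R), BlockCode.zero_powerConstraint k n _ hP,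
      fun ν hν => by
        have := hν.prob
        simpa using BlockCode.errorProb_le_one _ ν⟩
  have hQ : ∀ n, Q n (Nat.findGreatest (Q n) n) := fun n =>
    Nat.findGreatest_spec (Nat.zero_le n) (h0 n)
  choose C hC1 hC2 using hQ
  refine ⟨hR, C, hC1, fun ν hν => ?_⟩
  refine tendsto_zero_of_eventually_le (fun n => (C n).errorProb_nonneg ν) fun δ hδ => ?_
  obtain ⟨m, hm⟩ := exists_nat_one_div_lt hδ
  filter_upwards [h (1 / ((m : ℝ) + 1)) (by positivity), eventually_ge_atTop m] with n hn hmn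
  have hle : m ≤ Nat.findGreatest (Q n) n := Nat.le_findGreatest hmn hn
  refine (hC2 n ν hν).trans (le_trans ?_ hm.le)
  gcongr

/-- At rate zero there is a single message and no error. This covers lower bounds that are not
positive. -/
theorem achievable_zero {k : ℕ} (c r : Fin (k + 1) → ℝ) {P : ℝ} (hP : 0 ≤ P) :
    Achievable c r P 0 := by
  have hM : ∀ n, numMessages n 0 = 1 := fun n => by simp [numMessages]
  have hsub : ∀ n, Subsingleton (Fin (numMessages n 0)) := fun n => by
    rw [hM n]; infer_instance
  refine ⟨le_rfl, fun n => BlockCode.zero k n (numMessages_pos n 0),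
    fun n => BlockCode.zero_powerConstraint k n _ hP, fun ν _ => ?_⟩
  have : ∀ n, (BlockCode.zero k n (numMessages_pos n 0)).errorProb ν = 0 := by
    intro n
    have := hsub n
    rw [BlockCode.errorProb, Finset.sum_eq_zero, mul_zero]
    intro w _
    have e : {p : Taps k × (Fin (n + k) → ℝ) | (BlockCode.zero k n (numMessages_pos n 0)).dec
        (output p.1 ((BlockCode.zero k n (numMessages_pos n 0)).enc w) p.2) ≠ w} = ∅ := by
      ext p
      simp [Subsingleton.elim _ w]
    rw [e, measureReal_empty]
  simp [this]

theorem lowerBound_le_capacity {k : ℕ} {c r : Fin (k + 1) → ℝ} (hr : ∀ i, 0 ≤ r i) {P : ℝ}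
    {S : ∀ n : ℕ, Matrix (Fin n) (Fin n) ℝ} (hS : ∀ n, (S n).PosDef)
    (htr : ∀ n, (S n).trace ≤ n * P)
    (hmax : Tendsto (fun n : ℕ => 1 / (n : ℝ) * lamMax (S n)) atTop (𝓝 0))
    (hphi : ∀ n, phi1 c r (S n) < 1) : lowerBound c r S ≤ capacity c r P := by
  have hP := (power_pos hS htr).le
  have hcap : ∀ {R : ℝ}, Achievable c r P R → (R : EReal) ≤ capacity c r P := fun hR =>
    le_sSup (Set.mem_image_of_mem _ hR)
  refine le_of_forall_lt fun x hx => ?_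
  -- Two real rates are inserted: the gap between them pays for the prefix, and the one from the
  -- larger rate to the bound pays for the random code.
  obtain ⟨R', hx', hR'⟩ := EReal.lt_iff_exists_real_btwn.1 hx
  obtain ⟨R, hxR, hRR⟩ := EReal.lt_iff_exists_real_btwn.1 hx'
  have hRR' : R < R' := by exact_mod_cast hRR
  refine hxR.trans_le ?_
  rcases le_or_gt R 0 with h0 | h0
  · exact le_trans (by exact_mod_cast h0) (hcap (achievable_zero c r hP))
  · exact hcap (achievable_of_forall_eventually hP h0.le fun τ hτ =>
      exists_code_of_lt_lowerBound hr hS htr hmax hphi h0 hRR' hR' hτ)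

end ISI

theorem theorem1 {k : ℕ} (hk : 1 ≤ k) (c r : Fin (k + 1) → ℝ) (hr : ∀ i, 0 ≤ r i) (P : ℝ)
    (S : ∀ n : ℕ, Matrix (Fin n) (Fin n) ℝ)
    (hS : ∀ n, (S n).PosDef)
    (htr : ∀ n, (S n).trace ≤ n * P)
    (hmax : Tendsto (fun n : ℕ => 1 / (n : ℝ) * ISI.lamMax (S n)) atTop (𝓝 0))
    (hphi : ∀ n, ISI.phi1 c r (S n) < 1) :
    ISI.lowerBound c r S ≤ ISI.capacity c r P ∧
    ∀ R : ℝ, 0 ≤ R → (R : EReal) < ISI.lowerBound c r S →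
      ∃ ε : ℝ, 0 < ε ∧ ∃ η : ℕ → ℝ, (∀ n, 0 < η n) ∧
        ∀ ν : Measure (ISI.Taps k), ISI.IsTapLaw c r ν →
          Tendsto (fun n => ISI.ensembleError c (S n) ε (η n) (ISI.numMessages n R) ν)
            atTop (𝓝 0) := by
  exact ⟨ISI.lowerBound_le_capacity hr hS htr hmax hphi,
    fun R _ hR => ISI.tendsto_ensembleError hr hS htr hmax hphi hR⟩
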